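/- **Theorem 7.3 (globally strict convexity).** *Grid and spaces.* Let $b,d>0$, $-\xi<d$, $\Omega=\{|x|,|y|<b,\ -\xi<z<d\}$, $\Gamma=\{|x|,|y|<b,\ z=-\xi\}$, and let $x_j=-b+jh$, $y_s=-b+sh$ $(0\le j,s\le n+1)$, $h=2b/(n+1)$, be a uniform grid. Nodes with $1\le j,s\le n$ are called interior, the others lateral. Let $[\underline k,\overline k]\subset(0,\infty)$, $\underline k<\overline k$. For complex-valued semidiscrete functions put $$\|f\|_{H^{m,h}}^2=\sum_{j,s}\sum_{r=0}^m h^2\int_{-\xi}^d|\partial_z^r f(x_j,y_s,z)|^2dz,\qquad \|f\|_{H_m^h}^2=\int_{\underline k}^{\overline k}\|f(\cdot,k)\|_{H^{m,h}}^2\,dk ,$$ and let $H^{m,h}$, $H_m^h$ be the corresponding real Hilbert spaces. $H_0^{2,h}\subset H^{2,h}$ and $H_{0,2}^h\subset H_2^h$ are the subspaces of the $f$ with $f|_{\partial\Omega}=0$, $f_z|_\Gamma=0$ (for a.e. $k$ in the second case), boundary values being taken at the grid points. At interior nodes let $\Delta^hf=f_{zz}+f^h_{xx}+f^h_{yy}$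 with the standard three-point second differences, and $\nabla^hf=(\partial_x^hf,\partial_y^hf,f_z)$ with central differences. All sums $\sum_{j,s}$ below are over the interior nodes. *Carleman number.* There is $\lambda_0>1$, depending only on the grid, $\xi$ and $d$, and a constant $C>0$ such that for all $\lambda\ge\lambda_0$ and $u\in H_0^{2,h}$ $$\sum_{j,s} h^2\!\int_{-\xi}^d|\Delta^hu|^2e^{-2\lambda z}dz\ \ge\ C\sum_{j,s} h^2\!\int_{-\xi}^d\big(|u_{zz}|^2+\lambda|u_z|^2+\lambda^3|u|^2\big)e^{-2\lambda z}dz ,$$ and with this $\lambda_0$ the following holds. *Functional.* For $V\in H^{2,h}$, $F\in H_3^h$, and with $a\cdot b=\sum_c a_cb_c$ (no conjugation), let $$L^h(q)=\Delta^hq+2k\Big(\nabla^hV-\int_k^{\overline k}\nabla^hq\,d\kappa\Big)\cdot\Big(k\nabla^hq+\theta(k)\nabla^hV-\int_k^{\overline k}\nabla^hq\,d\kappa\Big)+2i\Big(kq_z+V_z-\int_k^{\overline k}q_z\,d\kappa\Big),$$ where either $\theta(k)\equiv1$ or $\theta(k)=k$ (the result holds for both), and $$J_\lambda(p)=e^{2\lambda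 d}\sum_{j,s}h^2\int_{\underline k}^{\overline k}\int_{-\xi}^d|L^h(p+F)(x_j,y_s,z,k)|^2e^{-2\lambda z}\,dz\,dk,\qquad p\in H_{0,2}^h .$$ *Statement.* For every $R>0$ there are $\lambda_1\ge\lambda_0$ and $C_1>0$, depending only on $\Omega_h$ (that is, $b,d,\xi,n$), $R$, $\|F_*\|_{H_3^h}$, $\|V_*\|_{H^{2,h}}$, $\underline k,\overline k$ (and the choice of $\theta$), such that the following holds whenever $0<\delta<e^{-2(d+\xi)\lambda_1}$ and 1. $Q,Q_*,V_*\in H^{2,h}$ vanish on $\partial\Omega\setminus\Gamma$ and have the Cauchy data $(\psi_0,\psi_1)$, $(\psi_{0*},\psi_{1*})$, $(\psi_{0*},\psi_{1*})$ on $\Gamma$ (the values of the function and of its $z$-derivative), $\Delta^hV_*=0$, and $\|Q-Q_*\|_{H^{2,h}}<\delta$; 2. $F,F_*\in H_3^h$ vanish on $\partial\Omega\setminus\Gamma$, have the Cauchy data $(\phi_0,\phi_1)$ and $(\phi_{0*},\phi_{1*})$ on $\Gamma$, and $\|F-F_*\|_{H_3^h}<\delta$. With $\mu(\delta)=\ln(\delta^{-1/(2(d+\xi))})$,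 the functional $I_{\mu(\delta)}(W)=e^{2\mu(\delta) d}\sum_{j,s}h^2\int_{-\xi}^d|\Delta^hW+\Delta^hQ|^2e^{-2\mu(\delta) z}dz$ has a unique minimizer $W$ on $H_0^{2,h}$; let $V=V_{\mu(\delta)}=W+Q$ be the tail function in $L^h$. Then: (a) for every $\lambda>0$, the integrals defining $J_\lambda$ converge, and $J_\lambda$ has a Fréchet derivative $J_\lambda'(p)\in H_{0,2}^h$ (identified through the scalar product of $H_2^h$) at every $p\in H_{0,2}^h$; (b) for every $\lambda\ge\lambda_1$, $J_\lambda$ is strictly convex on $\overline{B(R)}=\{p\in H_{0,2}^h:\|p\|_{H_2^h}\le R\}$, and more precisely $$J_\lambda(p+r)-J_\lambda(p)-J_\lambda'(p)(r)\ \ge\ C_1\|r\|_{H_2^h}^2\qquad\text{for all }p,\ p+r\in\overline{B(R)} .$$ -/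

import Mathlib

open MeasureTheory Set
open scoped Matrix

noncomputable section

namespace SemiDiscrete

/-- The box `{|x|, |y| < b, -ξ < z < d}` with a uniform grid in `(x, y)`: the grid lines are
`x_j = -b + j h`, `y_s = -b + s h` for `j, s = 0, …, n + 1`, with `h = 2 b / (n + 1)`. Thus there
are `n + 2` nodes in each direction, the indices `0` and `n + 1` being on the lateral boundary. -/
structure Box where
  n : ℕ
  b : ℝ
  d : ℝ
  ξ : ℝ
  b_pos : 0 < b
  d_pos : 0 < d
  lt : -ξ < d

/-- The grid step. -/
def Box.h (G : Box) : ℝ := 2 * G.b / (G.n + 1)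

/-- All nodes of one coordinate direction. -/
abbrev Box.Node (G : Box) : Type := Fin (G.n + 2)

/-- `Fin n` enumerates the interior nodes; `mid i` is the interior node itself, `lft i` and `rgt i`
are its two neighbours. -/
def Box.mid (G : Box) (i : Fin G.n) : G.Node := i.castSucc.succ

def Box.lft (G : Box) (i : Fin G.n) : G.Node := i.castSucc.castSucc

def Box.rgt (G : Box) (i : Fin G.n) : G.Node := i.succ.succ

/-- The node `(x_j, y_s)` lies on the boundary of the square. -/
def Box.Lateral (G : Box) (j s : G.Node) : Prop :=
  j = 0 ∨ j = Fin.last (G.n + 1) ∨ s = 0 ∨ s = Fin.last (G.n + 1)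

section Spaces

variable {K : Type} [MeasurableSpace K]

/-- The measure `dz dν(k)` on `(-ξ, d) × K`, for a parameter space `(K, ν)`. -/
def Box.dom (G : Box) (ν : Measure K) : Measure (ℝ × K) :=
  (volume.restrict (Ioo (-G.ξ) G.d)).prod ν

/-- The measure `h² dz dν(k)`. -/
def Box.wt (G : Box) (ν : Measure K) : Measure (ℝ × K) :=
  ENNReal.ofReal (G.h ^ 2) • G.dom ν

/-- For almost every parameter `k`, the function `u(·, k)` is (a.e. equal to) the absolutely
continuous function with derivative `v(·, k)` and with the value `g k` at `z = a`. -/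
def Box.TraceAt (G : Box) (ν : Measure K) (a : ℝ) (u v : ℝ × K → ℂ) (g : K → ℂ) : Prop :=
  ∀ᵐ x ∂(G.dom ν), u x = g x.2 + ∫ t in a..x.1, v (t, x.2)

/-- `v = ∂_z u`: for almost every `k`, `u(·, k)` is absolutely continuous with derivative
`v(·, k)`. -/
def Box.IsZDeriv (G : Box) (ν : Measure K) (u v : ℝ × K → ℂ) : Prop :=
  ∃ c : K → ℂ, G.TraceAt ν (-G.ξ) u v c

lemma Box.wt_ae {G : Box} {ν : Measure K} {p : ℝ × K → Prop} :
    (∀ᵐ x ∂(G.wt ν), p x) ↔ ∀ᵐ x ∂(G.dom ν), p x := by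
  have hh : 0 < G.h := by
    have := G.b_pos
    unfold Box.h
    positivity
  have h0 : ENNReal.ofReal (G.h ^ 2) ≠ 0 := by
    simpa using hh.ne'
  unfold Box.wt
  rw [ae_iff, ae_iff, Measure.smul_apply, smul_eq_mul, mul_eq_zero]
  simp [h0]

lemma Box.ae_param {G : Box} {ν : Measure K} [SFinite ν] {p : K → Prop} (h : ∀ᵐ k ∂ν, p k) :
    ∀ᵐ x ∂(G.dom ν), p x.2 :=
  Measure.quasiMeasurePreserving_snd.ae h

lemma Box.ae_swap {G : Box} {ν : Measure K} [SFinite ν] {p : ℝ × K → Prop}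
    (h : ∀ᵐ x ∂(G.dom ν), p x) :
    ∀ᵐ k ∂ν, ∀ᵐ z ∂(volume.restrict (Ioo (-G.ξ) G.d)), p (z, k) := by
  have h1 : ∀ᵐ y ∂(ν.prod (volume.restrict (Ioo (-G.ξ) G.d))), p y.swap :=
    (Measure.measurePreserving_swap (μ := ν)
      (ν := volume.restrict (Ioo (-G.ξ) G.d))).quasiMeasurePreserving.ae h
  exact Measure.ae_ae_of_ae_prod h1

lemma Box.integrable_slice {G : Box} {ν : Measure K} [SFinite ν] (v : Lp ℂ 2 (G.wt ν)) :
    ∀ᵐ k ∂ν, IntegrableOn (fun z => v (z, k)) (Ioo (-G.ξ) G.d) := by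
  have hh : 0 < G.h := by
    have := G.b_pos
    unfold Box.h
    positivity
  have h0 : ENNReal.ofReal (G.h ^ 2) ≠ 0 := by
    simpa using hh.ne'
  have hm : AEStronglyMeasurable v (G.dom ν) := by
    refine (Lp.aestronglyMeasurable v).mono_ac ?_
    intro s hs
    have : G.wt ν s = 0 := hs
    unfold Box.wt at this
    rw [Measure.smul_apply, smul_eq_mul, mul_eq_zero] at this
    exact this.resolve_left h0
  have h2 : Integrable (fun x => ‖v x‖ ^ 2) (G.wt ν) := (Lp.memLp v).integrable_norm_pow (by simp)
  have h3 : Integrable (fun x => ‖v x‖ ^ 2) (G.dom ν) := by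
    unfold Box.wt at h2
    rwa [integrable_smul_measure h0 ENNReal.ofReal_ne_top] at h2
  have h4 : ∀ᵐ k ∂ν, Integrable (fun z => ‖v (z, k)‖ ^ 2) (volume.restrict (Ioo (-G.ξ) G.d)) :=
    h3.prod_left_ae
  have h5 : ∀ᵐ k ∂ν, AEStronglyMeasurable (fun z => v (z, k))
      (volume.restrict (Ioo (-G.ξ) G.d)) := by
    have := hm.prod_swap
    exact this.prodMk_left
  filter_upwards [h4, h5] with k h4 h5
  have : MemLp (fun z => v (z, k)) 2 (volume.restrict (Ioo (-G.ξ) G.d)) :=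
    (memLp_two_iff_integrable_sq_norm h5).2 h4
  exact this.integrable (by norm_num)

lemma Box.uIoc_subset {G : Box} {a z : ℝ} (ha : a ∈ Icc (-G.ξ) G.d)
    (hz : z ∈ Ioo (-G.ξ) G.d) : uIoc a z ⊆ Ioc (-G.ξ) G.d := by
  intro t ht
  rcases mem_uIoc.1 ht with h | h
  · exact ⟨lt_of_le_of_lt ha.1 h.1, h.2.trans hz.2.le⟩
  · exact ⟨lt_trans hz.1 h.1, h.2.trans ha.2⟩

lemma Box.ae_mem {G : Box} {ν : Measure K} [SFinite ν] :
    ∀ᵐ x ∂(G.dom ν), x.1 ∈ Ioo (-G.ξ) G.d :=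
  Measure.quasiMeasurePreserving_fst.ae (ae_restrict_mem measurableSet_Ioo)

lemma Box.TraceAt.add {G : Box} {ν : Measure K} [SFinite ν] {a : ℝ}
    (ha : a ∈ Icc (-G.ξ) G.d) {u v u' v' : Lp ℂ 2 (G.wt ν)} {g g' : K → ℂ}
    (h : G.TraceAt ν a u v g) (h' : G.TraceAt ν a u' v' g') :
    G.TraceAt ν a (u + u' : Lp ℂ 2 (G.wt ν)) (v + v' : Lp ℂ 2 (G.wt ν)) (g + g') := by
  have hu := Box.wt_ae.1 (Lp.coeFn_add u u')
  have hv := Box.ae_param (G := G) (Box.ae_swap (Box.wt_ae.1 (Lp.coeFn_add v v')))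
  have i1 := Box.ae_param (G := G) (Box.integrable_slice v)
  have i2 := Box.ae_param (G := G) (Box.integrable_slice v')
  unfold Box.TraceAt at *
  filter_upwards [h, h', hu, hv, i1, i2, Box.ae_mem (G := G) (ν := ν)]
    with x h h' hu hv i1 i2 hx
  have hs := Box.uIoc_subset ha hx
  rw [← integrableOn_Ioc_iff_integrableOn_Ioo] at i1 i2
  rw [restrict_Ioo_eq_restrict_Ioc] at hv
  have e : ∫ t in a..x.1, (v + v' : Lp ℂ 2 (G.wt ν)) (t, x.2)
      = ∫ t in a..x.1, (v (t, x.2) + v' (t, x.2)) := by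
    apply intervalIntegral.integral_congr_ae
    have := (ae_restrict_iff' measurableSet_Ioc).1 hv
    filter_upwards [this] with t ht htm
    exact ht (hs htm)
  rw [hu, e, intervalIntegral.integral_add
    (intervalIntegrable_iff.2 (i1.mono_set hs)) (intervalIntegrable_iff.2 (i2.mono_set hs))]
  simp only [Pi.add_apply]
  rw [h, h']
  ring

lemma Box.TraceAt.smul {G : Box} {ν : Measure K} [SFinite ν] {a : ℝ}
    (ha : a ∈ Icc (-G.ξ) G.d) {u v : Lp ℂ 2 (G.wt ν)} {g : K → ℂ} (c : ℝ)
    (h : G.TraceAt ν a u v g) :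
    G.TraceAt ν a (c • u : Lp ℂ 2 (G.wt ν)) (c • v : Lp ℂ 2 (G.wt ν)) (c • g) := by
  have hu := Box.wt_ae.1 (Lp.coeFn_smul c u)
  have hv := Box.ae_param (G := G) (Box.ae_swap (Box.wt_ae.1 (Lp.coeFn_smul c v)))
  unfold Box.TraceAt at *
  filter_upwards [h, hu, hv, Box.ae_mem (G := G) (ν := ν)] with x h hu hv hx
  have hs := Box.uIoc_subset ha hx
  rw [restrict_Ioo_eq_restrict_Ioc] at hv
  have e : ∫ t in a..x.1, (c • v : Lp ℂ 2 (G.wt ν)) (t, x.2)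
      = ∫ t in a..x.1, c • v (t, x.2) := by
    apply intervalIntegral.integral_congr_ae
    have := (ae_restrict_iff' measurableSet_Ioc).1 hv
    filter_upwards [this] with t ht htm
    exact ht (hs htm)
  rw [hu, e, intervalIntegral.integral_smul]
  simp only [Pi.smul_apply]
  rw [h, smul_add]

lemma Box.TraceAt.zero {G : Box} {ν : Measure K} [SFinite ν] {a : ℝ}
    (ha : a ∈ Icc (-G.ξ) G.d) :
    G.TraceAt ν a (0 : Lp ℂ 2 (G.wt ν)) (0 : Lp ℂ 2 (G.wt ν)) 0 := by
  have hu := Box.wt_ae.1 (Lp.coeFn_zero ℂ 2 (G.wt ν))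
  have hv := Box.ae_param (G := G) (Box.ae_swap hu)
  unfold Box.TraceAt
  filter_upwards [hu, hv, Box.ae_mem (G := G) (ν := ν)] with x hu hv hx
  have hs := Box.uIoc_subset ha hx
  rw [restrict_Ioo_eq_restrict_Ioc] at hv
  have e : ∫ t in a..x.1, (0 : Lp ℂ 2 (G.wt ν)) (t, x.2) = ∫ t in a..x.1, (0 : ℂ) := by
    apply intervalIntegral.integral_congr_ae
    have := (ae_restrict_iff' measurableSet_Ioc).1 hv
    filter_upwards [this] with t ht htm
    exact ht (hs htm)
  rw [hu, e]
  simp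

lemma Box.TraceAt.add₀ {G : Box} {ν : Measure K} [SFinite ν] {a : ℝ}
    (ha : a ∈ Icc (-G.ξ) G.d) {u v u' v' : Lp ℂ 2 (G.wt ν)}
    (h : G.TraceAt ν a u v 0) (h' : G.TraceAt ν a u' v' 0) :
    G.TraceAt ν a (u + u' : Lp ℂ 2 (G.wt ν)) (v + v' : Lp ℂ 2 (G.wt ν)) 0 := by
  have e := h.add ha h'
  rwa [add_zero] at e

lemma Box.TraceAt.smul₀ {G : Box} {ν : Measure K} [SFinite ν] {a : ℝ}
    (ha : a ∈ Icc (-G.ξ) G.d) {u v : Lp ℂ 2 (G.wt ν)} (c : ℝ)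
    (h : G.TraceAt ν a u v 0) :
    G.TraceAt ν a (c • u : Lp ℂ 2 (G.wt ν)) (c • v : Lp ℂ 2 (G.wt ν)) 0 := by
  have e := h.smul ha c
  rwa [smul_zero] at e

lemma Box.left_mem (G : Box) : -G.ξ ∈ Icc (-G.ξ) G.d := ⟨le_rfl, G.lt.le⟩

lemma Box.right_mem (G : Box) : G.d ∈ Icc (-G.ξ) G.d := ⟨G.lt.le, le_rfl⟩

/-- Semidiscrete complex-valued functions `f(x_j, y_s, z, k)` with `k` in the measure space
`(K, ν)`, which together with their `z`-derivatives up to the order `m` are square integrable: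
an element is the family `(∂_z^r f(x_j, y_s, ·, ·))_{j, s, r}`, and its norm is given by
`‖f‖² = ∑_{j,s} ∑_{r ≤ m} h² ∫_K ∫_{-ξ}^d |∂_z^r f(x_j, y_s, z, k)|² dz dν(k)`.
Complex-valued functions are pairs of real ones, so this is a real inner product space. -/
def Sob (G : Box) (ν : Measure K) [SFinite ν] (m : ℕ) :
    Submodule ℝ (PiLp 2 (fun _ : G.Node × G.Node × Fin (m + 1) => Lp ℂ 2 (G.wt ν))) where
  carrier := {f | ∀ j s, ∀ r : Fin m, G.IsZDeriv ν (f (j, s, r.castSucc)) (f (j, s, r.succ))}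
  add_mem' := by
    intro f f' hf hf' j s r
    obtain ⟨c, hc⟩ := hf j s r
    obtain ⟨c', hc'⟩ := hf' j s r
    exact ⟨c + c', hc.add G.left_mem hc'⟩
  zero_mem' := by
    intro j s r
    exact ⟨0, Box.TraceAt.zero G.left_mem⟩
  smul_mem' := by
    intro a f hf j s r
    obtain ⟨c, hc⟩ := hf j s r
    exact ⟨a • c, hc.smul G.left_mem a⟩

/-- `zD f r j s` is the function `(z, k) ↦ ∂_z^r f(x_j, y_s, z, k)`. -/
def zD {G : Box} {ν : Measure K} [SFinite ν] {m : ℕ} (f : Sob G ν m) (r : Fin (m + 1))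
    (j s : G.Node) : ℝ × K → ℂ :=
  ((f : PiLp 2 (fun _ : G.Node × G.Node × Fin (m + 1) => Lp ℂ 2 (G.wt ν))) (j, s, r) :
    Lp ℂ 2 (G.wt ν))

/-- The embedding of the space of order `m + 1` into the space of order `m`. -/
def trunc {G : Box} {ν : Measure K} [SFinite ν] {m : ℕ} (f : Sob G ν (m + 1)) : Sob G ν m :=
  ⟨WithLp.toLp 2 (fun a =>
    (f : PiLp 2 (fun _ : G.Node × G.Node × Fin (m + 2) => Lp ℂ 2 (G.wt ν)))
      (a.1, a.2.1, a.2.2.castSucc)), by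
    intro j s r
    exact f.2 j s r.castSucc⟩

/-- The boundary conditions `f = φ₀`, `∂_z f = φ₁` on the face `Γ = {|x|, |y| < b, z = -ξ}` and
`f = 0` on the rest of the boundary (the face `z = d` and the lateral faces). -/
def HasBC {G : Box} {ν : Measure K} [SFinite ν] (f : Sob G ν 2)
    (φ₀ φ₁ : Fin G.n → Fin G.n → K → ℂ) : Prop :=
  (∀ i l, G.TraceAt ν (-G.ξ) (zD f 0 (G.mid i) (G.mid l)) (zD f 1 (G.mid i) (G.mid l)) (φ₀ i l)) ∧
  (∀ i l, G.TraceAt ν (-G.ξ) (zD f 1 (G.mid i) (G.mid l)) (zD f 2 (G.mid i) (G.mid l)) (φ₁ i l)) ∧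
  (∀ i l, G.TraceAt ν G.d (zD f 0 (G.mid i) (G.mid l)) (zD f 1 (G.mid i) (G.mid l)) 0) ∧
  (∀ j s, G.Lateral j s → ∀ᵐ x ∂(G.dom ν), zD f 0 j s x = 0)

/-- The subspace given by `f = 0` on the whole boundary and `∂_z f = 0` on `Γ`. -/
def Sob₀ (G : Box) (ν : Measure K) [SFinite ν] : Submodule ℝ (Sob G ν 2) where
  carrier := {f | HasBC f 0 0}
  add_mem' := by
    rintro f f' ⟨h1, h2, h3, h4⟩ ⟨h1', h2', h3', h4'⟩
    refine ⟨fun i l => ?_, fun i l => ?_, fun i l => ?_, fun j s hjs => ?_⟩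
    · exact Box.TraceAt.add₀ G.left_mem (h1 i l) (h1' i l)
    · exact Box.TraceAt.add₀ G.left_mem (h2 i l) (h2' i l)
    · exact Box.TraceAt.add₀ G.right_mem (h3 i l) (h3' i l)
    · have hu := Box.wt_ae.1 (Lp.coeFn_add (f.1 (j, s, 0)) (f'.1 (j, s, 0)))
      filter_upwards [hu, h4 j s hjs, h4' j s hjs] with x hx h h'
      refine hx.trans ?_
      have e : zD f 0 j s x + zD f' 0 j s x = 0 := by rw [h, h', add_zero]
      exact e
  zero_mem' := by
    refine ⟨fun i l => ?_, fun i l => ?_, fun i l => ?_, fun j s hjs => ?_⟩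
    · exact Box.TraceAt.zero G.left_mem
    · exact Box.TraceAt.zero G.left_mem
    · exact Box.TraceAt.zero G.right_mem
    · exact Box.wt_ae.1 (Lp.coeFn_zero ℂ 2 (G.wt ν))
  smul_mem' := by
    rintro c f ⟨h1, h2, h3, h4⟩
    refine ⟨fun i l => ?_, fun i l => ?_, fun i l => ?_, fun j s hjs => ?_⟩
    · exact Box.TraceAt.smul₀ G.left_mem c (h1 i l)
    · exact Box.TraceAt.smul₀ G.left_mem c (h2 i l)
    · exact Box.TraceAt.smul₀ G.right_mem c (h3 i l)
    · have hu := Box.wt_ae.1 (Lp.coeFn_smul c (f.1 (j, s, 0)))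
      filter_upwards [hu, h4 j s hjs] with x hx h
      refine hx.trans ?_
      have e : c • zD f 0 j s x = 0 := by rw [h, smul_zero]
      exact e

/-- The semidiscrete Laplacian `f_zz + f_xx^h + f_yy^h` at the interior node `(i, l)`. -/
def lap {G : Box} {ν : Measure K} [SFinite ν] (f : Sob G ν 2) (i l : Fin G.n)
    (x : ℝ × K) : ℂ :=
  zD f 2 (G.mid i) (G.mid l) x
    + (zD f 0 (G.lft i) (G.mid l) x - 2 * zD f 0 (G.mid i) (G.mid l) x
        + zD f 0 (G.rgt i) (G.mid l) x) / (G.h : ℂ) ^ 2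
    + (zD f 0 (G.mid i) (G.lft l) x - 2 * zD f 0 (G.mid i) (G.mid l) x
        + zD f 0 (G.mid i) (G.rgt l) x) / (G.h : ℂ) ^ 2

/-- The semidiscrete gradient `(∂_x^h f, ∂_y^h f, ∂_z f)` at the interior node `(i, l)`. -/
def grad {G : Box} {ν : Measure K} [SFinite ν] (f : Sob G ν 2) (i l : Fin G.n)
    (x : ℝ × K) : Fin 3 → ℂ :=
  ![(zD f 0 (G.rgt i) (G.mid l) x - zD f 0 (G.lft i) (G.mid l) x) / (2 * (G.h : ℂ)),
    (zD f 0 (G.mid i) (G.rgt l) x - zD f 0 (G.mid i) (G.lft l) x) / (2 * (G.h : ℂ)),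
    zD f 1 (G.mid i) (G.mid l) x]

end Spaces

/-- Semidiscrete functions `f(x_j, y_s, z)` without parameter: the space `H^{m,h}(Ω_h)`. -/
abbrev HΩ (G : Box) (m : ℕ) : Type := Sob G (Measure.dirac ()) m

/-- The space `H_0^{2,h}(Ω_h)`. -/
abbrev HΩ₀ (G : Box) : Type := Sob₀ G (Measure.dirac ())

/-- Semidiscrete functions `f(x_j, y_s, z, k)`, `k ∈ (k₁, k₂)`: the space `H_m^h`. -/
abbrev HK (G : Box) (k₁ k₂ : ℝ) (m : ℕ) : Type := Sob G (volume.restrict (Ioo k₁ k₂)) m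

/-- The space `H_{0,2}^h`. -/
abbrev HK₀ (G : Box) (k₁ k₂ : ℝ) : Type := Sob₀ G (volume.restrict (Ioo k₁ k₂))

/-- `∑ h² ∫ |u(x_i, y_l, z)|² e^{-2λz} dz`, the sum over the interior nodes. -/
def weightedSq (G : Box) (lam : ℝ) (u : Fin G.n → Fin G.n → ℝ × Unit → ℂ) : ℝ :=
  ∑ i, ∑ l, G.h ^ 2 *
    ∫ x, ‖u i l x‖ ^ 2 * Real.exp (-2 * lam * x.1) ∂(G.dom (Measure.dirac ()))

/-- The Carleman estimate for `Δ^h` with the weight `e^{-2λz}` and the constant `C`. -/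
def CarlemanEstimate (G : Box) (C lam : ℝ) : Prop :=
  ∀ u : HΩ₀ G,
    C * weightedSq G lam (fun i l => zD u.1 2 (G.mid i) (G.mid l))
      + C * lam * weightedSq G lam (fun i l => zD u.1 1 (G.mid i) (G.mid l))
      + C * lam ^ 3 * weightedSq G lam (fun i l => zD u.1 0 (G.mid i) (G.mid l))
    ≤ weightedSq G lam (lap u.1)

/-- The functional `I_μ(W)` for the tail function. -/
def tailCost (G : Box) (Q : HΩ G 2) (μ : ℝ) (W : HΩ₀ G) : ℝ :=
  Real.exp (2 * μ * G.d) * weightedSq G μ (fun i l x => lap W.1 i l x + lap Q i l x)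

/-- The choice `μ(δ) = ln(δ^{-1/(2(d+ξ))})`. -/
def tailParam (G : Box) (δ : ℝ) : ℝ :=
  Real.log (δ ^ (-(1 / (2 * (G.d + G.ξ)))))

/-- The semidiscrete integro-differential operator
`L^h(q) = Δ^h q + 2k (∇^h V - ∫_k^{k₂} ∇^h q dκ) · (k ∇^h q + θ(k) ∇^h V - ∫_k^{k₂} ∇^h q dκ)
  + 2i (k q_z + V_z - ∫_k^{k₂} q_z dκ)`
at the interior node `(i, l)` and the point `x = (z, k)`; `a · b = ∑ a_c b_c` without
conjugation. -/
def Lop (G : Box) (k₁ k₂ : ℝ) (θ : ℝ → ℝ) (V : HΩ G 2) (q : HK G k₁ k₂ 2) (i l : Fin G.n)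
    (x : ℝ × ℝ) : ℂ :=
  let gV : Fin 3 → ℂ := grad V i l (x.1, ())
  let gq : Fin 3 → ℂ := grad q i l x
  let S : Fin 3 → ℂ := fun c => ∫ κ in x.2..k₂, grad q i l (x.1, κ) c
  lap q i l x
    + 2 * (x.2 : ℂ) * ((gV - S) ⬝ᵥ ((x.2 : ℂ) • gq + (θ x.2 : ℂ) • gV - S))
    + 2 * Complex.I * ((x.2 : ℂ) * gq 2 + gV 2 - S 2)

/-- The integrand `|L^h(p + F)|² e^{-2λz}` of the cost functional. -/
def costDensity (G : Box) (k₁ k₂ : ℝ) (θ : ℝ → ℝ) (V : HΩ G 2) (F : HK G k₁ k₂ 3) (lam : ℝ)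
    (p : HK₀ G k₁ k₂) (i l : Fin G.n) (x : ℝ × ℝ) : ℝ :=
  ‖Lop G k₁ k₂ θ V (p.1 + trunc F) i l x‖ ^ 2 * Real.exp (-2 * lam * x.1)

/-- The weighted cost functional `J_λ(p)`. -/
def cost (G : Box) (k₁ k₂ : ℝ) (θ : ℝ → ℝ) (V : HΩ G 2) (F : HK G k₁ k₂ 3) (lam : ℝ)
    (p : HK₀ G k₁ k₂) : ℝ :=
  Real.exp (2 * lam * G.d) * ∑ i, ∑ l, G.h ^ 2 *
    ∫ x, costDensity G k₁ k₂ θ V F lam p i l x ∂(G.dom (volume.restrict (Ioo k₁ k₂)))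

/-- `J` is Fréchet differentiable at `p`, and its derivative is `r ↦ ⟨X, r⟩`. -/
def HasFrechetGrad {E : Type*} [NormedAddCommGroup E] [InnerProductSpace ℝ E] (J : E → ℝ)
    (X p : E) : Prop :=
  HasFDerivAt J (innerSL ℝ X) p

end SemiDiscrete

end

noncomputable section

namespace SemiDiscrete

/-! ### Weighted estimates for primitives on an interval -/

section OneDimensional

/-! Everything rests on a one-dimensional fact. The weight `e^{-2λz}` decays away from `Γ`, and an
element `u` of `Sob₀` vanishes on `Γ` together with `u_z`, so `u_z` and `u` are primitives starting
at `z = -ξ`. Writing `e^{-λz} = e^{-λt} e^{-λ(z-t)}` under the integral, Cauchy–Schwarz bounds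
`|u_z|² e^{-2λz}`, pointwise in `z`, by `(2λ)⁻¹ ∫ |u_zz|² e^{-2λt} dt`. A second integration gains a
further `λ⁻²` for `|u|²` (`weighted_sq_norm_primitive_le`, `weighted_norm_primitive_le`). The grid
is fixed, so the second differences are bounded operators and `Δ^h u` is `u_zz` plus a term that is
small for large `λ`. Absorbing it gives `mass_le_lapMass`, the core of the Carleman estimate. The
argument works for any parameter measure, so it serves both the tail problem (a Dirac measure) and
the functions of `(z, k)`.

The tail functional is a quadratic residual. The parallelogram law and the Carleman estimate make it
strongly convex, which gives the unique minimizer. To bound `V = W + Q` (`norm_tail_le`), compare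
`W` with `W_* = V_* - Q_*`. As `Δ^h V_* = 0`, its residual is that of `Q - Q_*`, at most a constant
times `δ²` times the maximum of the weight. The loss `e^{2μ(d+ξ)}` in passing from weighted to
unweighted norms equals `1/δ` by the choice of `μ(δ)`, so `‖W - W_*‖²` is at most a constant times
`δ`.

For the convexity put `q = p + F`. Then `L^h(q + r) = L^h(q) + Δ^h r + P` exactly, where `P`
contains only first order terms of `r`. If `A` is the part of `P` linear in `r`, the remainder of
`|L^h|²` is `|Δ^h r + P|² + 2⟨L^h(q), P - A⟩`. After weighting and integration, `P` and `P - A` cost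
only `O(1/λ)` times the weighted integral of `|r_zz|²`. This uses that `∫_k^{k₂} ∇^h r dκ` is
bounded in `k` while `∇^h r` is merely square integrable in `k`, and that `P - A` contains no
product of two factors `∇^h r`. For large `λ` the term `½|Δ^h r|²` absorbs everything, and since
`e^{-2λz} ≥ e^{-2λd}`, the prefactor `e^{2λd}` makes the constant independent of `λ`
(`Coeff.convex_estimate`).

For fixed `λ` the remainder is also `O(‖r‖²)` from above. With the Riesz theorem on the complete
space `Sob₀` this gives the Fréchet derivative. -/

lemma integral_mul_sq_le {α : Type*} [MeasurableSpace α] {μ : Measure α} {f g : α → ℝ}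
    (hf : MemLp f 2 μ) (hg : MemLp g 2 μ) (hf0 : ∀ x, 0 ≤ f x) (hg0 : ∀ x, 0 ≤ g x) :
    (∫ x, f x * g x ∂μ) ^ 2 ≤ (∫ x, f x ^ 2 ∂μ) * ∫ x, g x ^ 2 ∂μ := by
  have h := integral_mul_le_Lp_mul_Lq_of_nonneg (μ := μ) (p := 2) (q := 2)
    Real.HolderConjugate.two_two (f := f) (g := g) (.of_forall hf0) (.of_forall hg0)
    (by simpa using hf) (by simpa using hg)
  simp only [Real.rpow_two, ← Real.sqrt_eq_rpow] at h
  have h0 : 0 ≤ ∫ x, f x * g x ∂μ := integral_nonneg fun x => mul_nonneg (hf0 x) (hg0 x)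
  have hF : 0 ≤ ∫ x, f x ^ 2 ∂μ := integral_nonneg fun x => sq_nonneg _
  have hG : 0 ≤ ∫ x, g x ^ 2 ∂μ := integral_nonneg fun x => sq_nonneg _
  calc (∫ x, f x * g x ∂μ) ^ 2
      ≤ (√(∫ x, f x ^ 2 ∂μ) * √(∫ x, g x ^ 2 ∂μ)) ^ 2 := pow_le_pow_left₀ h0 h 2
    _ = _ := by rw [mul_pow, Real.sq_sqrt hF, Real.sq_sqrt hG]

lemma sq_setIntegral_norm_le {a b : ℝ} {g : ℝ → ℂ} (hgm : Measurable g)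
    (hg : IntegrableOn (fun t => ‖g t‖ ^ 2) (Ioo a b)) (hab : a < b) :
    (∫ t in Ioo a b, ‖g t‖) ^ 2 ≤ (b - a) * ∫ t in Ioo a b, ‖g t‖ ^ 2 := by
  have h1 : MemLp (fun t => ‖g t‖) 2 (volume.restrict (Ioo a b)) :=
    (memLp_two_iff_integrable_sq hgm.norm.aestronglyMeasurable).2 hg
  have h2 : MemLp (fun _ : ℝ => (1 : ℝ)) 2 (volume.restrict (Ioo a b)) := memLp_const 1
  have h := integral_mul_sq_le h2 h1 (fun _ => zero_le_one) (fun _ => norm_nonneg _)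
  simpa [hab.le] using h

lemma integrableOn_of_sq {a b : ℝ} {g : ℝ → ℂ} (hgm : Measurable g)
    (hg : IntegrableOn (fun t => ‖g t‖ ^ 2) (Ioo a b)) : IntegrableOn g (Ioo a b) := by
  have : MemLp g 2 (volume.restrict (Ioo a b)) :=
    (memLp_two_iff_integrable_sq_norm hgm.aestronglyMeasurable).2 hg
  exact this.integrable (by norm_num)

lemma sq_norm_intervalIntegral_le {a b y z : ℝ} {g : ℝ → ℂ} (hgm : Measurable g)
    (hg : IntegrableOn (fun t => ‖g t‖ ^ 2) (Ioo a b)) (hab : a < b)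
    (hy : y ∈ Icc a b) (hz : z ∈ Icc a b) :
    ‖∫ t in y..z, g t‖ ^ 2 ≤ (b - a) * ∫ t in Ioo a b, ‖g t‖ ^ 2 := by
  refine le_trans (pow_le_pow_left₀ (norm_nonneg _) ?_ 2) (sq_setIntegral_norm_le hgm hg hab)
  refine intervalIntegral.norm_integral_le_integral_norm_uIoc.trans ?_
  rw [← integral_Ioc_eq_integral_Ioo]
  refine setIntegral_mono_set ?_ (.of_forall fun _ => norm_nonneg _)
    (LE.le.eventuallyLE ?_)
  · rw [integrableOn_Ioc_iff_integrableOn_Ioo]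
    exact (integrableOn_of_sq hgm hg).norm
  · intro t ht
    rcases mem_uIoc.1 ht with h | h
    · exact ⟨lt_of_le_of_lt hy.1 h.1, h.2.trans hz.2⟩
    · exact ⟨lt_of_le_of_lt hz.1 h.1, h.2.trans hy.2⟩

lemma setIntegral_exp_le {a z lam : ℝ} (hl : 0 < lam) (haz : a ≤ z) :
    ∫ t in Ioo a z, Real.exp (-lam * (z - t)) ≤ 1 / lam := by
  rw [← integral_Ioc_eq_integral_Ioo, ← intervalIntegral.integral_of_le haz]
  have hd : ∀ t ∈ uIcc a z, HasDerivAt (fun t => Real.exp (-lam * (z - t)) / lam)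
      (Real.exp (-lam * (z - t))) t := by
    intro t _
    have h1 : HasDerivAt (fun t => -lam * (z - t)) lam t := by
      simpa using ((hasDerivAt_id t).const_sub z).const_mul (-lam)
    have h2 := h1.exp.div_const lam
    rwa [mul_div_assoc, div_self hl.ne', mul_one] at h2
  rw [intervalIntegral.integral_eq_sub_of_hasDerivAt hd
    (Continuous.intervalIntegrable (by fun_prop) _ _)]
  simp only [sub_self, mul_zero, Real.exp_zero]
  have : 0 ≤ Real.exp (-lam * (z - a)) / lam := by positivity
  linarith

lemma integrableOn_sq_mul_exp {a b lam : ℝ} {g : ℝ → ℂ}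
    (hg : IntegrableOn (fun t => ‖g t‖ ^ 2) (Ioo a b)) :
    IntegrableOn (fun t => ‖g t‖ ^ 2 * Real.exp (-2 * lam * t)) (Ioo a b) := by
  have hc : Continuous fun t : ℝ => Real.exp (-2 * lam * t) := by fun_prop
  rw [← integrableOn_Icc_iff_integrableOn_Ioo] at hg ⊢
  exact hg.mul_continuousOn hc.continuousOn isCompact_Icc

/-- The weighted bound for a primitive that vanishes at the left end point. -/
lemma weighted_sq_norm_primitive_le {a b z lam : ℝ} {g : ℝ → ℂ} (hgm : Measurable g)
    (hg : IntegrableOn (fun t => ‖g t‖ ^ 2) (Ioo a b)) (hl : 0 < lam) (hz : z ∈ Ioo a b) :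
    (‖∫ t in a..z, g t‖ * Real.exp (-lam * z)) ^ 2
      ≤ 1 / (2 * lam) * ∫ t in Ioo a b, ‖g t‖ ^ 2 * Real.exp (-2 * lam * t) := by
  have hsub : Ioo a z ⊆ Ioo a b := Ioo_subset_Ioo_right hz.2.le
  have hgz : IntegrableOn (fun t => ‖g t‖ ^ 2) (Ioo a z) := hg.mono_set hsub
  have e1 : ∀ t, (‖g t‖ * Real.exp (-lam * t)) ^ 2 = ‖g t‖ ^ 2 * Real.exp (-2 * lam * t) := by
    intro t
    rw [mul_pow, ← Real.exp_nat_mul]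
    congr 2
    push_cast
    ring
  have e2 : ∀ t, Real.exp (-lam * (z - t)) ^ 2 = Real.exp (-(2 * lam) * (z - t)) := by
    intro t
    rw [← Real.exp_nat_mul]
    congr 1
    push_cast
    ring
  have h1 : MemLp (fun t => ‖g t‖ * Real.exp (-lam * t)) 2 (volume.restrict (Ioo a z)) := by
    refine (memLp_two_iff_integrable_sq ?_).2 ?_
    · exact (hgm.norm.mul (by fun_prop)).aestronglyMeasurable
    · simp only [e1]
      exact integrableOn_sq_mul_exp hgz
  have h2 : MemLp (fun t => Real.exp (-lam * (z - t))) 2 (volume.restrict (Ioo a z)) := by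
    refine (memLp_two_iff_integrable_sq ?_).2 ?_
    · exact Continuous.aestronglyMeasurable (by fun_prop)
    · simp only [e2]
      have : IntegrableOn (fun t => Real.exp (-(2 * lam) * (z - t))) (Icc a z) :=
        Continuous.integrableOn_Icc (by fun_prop)
      exact this.mono_set Ioo_subset_Icc_self
  have hcs := integral_mul_sq_le h1 h2 (fun t => by positivity) (fun t => by positivity)
  simp only [e1, e2] at hcs
  -- Moving the weight under the integral leaves the kernel `e^{-λ(z-t)}`, whose squared `L²` norm
  -- is at most `1/(2λ)`. This is the source of the gain.
  have h3 : ‖∫ t in a..z, g t‖ * Real.exp (-lam * z)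
      ≤ ∫ t in Ioo a z, ‖g t‖ * Real.exp (-lam * t) * Real.exp (-lam * (z - t)) := by
    have h4 : ‖∫ t in a..z, g t‖ ≤ ∫ t in Ioo a z, ‖g t‖ := by
      rw [← integral_Ioc_eq_integral_Ioo, ← intervalIntegral.integral_of_le hz.1.le]
      exact intervalIntegral.norm_integral_le_integral_norm hz.1.le
    calc _ ≤ (∫ t in Ioo a z, ‖g t‖) * Real.exp (-lam * z) := by gcongr
      _ = ∫ t in Ioo a z, ‖g t‖ * Real.exp (-lam * z) := by rw [integral_mul_const]
      _ = _ := by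
        congr 1
        ext t
        rw [mul_assoc, ← Real.exp_add]
        congr 2
        ring
  have h5 := setIntegral_exp_le (lam := 2 * lam) (by positivity) hz.1.le
  have h6 : ∫ t in Ioo a z, ‖g t‖ ^ 2 * Real.exp (-2 * lam * t)
      ≤ ∫ t in Ioo a b, ‖g t‖ ^ 2 * Real.exp (-2 * lam * t) :=
    setIntegral_mono_set (integrableOn_sq_mul_exp hg) (.of_forall fun t => by positivity)
      (LE.le.eventuallyLE hsub)
  have h7 : 0 ≤ ∫ t in Ioo a b, ‖g t‖ ^ 2 * Real.exp (-2 * lam * t) :=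
    integral_nonneg fun t => by positivity
  calc _ ≤ (∫ t in Ioo a z, ‖g t‖ * Real.exp (-lam * t) * Real.exp (-lam * (z - t))) ^ 2 :=
        pow_le_pow_left₀ (by positivity) h3 2
    _ ≤ _ := hcs
    _ ≤ (∫ t in Ioo a b, ‖g t‖ ^ 2 * Real.exp (-2 * lam * t)) * (1 / (2 * lam)) := by
        refine mul_le_mul h6 h5 (integral_nonneg fun t => by positivity) h7
    _ = _ := mul_comm _ _

/-- A pointwise weighted bound improves by `1 / lam` under integration. -/
lemma weighted_norm_primitive_le {a b z lam c : ℝ} {g : ℝ → ℂ}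
    (hg : ∀ᵐ t ∂(volume.restrict (Ioo a b)), ‖g t‖ * Real.exp (-lam * t) ≤ c)
    (hl : 0 < lam) (hz : z ∈ Ioo a b) (hc : 0 ≤ c) :
    ‖∫ t in a..z, g t‖ * Real.exp (-lam * z) ≤ c / lam := by
  have hsub : Ioo a z ⊆ Ioo a b := Ioo_subset_Ioo_right hz.2.le
  have hg' := ae_restrict_of_ae_restrict_of_subset hsub hg
  have hi : IntegrableOn (fun t => c * Real.exp (lam * z) * Real.exp (-lam * (z - t)))
      (Ioo a z) := by
    have : IntegrableOn (fun t => c * Real.exp (lam * z) * Real.exp (-lam * (z - t)))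
      (Icc a z) := Continuous.integrableOn_Icc (by fun_prop)
    exact this.mono_set Ioo_subset_Icc_self
  have h1 : ‖∫ t in a..z, g t‖
      ≤ ∫ t in Ioo a z, c * Real.exp (lam * z) * Real.exp (-lam * (z - t)) := by
    rw [intervalIntegral.integral_of_le hz.1.le, integral_Ioc_eq_integral_Ioo]
    refine norm_integral_le_of_norm_le hi ?_
    filter_upwards [hg'] with t ht
    have e : Real.exp (lam * z) * Real.exp (-lam * (z - t)) * Real.exp (-lam * t) = 1 := by
      rw [← Real.exp_add, ← Real.exp_add, Real.exp_eq_one_iff]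
      ring
    refine le_of_mul_le_mul_right (ht.trans (le_of_eq ?_)) (Real.exp_pos (-lam * t))
    rw [mul_assoc c, mul_assoc c, e, mul_one]
  rw [integral_const_mul] at h1
  have h2 := setIntegral_exp_le hl hz.1.le
  have e : Real.exp (lam * z) * Real.exp (-lam * z) = 1 := by
    rw [← Real.exp_add, Real.exp_eq_one_iff]
    ring
  calc _ ≤ c * Real.exp (lam * z) * (1 / lam) * Real.exp (-lam * z) := by
        gcongr
        exact h1.trans (by gcongr)
    _ = c / lam * (Real.exp (lam * z) * Real.exp (-lam * z)) := by ring
    _ = c / lam := by rw [e, mul_one]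

/-- The Sobolev embedding in one variable. -/
lemma sq_norm_le_of_primitive {a b : ℝ} {u v : ℝ → ℂ} {c : ℂ} (hab : a < b)
    (hvm : Measurable v)
    (hu : IntegrableOn (fun t => ‖u t‖ ^ 2) (Ioo a b))
    (hv : IntegrableOn (fun t => ‖v t‖ ^ 2) (Ioo a b))
    (h : ∀ᵐ z ∂(volume.restrict (Ioo a b)), u z = c + ∫ t in a..z, v t) :
    ∀ᵐ z ∂(volume.restrict (Ioo a b)),
      ‖u z‖ ^ 2 ≤ 2 / (b - a) * (∫ t in Ioo a b, ‖u t‖ ^ 2)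
        + 2 * (b - a) * ∫ t in Ioo a b, ‖v t‖ ^ 2 := by
  have hba : 0 < b - a := sub_pos.2 hab
  have hvi : IntegrableOn v (Ioc a b) := by
    rw [integrableOn_Ioc_iff_integrableOn_Ioo]
    exact integrableOn_of_sq hvm hv
  have hii : ∀ z ∈ Ioo a b, IntervalIntegrable v volume a z := by
    intro z hz
    rw [intervalIntegrable_iff, uIoc_of_le hz.1.le]
    exact hvi.mono_set (Ioc_subset_Ioc_right hz.2.le)
  set B := ∫ t in Ioo a b, ‖v t‖ ^ 2 with hB
  filter_upwards [h, ae_restrict_mem measurableSet_Ioo] with z hz hzm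
  -- Compare `u z` with `u y` and average over `y`. The constant `c`, about which nothing is known,
  -- cancels in the difference.
  have h1 : ∀ᵐ y ∂(volume.restrict (Ioo a b)), ‖u z‖ ^ 2 ≤ 2 * ‖u y‖ ^ 2 + 2 * ((b - a) * B) := by
    filter_upwards [h, ae_restrict_mem measurableSet_Ioo] with y hy hym
    have e : u z = u y + ∫ t in y..z, v t := by
      rw [hz, hy, add_assoc, intervalIntegral.integral_add_adjacent_intervals (hii y hym)
        ((hii y hym).symm.trans (hii z hzm))]
    have h2 := sq_norm_intervalIntegral_le hvm hv hab (Ioo_subset_Icc_self hym)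
      (Ioo_subset_Icc_self hzm)
    have h3 : ‖u z‖ ≤ ‖u y‖ + ‖∫ t in y..z, v t‖ := by
      rw [e]
      exact norm_add_le _ _
    nlinarith [sq_nonneg (‖u y‖ - ‖∫ t in y..z, v t‖), norm_nonneg (u z)]
  have h4 : ∫ _y in Ioo a b, ‖u z‖ ^ 2 ≤ ∫ y in Ioo a b, (2 * ‖u y‖ ^ 2 + 2 * ((b - a) * B)) := by
    exact integral_mono_ae (integrable_const _) ((hu.const_mul 2).add (integrable_const _)) h1
  rw [integral_add (hu.const_mul 2) (integrable_const _), integral_const_mul] at h4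
  simp only [integral_const, MeasurableSet.univ, measureReal_restrict_apply, univ_inter,
    Real.volume_real_Ioo_of_le hab.le, smul_eq_mul] at h4
  have h5 : ‖u z‖ ^ 2 ≤ (2 * (∫ y in Ioo a b, ‖u y‖ ^ 2) + (b - a) * (2 * ((b - a) * B)))
      / (b - a) := by
    rw [le_div_iff₀ hba]
    linarith
  refine h5.trans (le_of_eq ?_)
  field_simp

/-- A function with constant primitive vanishes. -/
lemma ae_eq_zero_of_primitive_const {a b : ℝ} {v : ℝ → ℂ} {c : ℂ}
    (hv : IntegrableOn v (Ioo a b))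
    (h : ∀ᵐ z ∂(volume.restrict (Ioo a b)), c + ∫ t in a..z, v t = 0) :
    ∀ᵐ z ∂(volume.restrict (Ioo a b)), v z = 0 := by
  rcases le_or_gt b a with hab | hab
  · simp [Ioo_eq_empty_of_le hab]
  have hvi : IntervalIntegrable v volume a b := by
    rw [intervalIntegrable_iff, uIoc_of_le hab.le, integrableOn_Ioc_iff_integrableOn_Ioo]
    exact hv
  have hcont : ContinuousOn (fun z => c + ∫ t in a..z, v t) (Ioo a b) := by
    have := (intervalIntegral.continuousOn_primitive_interval'
      hvi left_mem_uIcc)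
    rw [uIcc_of_le hab.le] at this
    exact (continuousOn_const.add this).mono Ioo_subset_Icc_self
  -- Continuity of the primitive turns "almost everywhere" into "everywhere". A locally constant
  -- primitive has derivative `0`, which is `v` by Lebesgue differentiation.
  have h0 : ∀ z ∈ Ioo a b, c + ∫ t in a..z, v t = 0 :=
    Measure.eqOn_open_of_ae_eq (μ := volume) (f := fun z => c + ∫ t in a..z, v t)
      (g := fun _ => (0 : ℂ)) h isOpen_Ioo hcont continuousOn_const
  rw [ae_restrict_iff' measurableSet_Ioo]
  filter_upwards [hvi.ae_hasDerivAt_integral] with z hz hzm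
  have hd := (hz (by rw [uIcc_of_le hab.le]; exact Ioo_subset_Icc_self hzm) a left_mem_uIcc)
  have hd' : HasDerivAt (fun z => ∫ t in a..z, v t) 0 z := by
    refine (hasDerivAt_const z (-c)).congr_of_eventuallyEq ?_
    filter_upwards [isOpen_Ioo.mem_nhds hzm] with y hy
    have := h0 y hy
    exact (neg_eq_of_add_eq_zero_right this).symm
  exact hd.unique hd'

end OneDimensional

/-! ### Fubini for slices and the one-dimensional bounds with a parameter -/

section Slices

variable {K : Type} [MeasurableSpace K]

lemma Box.h_pos (G : Box) : 0 < G.h := by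
  have := G.b_pos
  unfold Box.h
  positivity

/-- The height `d + ξ` of the box. -/
def Box.len (G : Box) : ℝ := G.d + G.ξ

lemma Box.len_pos (G : Box) : 0 < G.len := by
  have := G.lt
  unfold Box.len
  linarith

lemma Box.sub_eq_len (G : Box) : G.d - -G.ξ = G.len := by
  unfold Box.len
  ring

/-- The converse of `Box.ae_swap`, which requires a measurable set. The initial value in `TraceAt`
need not be measurable in the parameter, so this is applied only to conclusions from which it has
disappeared. -/
lemma Box.ae_prod_left {G : Box} {ν : Measure K} [SFinite ν] {p : ℝ × K → Prop}
    (h : ∀ᵐ k ∂ν, ∀ᵐ z ∂(volume.restrict (Ioo (-G.ξ) G.d)), p (z, k))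
    (hp : MeasurableSet {x | p x}) : ∀ᵐ x ∂(G.dom ν), p x := by
  have h1 : ∀ᵐ y ∂(ν.prod (volume.restrict (Ioo (-G.ξ) G.d))), p y.swap :=
    (Measure.ae_prod_iff_ae_ae (p := fun y : K × ℝ => p y.swap)
      (hp.preimage measurable_swap)).2 h
  have h2 := (Measure.measurePreserving_swap (μ := volume.restrict (Ioo (-G.ξ) G.d))
      (ν := ν)).quasiMeasurePreserving.ae h1
  exact h2

lemma Box.integrable_wt_iff {G : Box} {ν : Measure K} {E : Type*} [NormedAddCommGroup E]
    {f : ℝ × K → E} : Integrable f (G.wt ν) ↔ Integrable f (G.dom ν) := by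
  unfold Box.wt
  refine integrable_smul_measure ?_ ENNReal.ofReal_ne_top
  simpa using G.h_pos.ne'

lemma Box.integrable_sq {G : Box} {ν : Measure K} (v : Lp ℂ 2 (G.wt ν)) :
    Integrable (fun x => ‖v x‖ ^ 2) (G.dom ν) :=
  Box.integrable_wt_iff.1 ((Lp.memLp v).integrable_norm_pow (by simp))

lemma Box.measurable_coe {G : Box} {ν : Measure K} (v : Lp ℂ 2 (G.wt ν)) : Measurable v :=
  (Lp.stronglyMeasurable v).measurable

lemma Box.norm_sq_eq {G : Box} {ν : Measure K} (v : Lp ℂ 2 (G.wt ν)) :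
    ‖v‖ ^ 2 = G.h ^ 2 * ∫ x, ‖v x‖ ^ 2 ∂(G.dom ν) := by
  rw [← real_inner_self_eq_norm_sq, L2.inner_def]
  simp only [real_inner_self_eq_norm_sq]
  unfold Box.wt
  rw [integral_smul_measure, ENNReal.toReal_ofReal (by positivity), smul_eq_mul]

/-- The weight `e^{-2λz}` is bounded on the box. -/
lemma Box.exp_le {G : Box} {lam z : ℝ} (hz : z ∈ Ioo (-G.ξ) G.d) :
    Real.exp (-2 * lam * z) ≤ Real.exp (2 * |lam| * (|G.ξ| + |G.d|)) := by
  refine Real.exp_le_exp.2 ?_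
  have h1 : |z| ≤ |G.ξ| + |G.d| := by
    rw [abs_le]
    constructor
    · linarith [hz.1, le_abs_self G.ξ, abs_nonneg G.d]
    · linarith [hz.2, le_abs_self G.d, abs_nonneg G.ξ]
  have h2 : -(lam * z) ≤ |lam| * |z| := by
    rw [← abs_mul]
    exact neg_le_abs _
  nlinarith [abs_nonneg lam]

lemma Box.integrable_mul_exp {G : Box} {ν : Measure K} [SFinite ν] {f : ℝ × K → ℝ} (lam : ℝ)
    (hf : Integrable f (G.dom ν)) :
    Integrable (fun x => f x * Real.exp (-2 * lam * x.1)) (G.dom ν) := by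
  refine hf.mul_bdd (c := Real.exp (2 * |lam| * (|G.ξ| + |G.d|))) ?_ ?_
  · exact Measurable.aestronglyMeasurable (by fun_prop)
  · filter_upwards [Box.ae_mem (G := G) (ν := ν)] with x hx
    rw [Real.norm_eq_abs, Real.abs_exp]
    exact Box.exp_le hx

/-- `∫ |f(z, k)|² e^{-2λz} dz` as a function of `k`. -/
def Box.sliceSq (G : Box) (lam : ℝ) (f : ℝ × K → ℂ) (k : K) : ℝ :=
  ∫ z in Ioo (-G.ξ) G.d, ‖f (z, k)‖ ^ 2 * Real.exp (-2 * lam * z)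

lemma Box.sliceSq_nonneg {K : Type} (G : Box) (lam : ℝ) (f : ℝ × K → ℂ) (k : K) : 0 ≤ G.sliceSq lam f k :=
  integral_nonneg fun z => by positivity

lemma Box.measurable_sliceSq (G : Box) (lam : ℝ) {f : ℝ × K → ℂ} (hf : Measurable f) :
    Measurable (G.sliceSq lam f) := by
  have h : StronglyMeasurable fun p : ℝ × K => ‖f p‖ ^ 2 * Real.exp (-2 * lam * p.1) :=
    Measurable.stronglyMeasurable (by fun_prop)
  exact (h.integral_prod_left' (μ := volume.restrict (Ioo (-G.ξ) G.d))).measurable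

lemma Box.integrable_sliceSq {G : Box} {ν : Measure K} [SFinite ν] (lam : ℝ) {f : ℝ × K → ℂ}
    (hf : Integrable (fun x => ‖f x‖ ^ 2) (G.dom ν)) : Integrable (G.sliceSq lam f) ν :=
  (Box.integrable_mul_exp lam hf).integral_prod_right

lemma Box.integral_sliceSq {G : Box} {ν : Measure K} [SFinite ν] (lam : ℝ) {f : ℝ × K → ℂ}
    (hf : Integrable (fun x => ‖f x‖ ^ 2) (G.dom ν)) :
    ∫ k, G.sliceSq lam f k ∂ν = ∫ x, ‖f x‖ ^ 2 * Real.exp (-2 * lam * x.1) ∂(G.dom ν) :=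
  (integral_prod_symm _ (Box.integrable_mul_exp lam hf)).symm

lemma Box.integrable_param {G : Box} {ν : Measure K} [SFinite ν] {e : K → ℝ}
    (he : Integrable e ν) : Integrable (fun x => e x.2) (G.dom ν) := by
  unfold Box.dom
  exact he.comp_snd _

lemma Box.integral_param {G : Box} {ν : Measure K} [SFinite ν] (e : K → ℝ) :
    ∫ x, e x.2 ∂(G.dom ν) = G.len * ∫ k, e k ∂ν := by
  unfold Box.dom
  rw [integral_fun_snd]
  simp only [Box.len, measureReal_restrict_apply_univ, Real.volume_real_Ioo_of_le G.lt.le,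
    sub_neg_eq_add, smul_eq_mul]

lemma Box.ae_slice_integrable {G : Box} {ν : Measure K} [SFinite ν] (v : Lp ℂ 2 (G.wt ν)) :
    ∀ᵐ k ∂ν, IntegrableOn (fun z => ‖v (z, k)‖ ^ 2) (Ioo (-G.ξ) G.d) :=
  (Box.integrable_sq v).prod_left_ae

/-- Since the interval of integration depends on the point, the integral is rewritten over the whole
line with the indicator of a measurable set in the product space. -/
lemma Box.measurable_primitive (a : ℝ) {v : ℝ × K → ℂ} (hv : Measurable v) :
    Measurable fun x : ℝ × K => ∫ t in a..x.1, v (t, x.2) := by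
  have key : ∀ s : ℝ × K → Set ℝ, MeasurableSet {y : (ℝ × K) × ℝ | y.2 ∈ s y.1} →
      (∀ x, MeasurableSet (s x)) →
      Measurable fun x : ℝ × K => ∫ t in s x, v (t, x.2) := by
    intro s hs hs'
    have h : StronglyMeasurable fun y : (ℝ × K) × ℝ =>
        {y : (ℝ × K) × ℝ | y.2 ∈ s y.1}.indicator (fun y => v (y.2, y.1.2)) y :=
      (Measurable.indicator (by fun_prop) hs).stronglyMeasurable
    have h2 := (h.integral_prod_right' (ν := volume)).measurable
    convert h2 using 2 with x
    rw [← integral_indicator (hs' x)]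
    rfl
  simp only [intervalIntegral]
  refine (key (fun x => Ioc a x.1) ?_ fun x => measurableSet_Ioc).sub
    (key (fun x => Ioc x.1 a) ?_ fun x => measurableSet_Ioc)
  · exact (measurableSet_lt measurable_const measurable_snd).inter
      (measurableSet_le measurable_snd (by fun_prop))
  · exact (measurableSet_lt (by fun_prop) measurable_snd).inter
      (measurableSet_le measurable_snd measurable_const)

/-- If the function vanishes, so does its derivative. -/
lemma Box.IsZDeriv.ae_eq_zero {G : Box} {ν : Measure K} [SFinite ν] {u v : Lp ℂ 2 (G.wt ν)}
    (h : G.IsZDeriv ν u v) (hu : ∀ᵐ x ∂(G.dom ν), u x = 0) : ∀ᵐ x ∂(G.dom ν), v x = 0 := by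
  obtain ⟨c, hc⟩ := h
  have h1 : ∀ᵐ x ∂(G.dom ν), c x.2 + ∫ t in (-G.ξ)..x.1, v (t, x.2) = 0 := by
    filter_upwards [hc, hu] with x hx hx'
    rw [← hx, hx']
  refine Box.ae_prod_left ?_ (Box.measurable_coe v (measurableSet_singleton 0))
  filter_upwards [Box.ae_swap h1, Box.integrable_slice v] with k hk hi
  exact ae_eq_zero_of_primitive_const hi hk

/-- The Sobolev embedding in `z`, on almost every slice. -/
lemma Box.IsZDeriv.sq_norm_le {G : Box} {ν : Measure K} [SFinite ν] {u v : Lp ℂ 2 (G.wt ν)}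
    (h : G.IsZDeriv ν u v) :
    ∀ᵐ x ∂(G.dom ν), ‖u x‖ ^ 2 ≤ 2 / G.len * G.sliceSq 0 u x.2
      + 2 * G.len * G.sliceSq 0 v x.2 := by
  obtain ⟨c, hc⟩ := h
  refine Box.ae_prod_left ?_ ?_
  · filter_upwards [Box.ae_swap hc, Box.ae_slice_integrable u, Box.ae_slice_integrable v]
      with k hk hu hv
    have := sq_norm_le_of_primitive G.lt
      (v := fun z => v (z, k)) ((Box.measurable_coe v).comp (by fun_prop)) hu hv hk
    rw [G.sub_eq_len] at this
    simpa [Box.sliceSq] using this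
  · have h1 := Box.measurable_coe u
    have h2 := G.measurable_sliceSq 0 h1
    have h3 := G.measurable_sliceSq 0 (Box.measurable_coe v)
    exact measurableSet_le (by fun_prop) (by fun_prop)

/-- The weighted bound for functions that vanish at `z = -ξ`. -/
lemma Box.TraceAt.weighted_sq_le {G : Box} {ν : Measure K} [SFinite ν] {u v : Lp ℂ 2 (G.wt ν)}
    (h : G.TraceAt ν (-G.ξ) u v 0) {lam : ℝ} (hl : 0 < lam) :
    ∀ᵐ x ∂(G.dom ν), (‖u x‖ * Real.exp (-lam * x.1)) ^ 2 ≤ 1 / (2 * lam) * G.sliceSq lam v x.2 := by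
  refine Box.ae_prod_left ?_ ?_
  · filter_upwards [Box.ae_swap h, Box.ae_slice_integrable v] with k hk hv
    filter_upwards [hk, ae_restrict_mem measurableSet_Ioo] with z hz hzm
    rw [hz]
    simpa [Box.sliceSq] using weighted_sq_norm_primitive_le (g := fun z => v (z, k))
      ((Box.measurable_coe v).comp (by fun_prop)) hv hl hzm
  · have h1 := Box.measurable_coe u
    have h3 := G.measurable_sliceSq lam (Box.measurable_coe v)
    exact measurableSet_le (by fun_prop) (by fun_prop)

/-- The second integration: starting from a bound uniform in `z`, the kernel `e^{-λ(z-t)}` is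
integrated rather than its square, so the gain is a full factor `1 / lam` and not its square root.
-/
lemma Box.TraceAt.weighted_le {G : Box} {ν : Measure K} [SFinite ν] {u v : Lp ℂ 2 (G.wt ν)}
    (h : G.TraceAt ν (-G.ξ) u v 0) {lam : ℝ} (hl : 0 < lam) {e : K → ℝ} (he : Measurable e)
    (he0 : ∀ k, 0 ≤ e k)
    (hv : ∀ᵐ x ∂(G.dom ν), ‖v x‖ * Real.exp (-lam * x.1) ≤ e x.2) :
    ∀ᵐ x ∂(G.dom ν), ‖u x‖ * Real.exp (-lam * x.1) ≤ e x.2 / lam := by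
  refine Box.ae_prod_left ?_ ?_
  · filter_upwards [Box.ae_swap h, Box.ae_swap hv] with k hk hv
    filter_upwards [hk, ae_restrict_mem measurableSet_Ioo] with z hz hzm
    rw [hz]
    simpa using weighted_norm_primitive_le hv hl hzm (he0 k)
  · have h1 := Box.measurable_coe u
    exact measurableSet_le (by fun_prop) (by fun_prop)

end Slices

/-! ### Difference operators, norms and the Sobolev embedding in `z` -/

section Pointwise

variable {K : Type} [MeasurableSpace K] {G : Box} {ν : Measure K} [SFinite ν]

lemma measurable_zD {m : ℕ} (f : Sob G ν m) (r : Fin (m + 1)) (j s : G.Node) :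
    Measurable (zD f r j s) :=
  Box.measurable_coe _

lemma integrable_sq_zD {m : ℕ} (f : Sob G ν m) (r : Fin (m + 1)) (j s : G.Node) :
    Integrable (fun x => ‖zD f r j s x‖ ^ 2) (G.dom ν) :=
  Box.integrable_sq _

lemma ae_zD_add {m : ℕ} (f g : Sob G ν m) :
    ∀ᵐ x ∂(G.dom ν), ∀ r j s, zD (f + g) r j s x = zD f r j s x + zD g r j s x := by
  simp only [ae_all_iff]
  intro r j s
  exact Box.wt_ae.1 (Lp.coeFn_add (f.1 (j, s, r)) (g.1 (j, s, r)))

lemma ae_zD_smul {m : ℕ} (c : ℝ) (f : Sob G ν m) :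
    ∀ᵐ x ∂(G.dom ν), ∀ r j s, zD (c • f) r j s x = (c : ℂ) * zD f r j s x := by
  simp only [ae_all_iff]
  intro r j s
  exact Box.wt_ae.1 (Lp.coeFn_smul c (f.1 (j, s, r)))

lemma lap_eq_add {f g e : Sob G ν 2} {x : ℝ × K}
    (h : ∀ r j s, zD e r j s x = zD f r j s x + zD g r j s x) (i l : Fin G.n) :
    lap e i l x = lap f i l x + lap g i l x := by
  simp only [lap, h]
  ring

lemma lap_eq_smul {c : ℝ} {f e : Sob G ν 2} {x : ℝ × K}
    (h : ∀ r j s, zD e r j s x = (c : ℂ) * zD f r j s x) (i l : Fin G.n) :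
    lap e i l x = (c : ℂ) * lap f i l x := by
  simp only [lap, h]
  ring

lemma grad_eq_add {f g e : Sob G ν 2} {x : ℝ × K}
    (h : ∀ r j s, zD e r j s x = zD f r j s x + zD g r j s x) (i l : Fin G.n) :
    grad e i l x = grad f i l x + grad g i l x := by
  simp only [grad, h]
  ext c
  fin_cases c <;> simp <;> ring

lemma grad_eq_smul {c : ℝ} {f e : Sob G ν 2} {x : ℝ × K}
    (h : ∀ r j s, zD e r j s x = (c : ℂ) * zD f r j s x) (i l : Fin G.n) :
    grad e i l x = (c : ℂ) • grad f i l x := by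
  simp only [grad, h]
  ext c
  fin_cases c <;> simp <;> ring

lemma measurable_lap (f : Sob G ν 2) (i l : Fin G.n) : Measurable (lap f i l) := by
  have h := measurable_zD f
  unfold lap
  fun_prop

lemma measurable_grad (f : Sob G ν 2) (i l : Fin G.n) (c : Fin 3) :
    Measurable fun x => grad f i l x c := by
  have h := measurable_zD f
  fin_cases c
  · have : Measurable fun x => (zD f 0 (G.rgt i) (G.mid l) x - zD f 0 (G.lft i) (G.mid l) x)
      / (2 * (G.h : ℂ)) := by fun_prop
    exact this
  · have : Measurable fun x => (zD f 0 (G.mid i) (G.rgt l) x - zD f 0 (G.mid i) (G.lft l) x)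
      / (2 * (G.h : ℂ)) := by fun_prop
    exact this
  · exact h _ _ _

/-- On a fixed grid, second differences are bounded operators: each direction costs `(1 + 2 + 1) /
h²`. This makes them lower order compared with `u_zz`. -/
lemma norm_lap_sub_le {f : Sob G ν 2} {x : ℝ × K} {A : ℝ} (h : ∀ j s, ‖zD f 0 j s x‖ ≤ A)
    (i l : Fin G.n) :
    ‖lap f i l x - zD f 2 (G.mid i) (G.mid l) x‖ ≤ 8 / G.h ^ 2 * A := by
  have hh := G.h_pos
  have h3 : ∀ a b c : ℂ, ‖a‖ ≤ A → ‖b‖ ≤ A → ‖c‖ ≤ A →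
      ‖(a - 2 * b + c) / (G.h : ℂ) ^ 2‖ ≤ 4 / G.h ^ 2 * A := by
    intro a b c ha hb hc
    have h1 : ‖a - 2 * b + c‖ ≤ 4 * A := by
      calc ‖a - 2 * b + c‖ ≤ ‖a‖ + ‖2 * b‖ + ‖c‖ := by
            refine (norm_add_le _ _).trans ?_
            gcongr
            exact norm_sub_le _ _
        _ ≤ 4 * A := by
            rw [norm_mul]
            norm_num
            linarith
    rw [norm_div, norm_pow, Complex.norm_real, Real.norm_of_nonneg hh.le, div_mul_eq_mul_div]
    gcongr
  have e : lap f i l x - zD f 2 (G.mid i) (G.mid l) x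
      = (zD f 0 (G.lft i) (G.mid l) x - 2 * zD f 0 (G.mid i) (G.mid l) x
        + zD f 0 (G.rgt i) (G.mid l) x) / (G.h : ℂ) ^ 2
      + (zD f 0 (G.mid i) (G.lft l) x - 2 * zD f 0 (G.mid i) (G.mid l) x
        + zD f 0 (G.mid i) (G.rgt l) x) / (G.h : ℂ) ^ 2 := by
    unfold lap
    ring
  rw [e]
  refine (norm_add_le _ _).trans ?_
  refine (add_le_add (h3 _ _ _ (h _ _) (h _ _) (h _ _)) (h3 _ _ _ (h _ _) (h _ _) (h _ _))).trans
    (le_of_eq ?_)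
  ring

/-- The constant covers both kinds of components: `1 / h` for the central differences and `1` for
the `z`-derivative. -/
lemma norm_grad_le {f : Sob G ν 2} {x : ℝ × K} {A : ℝ} {i l : Fin G.n}
    (h0 : ∀ j s, ‖zD f 0 j s x‖ ≤ A)
    (h1 : ‖zD f 1 (G.mid i) (G.mid l) x‖ ≤ A) (c : Fin 3) :
    ‖grad f i l x c‖ ≤ (1 + 1 / G.h) * A := by
  have hh := G.h_pos
  have hA : 0 ≤ A := (norm_nonneg _).trans h1
  have h3 : ∀ a b : ℂ, ‖a‖ ≤ A → ‖b‖ ≤ A → ‖(a - b) / (2 * (G.h : ℂ))‖ ≤ (1 + 1 / G.h) * A := by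
    intro a b ha hb
    have h1 : ‖a - b‖ ≤ 2 * A := (norm_sub_le _ _).trans (by linarith)
    rw [norm_div, norm_mul, Complex.norm_real, Real.norm_of_nonneg hh.le]
    calc ‖a - b‖ / (‖(2 : ℂ)‖ * G.h) ≤ 2 * A / (2 * G.h) := by
          norm_num
          gcongr
      _ = 1 / G.h * A := by field_simp
      _ ≤ _ := by
          gcongr
          linarith
  fin_cases c
  · exact h3 _ _ (h0 _ _) (h0 _ _)
  · exact h3 _ _ (h0 _ _) (h0 _ _)
  · refine h1.trans (le_mul_of_one_le_left hA ?_)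
    have : 0 ≤ 1 / G.h := by positivity
    linarith

lemma norm_sq_eq_sum {m : ℕ} (f : Sob G ν m) :
    ‖f‖ ^ 2 = ∑ a : G.Node × G.Node × Fin (m + 1),
      G.h ^ 2 * ∫ x, ‖zD f a.2.2 a.1 a.2.1 x‖ ^ 2 ∂(G.dom ν) := by
  have h := PiLp.norm_sq_eq_of_L2 _ f.1
  rw [Submodule.coe_norm, h]
  exact Finset.sum_congr rfl fun a _ => Box.norm_sq_eq _

/-- `∑ |∂_z^r f(x_j, y_s, z, k)|²` over all nodes and orders. -/
def totalSq {m : ℕ} (f : Sob G ν m) (x : ℝ × K) : ℝ :=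
  ∑ a : G.Node × G.Node × Fin (m + 1), ‖zD f a.2.2 a.1 a.2.1 x‖ ^ 2

lemma totalSq_nonneg {m : ℕ} (f : Sob G ν m) (x : ℝ × K) : 0 ≤ totalSq f x :=
  Finset.sum_nonneg fun _ _ => sq_nonneg _

lemma integrable_totalSq {m : ℕ} (f : Sob G ν m) : Integrable (totalSq f) (G.dom ν) :=
  integrable_finsetSum _ fun _ _ => integrable_sq_zD f _ _ _

lemma integral_totalSq {m : ℕ} (f : Sob G ν m) :
    ∫ x, totalSq f x ∂(G.dom ν) = ‖f‖ ^ 2 / G.h ^ 2 := by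
  have hh := G.h_pos
  rw [norm_sq_eq_sum, ← Finset.mul_sum, mul_div_cancel_left₀ _ (by positivity)]
  exact integral_finsetSum _ fun _ _ => integrable_sq_zD f _ _ _

lemma sq_zD_le_totalSq {m : ℕ} (f : Sob G ν m) (r : Fin (m + 1)) (j s : G.Node) (x : ℝ × K) :
    ‖zD f r j s x‖ ^ 2 ≤ totalSq f x :=
  Finset.single_le_sum (f := fun a : G.Node × G.Node × Fin (m + 1) =>
    ‖zD f a.2.2 a.1 a.2.1 x‖ ^ 2) (fun _ _ => sq_nonneg _) (Finset.mem_univ (j, s, r))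

lemma sq_lap_le (f : Sob G ν 2) (i l : Fin G.n) (x : ℝ × K) :
    ‖lap f i l x‖ ^ 2 ≤ (1 + 8 / G.h ^ 2) ^ 2 * totalSq f x := by
  have hh := G.h_pos
  have h0 : ∀ r j s, ‖zD f r j s x‖ ≤ √(totalSq f x) := fun r j s =>
    Real.le_sqrt_of_sq_le (sq_zD_le_totalSq f r j s x)
  have h1 := norm_lap_sub_le (h0 0) i l
  have h2 : ‖lap f i l x‖ ≤ (1 + 8 / G.h ^ 2) * √(totalSq f x) := by
    have := norm_le_norm_add_norm_sub' (lap f i l x) (zD f 2 (G.mid i) (G.mid l) x)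
    linarith [h0 2 (G.mid i) (G.mid l)]
  calc ‖lap f i l x‖ ^ 2 ≤ ((1 + 8 / G.h ^ 2) * √(totalSq f x)) ^ 2 :=
        pow_le_pow_left₀ (norm_nonneg _) h2 2
    _ = _ := by rw [mul_pow, Real.sq_sqrt (totalSq_nonneg _ _)]

lemma integrable_sq_lap (f : Sob G ν 2) (i l : Fin G.n) :
    Integrable (fun x => ‖lap f i l x‖ ^ 2) (G.dom ν) := by
  refine ((integrable_totalSq f).const_mul ((1 + 8 / G.h ^ 2) ^ 2)).mono'
    ((measurable_lap f i l).norm.pow_const 2).aestronglyMeasurable (.of_forall fun x => ?_)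
  rw [Real.norm_of_nonneg (sq_nonneg _)]
  exact sq_lap_le f i l x

lemma integral_sq_lap_le (f : Sob G ν 2) (i l : Fin G.n) :
    ∫ x, ‖lap f i l x‖ ^ 2 ∂(G.dom ν) ≤ (1 + 8 / G.h ^ 2) ^ 2 * (‖f‖ ^ 2 / G.h ^ 2) := by
  rw [← integral_totalSq, ← integral_const_mul]
  exact integral_mono (integrable_sq_lap f i l) ((integrable_totalSq f).const_mul _)
    (sq_lap_le f i l)

/-- `∑ ∫ |∂_z^r f(x_j, y_s, z, k)|² dz` over all nodes and orders, as a function of `k`. -/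
def totalSlice {m : ℕ} (f : Sob G ν m) (k : K) : ℝ :=
  ∑ a : G.Node × G.Node × Fin (m + 1), G.sliceSq 0 (zD f a.2.2 a.1 a.2.1) k

lemma totalSlice_nonneg {m : ℕ} (f : Sob G ν m) (k : K) : 0 ≤ totalSlice f k :=
  Finset.sum_nonneg fun _ _ => G.sliceSq_nonneg _ _ _

lemma measurable_totalSlice {m : ℕ} (f : Sob G ν m) : Measurable (totalSlice f) :=
  Finset.measurable_fun_sum _ fun _ _ => G.measurable_sliceSq _ (measurable_zD f _ _ _)

lemma integrable_totalSlice {m : ℕ} (f : Sob G ν m) : Integrable (totalSlice f) ν :=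
  integrable_finsetSum _ fun _ _ => Box.integrable_sliceSq 0 (integrable_sq_zD f _ _ _)

lemma integral_totalSlice {m : ℕ} (f : Sob G ν m) :
    ∫ k, totalSlice f k ∂ν = ‖f‖ ^ 2 / G.h ^ 2 := by
  have hh := G.h_pos
  rw [norm_sq_eq_sum, ← Finset.mul_sum, mul_div_cancel_left₀ _ (by positivity)]
  unfold totalSlice
  rw [integral_finsetSum _ fun _ _ => Box.integrable_sliceSq 0 (integrable_sq_zD f _ _ _)]
  refine Finset.sum_congr rfl fun a _ => ?_
  rw [Box.integral_sliceSq 0 (integrable_sq_zD f _ _ _)]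
  simp

/-- The constant of the embedding of `H^2` into functions with bounded gradient. -/
def Box.supConst (G : Box) : ℝ := (1 + 1 / G.h) * √(2 / G.len + 2 * G.len)

lemma Box.supConst_nonneg (G : Box) : 0 ≤ G.supConst := by
  have := G.h_pos
  unfold Box.supConst
  positivity

lemma ae_norm_grad_le (f : Sob G ν 2) :
    ∀ᵐ x ∂(G.dom ν), ∀ i l c, ‖grad f i l x c‖ ≤ G.supConst * √(totalSlice f x.2) := by
  have hlen := G.len_pos
  -- Only the orders `0` and `1` are bounded, since the embedding in `z` consumes one derivative;
  -- the gradient needs no more.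
  have h1 : ∀ᵐ x ∂(G.dom ν), ∀ (r : Fin 2) j s, ‖zD f r.castSucc j s x‖
      ≤ √(2 / G.len + 2 * G.len) * √(totalSlice f x.2) := by
    simp only [ae_all_iff]
    intro r j s
    filter_upwards [(f.2 j s r).sq_norm_le] with x hx
    rw [← Real.sqrt_mul (by positivity)]
    refine Real.le_sqrt_of_sq_le (hx.trans ?_)
    have h2 : ∀ r, G.sliceSq 0 (zD f r j s) x.2 ≤ totalSlice f x.2 := fun r =>
      Finset.single_le_sum (f := fun a : G.Node × G.Node × Fin 3 =>
        G.sliceSq 0 (zD f a.2.2 a.1 a.2.1) x.2) (fun _ _ => G.sliceSq_nonneg _ _ _)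
        (Finset.mem_univ (j, s, r))
    rw [add_mul]
    exact add_le_add (mul_le_mul_of_nonneg_left (h2 _) (by positivity))
      (mul_le_mul_of_nonneg_left (h2 _) (by positivity))
  filter_upwards [h1] with x hx i l c
  have := norm_grad_le (f := f) (x := x) (i := i) (l := l) (hx 0) (hx 1 _ _) c
  unfold Box.supConst
  rwa [mul_assoc]

end Pointwise

/-! ### The Carleman estimate -/

section Carleman

variable {K : Type} [MeasurableSpace K] {G : Box} {ν : Measure K} [SFinite ν]

lemma Box.lateral_or_mid (G : Box) (j s : G.Node) :
    G.Lateral j s ∨ ∃ i l, j = G.mid i ∧ s = G.mid l := by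
  have key : ∀ j : G.Node, j = 0 ∨ j = Fin.last (G.n + 1) ∨ ∃ i, j = G.mid i := by
    intro j
    induction j using Fin.cases with
    | zero => exact Or.inl rfl
    | succ j =>
      induction j using Fin.lastCases with
      | last => exact Or.inr (Or.inl (by simp))
      | cast i => exact Or.inr (Or.inr ⟨i, rfl⟩)
  unfold Box.Lateral
  rcases key j with h | h | ⟨i, h⟩
  · exact Or.inl (Or.inl h)
  · exact Or.inl (Or.inr (Or.inl h))
  · rcases key s with h' | h' | ⟨l, h'⟩
    · exact Or.inl (Or.inr (Or.inr (Or.inl h')))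
    · exact Or.inl (Or.inr (Or.inr (Or.inr h')))
    · exact Or.inr ⟨i, l, h, h'⟩

lemma exp_sq (lam z : ℝ) : Real.exp (-lam * z) ^ 2 = Real.exp (-2 * lam * z) := by
  rw [← Real.exp_nat_mul]
  congr 1
  push_cast
  ring

/-- On the lateral boundary all derivatives vanish. -/
lemma ae_zD_lateral (u : Sob₀ G ν) (r : Fin 3) {j s : G.Node} (h : G.Lateral j s) :
    ∀ᵐ x ∂(G.dom ν), zD u.1 r j s x = 0 := by
  have h0 : ∀ᵐ x ∂(G.dom ν), zD u.1 0 j s x = 0 := u.2.2.2.2 j s h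
  have h1 : ∀ᵐ x ∂(G.dom ν), zD u.1 1 j s x = 0 := (u.1.2 j s 0).ae_eq_zero h0
  have h2 : ∀ᵐ x ∂(G.dom ν), zD u.1 2 j s x = 0 := (u.1.2 j s 1).ae_eq_zero h1
  fin_cases r
  exacts [h0, h1, h2]

/-- `∑ ∫ |u_zz|² e^{-2λz} dz` over the interior nodes, as a function of `k`. -/
def energy (lam : ℝ) (u : Sob₀ G ν) (k : K) : ℝ :=
  ∑ i, ∑ l, G.sliceSq lam (zD u.1 2 (G.mid i) (G.mid l)) k

/-- `∑ ∫ |u_zz|² e^{-2λz} dz dν` over the interior nodes. -/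
def mass (lam : ℝ) (u : Sob₀ G ν) : ℝ :=
  ∑ i, ∑ l, ∫ x, ‖zD u.1 2 (G.mid i) (G.mid l) x‖ ^ 2 * Real.exp (-2 * lam * x.1) ∂(G.dom ν)

lemma energy_nonneg (lam : ℝ) (u : Sob₀ G ν) (k : K) : 0 ≤ energy lam u k :=
  Finset.sum_nonneg fun _ _ => Finset.sum_nonneg fun _ _ => G.sliceSq_nonneg _ _ _

lemma mass_nonneg (lam : ℝ) (u : Sob₀ G ν) : 0 ≤ mass lam u :=
  Finset.sum_nonneg fun _ _ => Finset.sum_nonneg fun _ _ =>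
    integral_nonneg fun _ => by positivity

lemma measurable_energy (lam : ℝ) (u : Sob₀ G ν) : Measurable (energy lam u) :=
  Finset.measurable_fun_sum _ fun _ _ => Finset.measurable_fun_sum _ fun _ _ =>
    G.measurable_sliceSq _ (measurable_zD _ _ _ _)

lemma integrable_energy (lam : ℝ) (u : Sob₀ G ν) : Integrable (energy lam u) ν :=
  integrable_finsetSum _ fun _ _ => integrable_finsetSum _ fun _ _ =>
    Box.integrable_sliceSq lam (integrable_sq_zD _ _ _ _)

lemma integral_energy (lam : ℝ) (u : Sob₀ G ν) : ∫ k, energy lam u k ∂ν = mass lam u := by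
  unfold energy mass
  rw [integral_finsetSum _ fun _ _ => integrable_finsetSum _ fun _ _ =>
    Box.integrable_sliceSq lam (integrable_sq_zD _ _ _ _)]
  refine Finset.sum_congr rfl fun i _ => ?_
  rw [integral_finsetSum _ fun _ _ => Box.integrable_sliceSq lam (integrable_sq_zD _ _ _ _)]
  exact Finset.sum_congr rfl fun l _ => Box.integral_sliceSq lam (integrable_sq_zD _ _ _ _)

lemma sliceSq_le_energy (lam : ℝ) (u : Sob₀ G ν) (i l : Fin G.n) (k : K) :
    G.sliceSq lam (zD u.1 2 (G.mid i) (G.mid l)) k ≤ energy lam u k := by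
  refine le_trans ?_ (Finset.single_le_sum (f := fun i => ∑ l,
    G.sliceSq lam (zD u.1 2 (G.mid i) (G.mid l)) k)
    (fun _ _ => Finset.sum_nonneg fun _ _ => G.sliceSq_nonneg _ _ _) (Finset.mem_univ i))
  exact Finset.single_le_sum (f := fun l => G.sliceSq lam (zD u.1 2 (G.mid i) (G.mid l)) k)
    (fun _ _ => G.sliceSq_nonneg _ _ _) (Finset.mem_univ l)

/-- At interior nodes `u_z` is the primitive of `u_zz` from `z = -ξ`; at lateral nodes it vanishes.
The bound depends on the parameter only, which allows for products with functions merely square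
integrable in `k`. -/
lemma ae_weighted_zD_one {lam : ℝ} (hl : 0 < lam) (u : Sob₀ G ν) :
    ∀ᵐ x ∂(G.dom ν), ∀ j s, ‖zD u.1 1 j s x‖ * Real.exp (-lam * x.1)
      ≤ √(energy lam u x.2 / (2 * lam)) := by
  simp only [ae_all_iff]
  intro j s
  rcases G.lateral_or_mid j s with h | ⟨i, l, rfl, rfl⟩
  · filter_upwards [ae_zD_lateral u 1 h] with x hx
    simp [hx]
  · filter_upwards [(u.2.2.1 i l).weighted_sq_le hl] with x hx
    refine Real.le_sqrt_of_sq_le (hx.trans ?_)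
    rw [one_div_mul_eq_div]
    gcongr
    exact sliceSq_le_energy lam u i l x.2

/-- Integrating the preceding bound once more divides it by `lam`. After squaring, the powers `λ⁻¹`
and `λ⁻³` are exactly those that the Carleman estimate compensates. -/
lemma ae_weighted_zD_zero {lam : ℝ} (hl : 0 < lam) (u : Sob₀ G ν) :
    ∀ᵐ x ∂(G.dom ν), ∀ j s, ‖zD u.1 0 j s x‖ * Real.exp (-lam * x.1)
      ≤ √(energy lam u x.2 / (2 * lam)) / lam := by
  simp only [ae_all_iff]
  intro j s
  rcases G.lateral_or_mid j s with h | ⟨i, l, rfl, rfl⟩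
  · filter_upwards [ae_zD_lateral u 0 h] with x hx
    simp only [hx, norm_zero, zero_mul]
    positivity
  · refine (u.2.1 i l).weighted_le hl (e := fun k => √(energy lam u k / (2 * lam))) ?_
      (fun k => Real.sqrt_nonneg _) ?_
    · have := measurable_energy lam u
      fun_prop
    · filter_upwards [ae_weighted_zD_one hl u] with x hx
      exact hx _ _

lemma sq_sqrt_energy {lam : ℝ} (hl : 0 < lam) (u : Sob₀ G ν) (k : K) :
    √(energy lam u k / (2 * lam)) ^ 2 = energy lam u k / (2 * lam) :=
  Real.sq_sqrt (div_nonneg (energy_nonneg _ _ _) (by positivity))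

lemma integral_weighted_zD_one {lam : ℝ} (hl : 0 < lam) (u : Sob₀ G ν) (j s : G.Node) :
    ∫ x, ‖zD u.1 1 j s x‖ ^ 2 * Real.exp (-2 * lam * x.1) ∂(G.dom ν)
      ≤ G.len / (2 * lam) * mass lam u := by
  have e : G.len / (2 * lam) * mass lam u = ∫ x, energy lam u x.2 / (2 * lam) ∂(G.dom ν) := by
    rw [Box.integral_param (fun k => energy lam u k / (2 * lam)), integral_div, integral_energy]
    ring
  rw [e]
  refine integral_mono_ae (Box.integrable_mul_exp lam (integrable_sq_zD _ _ _ _))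
    (Box.integrable_param ((integrable_energy lam u).div_const _)) ?_
  filter_upwards [ae_weighted_zD_one hl u] with x hx
  rw [← exp_sq, ← mul_pow, ← sq_sqrt_energy hl]
  exact pow_le_pow_left₀ (by positivity) (hx j s) 2

lemma integral_weighted_zD_zero {lam : ℝ} (hl : 0 < lam) (u : Sob₀ G ν) (j s : G.Node) :
    ∫ x, ‖zD u.1 0 j s x‖ ^ 2 * Real.exp (-2 * lam * x.1) ∂(G.dom ν)
      ≤ G.len / (2 * lam ^ 3) * mass lam u := by
  have e : G.len / (2 * lam ^ 3) * mass lam u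
      = ∫ x, energy lam u x.2 / (2 * lam) / lam ^ 2 ∂(G.dom ν) := by
    rw [Box.integral_param (fun k => energy lam u k / (2 * lam) / lam ^ 2), integral_div,
      integral_div, integral_energy]
    field_simp
  rw [e]
  refine integral_mono_ae (Box.integrable_mul_exp lam (integrable_sq_zD _ _ _ _))
    (Box.integrable_param (((integrable_energy lam u).div_const _).div_const _)) ?_
  filter_upwards [ae_weighted_zD_zero hl u] with x hx
  rw [← exp_sq, ← mul_pow, ← sq_sqrt_energy hl, ← div_pow]
  exact pow_le_pow_left₀ (by positivity) (hx j s) 2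

/-- `∑ ∫ |Δ^h u|² e^{-2λz} dz dν` over the interior nodes. -/
def lapMass (lam : ℝ) (u : Sob G ν 2) : ℝ :=
  ∑ i, ∑ l, ∫ x, ‖lap u i l x‖ ^ 2 * Real.exp (-2 * lam * x.1) ∂(G.dom ν)

lemma lapMass_nonneg (lam : ℝ) (u : Sob G ν 2) : 0 ≤ lapMass lam u :=
  Finset.sum_nonneg fun _ _ => Finset.sum_nonneg fun _ _ =>
    integral_nonneg fun _ => by positivity

/-- The threshold for the Carleman parameter. -/
def Box.carlemanParam (G : Box) : ℝ := 2 + 128 * G.n ^ 2 * G.len / G.h ^ 4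

lemma Box.two_le_carlemanParam (G : Box) : 2 ≤ G.carlemanParam := by
  have h1 := G.h_pos
  have h2 := G.len_pos
  unfold Box.carlemanParam
  have : 0 ≤ 128 * G.n ^ 2 * G.len / G.h ^ 4 := by positivity
  linarith

/-- The core of the Carleman estimate. -/
lemma mass_le_lapMass {lam : ℝ} (hl : G.carlemanParam ≤ lam) (u : Sob₀ G ν) :
    mass lam u ≤ 4 * lapMass lam u.1 := by
  have hh := G.h_pos
  have hlen := G.len_pos
  have h2 : 2 ≤ lam := G.two_le_carlemanParam.trans hl
  have hl0 : 0 < lam := by linarith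
  have hm := mass_nonneg lam u
  -- Here `u_zz = Δ^h u - (differences of u)`, with the differences bounded by `8 / h²` times the
  -- weighted supremum of `u`. The constant `64` arises as `2 · 8² / 2`, the last `2` coming from
  -- `energy / (2 * lam)`.
  have h1 : ∀ i l, ∫ x, ‖zD u.1 2 (G.mid i) (G.mid l) x‖ ^ 2 * Real.exp (-2 * lam * x.1)
        ∂(G.dom ν)
      ≤ 2 * (∫ x, ‖lap u.1 i l x‖ ^ 2 * Real.exp (-2 * lam * x.1) ∂(G.dom ν))
        + 64 / G.h ^ 4 * G.len / lam ^ 3 * mass lam u := by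
    intro i l
    have iL := Box.integrable_mul_exp lam (integrable_sq_lap u.1 i l)
    have iE : Integrable (fun x : ℝ × K => 64 / G.h ^ 4 * energy lam u x.2 / lam ^ 3) (G.dom ν) :=
      Box.integrable_param (((integrable_energy lam u).const_mul _).div_const _)
    have e : 64 / G.h ^ 4 * G.len / lam ^ 3 * mass lam u
        = ∫ x, 64 / G.h ^ 4 * energy lam u x.2 / lam ^ 3 ∂(G.dom ν) := by
      rw [Box.integral_param (fun k => 64 / G.h ^ 4 * energy lam u k / lam ^ 3), integral_div,
        integral_const_mul, integral_energy]
      ring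
    rw [e, ← integral_const_mul, ← integral_add (iL.const_mul 2) iE]
    refine integral_mono_ae (Box.integrable_mul_exp lam (integrable_sq_zD _ _ _ _))
      ((iL.const_mul 2).add iE) ?_
    filter_upwards [ae_weighted_zD_zero hl0 u] with x hx
    have hω := Real.exp_pos (-lam * x.1)
    set S := √(energy lam u x.2 / (2 * lam)) with hS
    have hS2 : S ^ 2 = energy lam u x.2 / (2 * lam) := sq_sqrt_energy hl0 u x.2
    have h3 := norm_lap_sub_le (f := u.1) (x := x)
      (A := S / lam / Real.exp (-lam * x.1)) (fun j s => (le_div_iff₀ hω).2 (hx j s)) i l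
    have h4 : ‖zD u.1 2 (G.mid i) (G.mid l) x‖ * Real.exp (-lam * x.1)
        ≤ ‖lap u.1 i l x‖ * Real.exp (-lam * x.1) + 8 / G.h ^ 2 * (S / lam) := by
      have h5 := norm_le_norm_add_norm_sub (lap u.1 i l x) (zD u.1 2 (G.mid i) (G.mid l) x)
      calc _ ≤ (‖lap u.1 i l x‖ + 8 / G.h ^ 2 * (S / lam / Real.exp (-lam * x.1)))
            * Real.exp (-lam * x.1) := by
              gcongr
              linarith
        _ = _ := by
              field_simp
    have h6 : 64 / G.h ^ 4 * energy lam u x.2 / lam ^ 3 = 2 * (8 / G.h ^ 2 * (S / lam)) ^ 2 := by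
      rw [mul_pow, div_pow S, hS2]
      field_simp
      ring
    have h7 := pow_le_pow_left₀ (by positivity) h4 2
    rw [h6, ← exp_sq, ← mul_pow, ← mul_pow]
    nlinarith [sq_nonneg (‖lap u.1 i l x‖ * Real.exp (-lam * x.1) - 8 / G.h ^ 2 * (S / lam))]
  have h8 : mass lam u ≤ 2 * lapMass lam u.1
      + G.n ^ 2 * (64 / G.h ^ 4 * G.len / lam ^ 3 * mass lam u) := by
    calc mass lam u ≤ ∑ i, ∑ l, (2 * (∫ x, ‖lap u.1 i l x‖ ^ 2 * Real.exp (-2 * lam * x.1)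
          ∂(G.dom ν)) + 64 / G.h ^ 4 * G.len / lam ^ 3 * mass lam u) :=
          Finset.sum_le_sum fun i _ => Finset.sum_le_sum fun l _ => h1 i l
      _ = _ := by
          simp only [Finset.sum_add_distrib, ← Finset.mul_sum, Finset.sum_const, Finset.card_univ,
            Fintype.card_fin, nsmul_eq_mul]
          unfold lapMass
          ring
  -- The sum over the nodes of the lower order terms is at most half of `mass` and can be absorbed
  -- on the left; `carlemanParam` is chosen for this.
  have h9 : G.n ^ 2 * (64 / G.h ^ 4 * G.len / lam ^ 3) ≤ 1 / 2 := by
    have h10 : 128 * G.n ^ 2 * G.len / G.h ^ 4 ≤ lam := by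
      unfold Box.carlemanParam at hl
      linarith
    have h11 : lam ≤ lam ^ 3 := by nlinarith [sq_nonneg lam]
    have e : G.n ^ 2 * (64 / G.h ^ 4 * G.len / lam ^ 3)
        = 1 / 2 * ((128 * G.n ^ 2 * G.len / G.h ^ 4) / lam ^ 3) := by ring
    rw [e]
    have : (128 * G.n ^ 2 * G.len / G.h ^ 4) / lam ^ 3 ≤ 1 := by
      rw [div_le_one (by positivity)]
      linarith
    linarith
  nlinarith

/-- The constant of the Carleman estimate. -/
def Box.carlemanConst (G : Box) : ℝ := 1 / (4 * (1 + G.n ^ 2 * G.len))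

lemma Box.carlemanConst_pos (G : Box) : 0 < G.carlemanConst := by
  have h2 := G.len_pos
  unfold Box.carlemanConst
  positivity

lemma weightedSq_eq (G : Box) (lam : ℝ) (u : Fin G.n → Fin G.n → ℝ × Unit → ℂ) :
    weightedSq G lam u = G.h ^ 2 * ∑ i, ∑ l,
      ∫ x, ‖u i l x‖ ^ 2 * Real.exp (-2 * lam * x.1) ∂(G.dom (Measure.dirac ())) := by
  simp only [weightedSq, Finset.mul_sum]

theorem carlemanEstimate {lam : ℝ} (hl : G.carlemanParam ≤ lam) :
    CarlemanEstimate G G.carlemanConst lam := by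
  intro u
  have hh := G.h_pos
  have hlen := G.len_pos
  have h2 : 2 ≤ lam := G.two_le_carlemanParam.trans hl
  have hl0 : 0 < lam := by linarith
  have hm := mass_nonneg lam u
  have hC := G.carlemanConst_pos
  simp only [weightedSq_eq]
  change _ ≤ G.h ^ 2 * lapMass lam u.1
  have h1 : lam * ∑ i, ∑ l, ∫ x, ‖zD u.1 1 (G.mid i) (G.mid l) x‖ ^ 2
      * Real.exp (-2 * lam * x.1) ∂(G.dom (Measure.dirac ()))
      ≤ G.n ^ 2 * (G.len / 2 * mass lam u) := by
    calc _ ≤ lam * ∑ _i : Fin G.n, ∑ _l : Fin G.n, G.len / (2 * lam) * mass lam u := by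
          gcongr with i _ l _
          exact integral_weighted_zD_one hl0 u _ _
      _ = _ := by
          simp only [Finset.sum_const, Finset.card_univ, Fintype.card_fin, nsmul_eq_mul]
          field_simp
  have h0 : lam ^ 3 * ∑ i, ∑ l, ∫ x, ‖zD u.1 0 (G.mid i) (G.mid l) x‖ ^ 2
      * Real.exp (-2 * lam * x.1) ∂(G.dom (Measure.dirac ()))
      ≤ G.n ^ 2 * (G.len / 2 * mass lam u) := by
    calc _ ≤ lam ^ 3 * ∑ _i : Fin G.n, ∑ _l : Fin G.n, G.len / (2 * lam ^ 3) * mass lam u := by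
          gcongr with i _ l _
          exact integral_weighted_zD_zero hl0 u _ _
      _ = _ := by
          simp only [Finset.sum_const, Finset.card_univ, Fintype.card_fin, nsmul_eq_mul]
          field_simp
  have h3 := mass_le_lapMass hl u
  have e2 : ∑ i, ∑ l, ∫ x, ‖zD u.1 2 (G.mid i) (G.mid l) x‖ ^ 2
      * Real.exp (-2 * lam * x.1) ∂(G.dom (Measure.dirac ())) = mass lam u := rfl
  rw [e2]
  -- The terms in `u_z` and `u` each contribute `n² · len / 2` times `mass`, so `carlemanConst`
  -- makes the left side a quarter of `mass`, to be bounded by `mass_le_lapMass`.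
  have h4 : G.carlemanConst * (mass lam u + 2 * (G.n ^ 2 * (G.len / 2 * mass lam u)))
      = mass lam u / 4 := by
    unfold Box.carlemanConst
    field_simp
  have h5 : G.carlemanConst * (G.h ^ 2 * mass lam u)
      + G.carlemanConst * (G.h ^ 2 * (lam * ∑ i, ∑ l, ∫ x, ‖zD u.1 1 (G.mid i) (G.mid l) x‖ ^ 2
      * Real.exp (-2 * lam * x.1) ∂(G.dom (Measure.dirac ()))))
      + G.carlemanConst * (G.h ^ 2 * (lam ^ 3 * ∑ i, ∑ l,
        ∫ x, ‖zD u.1 0 (G.mid i) (G.mid l) x‖ ^ 2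
      * Real.exp (-2 * lam * x.1) ∂(G.dom (Measure.dirac ())))) ≤ G.h ^ 2 * (mass lam u / 4) := by
    rw [← h4]
    calc _ ≤ G.carlemanConst * (G.h ^ 2 * mass lam u)
      + G.carlemanConst * (G.h ^ 2 * (G.n ^ 2 * (G.len / 2 * mass lam u)))
      + G.carlemanConst * (G.h ^ 2 * (G.n ^ 2 * (G.len / 2 * mass lam u))) := by
          gcongr
      _ = _ := by ring
  have h6 : G.h ^ 2 * (mass lam u / 4) ≤ G.h ^ 2 * lapMass lam u.1 := by
    gcongr
    linarith
  refine le_trans (le_of_eq ?_) (h5.trans h6)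
  ring

/-- The constant in the bound of the norm by the weighted norm of `u_zz`. -/
def Box.normConst (G : Box) : ℝ :=
  Fintype.card (G.Node × G.Node × Fin 3) * (G.h ^ 2 * (1 + G.len))

lemma Box.normConst_pos (G : Box) : 0 < G.normConst := by
  have h1 := G.h_pos
  have h2 := G.len_pos
  unfold Box.normConst
  have : 0 < Fintype.card (G.Node × G.Node × Fin 3) := Fintype.card_pos
  positivity

/-- The weight is at least `e^{-2λd}` on the box, and the lower derivatives are already controlled
by `u_zz`. The loss `e^{2λd}` is the very prefactor of the functionals, so no dependence on `lam`
remains. -/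
lemma norm_sq_le_mass {lam : ℝ} (hl : 1 ≤ lam) (u : Sob₀ G ν) :
    ‖u‖ ^ 2 ≤ G.normConst * (Real.exp (2 * lam * G.d) * mass lam u) := by
  have hh := G.h_pos
  have hlen := G.len_pos
  have hl0 : 0 < lam := by linarith
  have hm := mass_nonneg lam u
  have hw : ∀ (r : Fin 3) j s, ∫ x, ‖zD u.1 r j s x‖ ^ 2 * Real.exp (-2 * lam * x.1) ∂(G.dom ν)
      ≤ (1 + G.len) * mass lam u := by
    intro r j s
    fin_cases r
    · refine (integral_weighted_zD_zero hl0 u j s).trans ?_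
      gcongr
      have : G.len / (2 * lam ^ 3) ≤ G.len := by
        refine div_le_self hlen.le ?_
        have := one_le_pow₀ hl (n := 3)
        linarith
      linarith
    · refine (integral_weighted_zD_one hl0 u j s).trans ?_
      gcongr
      have : G.len / (2 * lam) ≤ G.len := div_le_self hlen.le (by linarith)
      linarith
    · refine le_trans ?_ (le_mul_of_one_le_left hm (by linarith))
      rcases G.lateral_or_mid j s with h | ⟨i, l, rfl, rfl⟩
      · rw [integral_eq_zero_of_ae]
        · exact hm
        · filter_upwards [ae_zD_lateral u 2 h] with x hx
          change ‖zD u.1 2 j s x‖ ^ 2 * _ = 0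
          rw [hx]
          simp
      · refine le_trans ?_ (Finset.single_le_sum (f := fun i => ∑ l, ∫ x,
          ‖zD u.1 2 (G.mid i) (G.mid l) x‖ ^ 2 * Real.exp (-2 * lam * x.1) ∂(G.dom ν))
          (fun _ _ => Finset.sum_nonneg fun _ _ => integral_nonneg fun _ => by positivity)
          (Finset.mem_univ i))
        exact Finset.single_le_sum (f := fun l => ∫ x,
          ‖zD u.1 2 (G.mid i) (G.mid l) x‖ ^ 2 * Real.exp (-2 * lam * x.1) ∂(G.dom ν))
          (fun _ _ => integral_nonneg fun _ => by positivity) (Finset.mem_univ l)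
  have h1 : ∀ (r : Fin 3) j s, ∫ x, ‖zD u.1 r j s x‖ ^ 2 ∂(G.dom ν)
      ≤ Real.exp (2 * lam * G.d) * ((1 + G.len) * mass lam u) := by
    intro r j s
    refine le_trans ?_ (mul_le_mul_of_nonneg_left (hw r j s) (Real.exp_pos _).le)
    rw [← integral_const_mul]
    refine integral_mono_ae (integrable_sq_zD _ _ _ _)
      ((Box.integrable_mul_exp lam (integrable_sq_zD _ _ _ _)).const_mul _) ?_
    filter_upwards [Box.ae_mem (G := G) (ν := ν)] with x hx
    have : 1 ≤ Real.exp (2 * lam * G.d) * Real.exp (-2 * lam * x.1) := by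
      rw [← Real.exp_add]
      refine Real.one_le_exp ?_
      nlinarith [hx.2]
    calc ‖zD u.1 r j s x‖ ^ 2 ≤ ‖zD u.1 r j s x‖ ^ 2
          * (Real.exp (2 * lam * G.d) * Real.exp (-2 * lam * x.1)) :=
          le_mul_of_one_le_right (sq_nonneg _) this
      _ = _ := by ring
  rw [Submodule.coe_norm, norm_sq_eq_sum]
  calc _ ≤ ∑ a : G.Node × G.Node × Fin 3,
        G.h ^ 2 * (Real.exp (2 * lam * G.d) * ((1 + G.len) * mass lam u)) := by
        gcongr with a _
        exact h1 _ _ _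
    _ = _ := by
        rw [Finset.sum_const, Finset.card_univ, nsmul_eq_mul]
        unfold Box.normConst
        ring

/-- An upper bound for the weight `e^{-2λz}` on the box. -/
def Box.wMax (G : Box) (lam : ℝ) : ℝ := Real.exp (2 * lam * G.ξ)

lemma Box.exp_le_wMax {lam z : ℝ} (hl : 0 ≤ lam) (hz : z ∈ Ioo (-G.ξ) G.d) :
    Real.exp (-2 * lam * z) ≤ G.wMax lam := by
  refine Real.exp_le_exp.2 ?_
  nlinarith [hz.1]

lemma integral_mul_exp_le {lam : ℝ} (hl : 0 ≤ lam) {f : ℝ × K → ℝ} (hf0 : ∀ x, 0 ≤ f x)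
    (hf : Integrable f (G.dom ν)) :
    ∫ x, f x * Real.exp (-2 * lam * x.1) ∂(G.dom ν) ≤ G.wMax lam * ∫ x, f x ∂(G.dom ν) := by
  rw [← integral_const_mul]
  refine integral_mono_ae (Box.integrable_mul_exp lam hf) (hf.const_mul _) ?_
  filter_upwards [Box.ae_mem (G := G) (ν := ν)] with x hx
  rw [mul_comm]
  exact mul_le_mul_of_nonneg_right (Box.exp_le_wMax hl hx) (hf0 x)

/-- A crude reverse bound whose constant grows with `lam`. It serves only for differentiability,
where `lam` is fixed. -/
lemma mass_le_norm {lam : ℝ} (hl : 0 ≤ lam) (u : Sob₀ G ν) :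
    mass lam u ≤ G.n ^ 2 * (G.wMax lam * (‖u‖ ^ 2 / G.h ^ 2)) := by
  unfold mass
  calc _ ≤ ∑ _i : Fin G.n, ∑ _l : Fin G.n, G.wMax lam * (‖u‖ ^ 2 / G.h ^ 2) := by
        gcongr with i _ l _
        refine (integral_mul_exp_le hl (fun _ => sq_nonneg _) (integrable_sq_zD _ _ _ _)).trans ?_
        refine mul_le_mul_of_nonneg_left ?_ (Real.exp_pos _).le
        rw [Submodule.coe_norm, ← integral_totalSq]
        exact integral_mono (integrable_sq_zD _ _ _ _) (integrable_totalSq _)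
          fun x => sq_zD_le_totalSq _ _ _ _ _
    _ = _ := by
        simp only [Finset.sum_const, Finset.card_univ, Fintype.card_fin, nsmul_eq_mul]
        ring

lemma lapMass_le_norm {lam : ℝ} (hl : 0 ≤ lam) (u : Sob G ν 2) :
    lapMass lam u ≤ G.n ^ 2 * (G.wMax lam * ((1 + 8 / G.h ^ 2) ^ 2 * (‖u‖ ^ 2 / G.h ^ 2))) := by
  unfold lapMass
  calc _ ≤ ∑ _i : Fin G.n, ∑ _l : Fin G.n,
        G.wMax lam * ((1 + 8 / G.h ^ 2) ^ 2 * (‖u‖ ^ 2 / G.h ^ 2)) := by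
        gcongr with i _ l _
        refine (integral_mul_exp_le hl (fun _ => sq_nonneg _) (integrable_sq_lap _ _ _)).trans ?_
        exact mul_le_mul_of_nonneg_left (integral_sq_lap_le u i l) (Real.exp_pos _).le
    _ = _ := by
        simp only [Finset.sum_const, Finset.card_univ, Fintype.card_fin, nsmul_eq_mul]
        ring

end Carleman

/-! ### Completeness of the space with zero boundary conditions -/

section Complete

variable {K : Type} [MeasurableSpace K] {G : Box} {ν : Measure K} [SFinite ν]

lemma Box.ae_sq_primitive_le {a : ℝ} (ha : a ∈ Icc (-G.ξ) G.d) (v : Lp ℂ 2 (G.wt ν)) :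
    ∀ᵐ x ∂(G.dom ν), ‖∫ t in a..x.1, v (t, x.2)‖ ^ 2 ≤ G.len * G.sliceSq 0 v x.2 := by
  filter_upwards [Box.ae_param (G := G) (Box.ae_slice_integrable v), Box.ae_mem (G := G) (ν := ν)]
    with x hx hm
  have := sq_norm_intervalIntegral_le (g := fun z => v (z, x.2))
    ((Box.measurable_coe v).comp (by fun_prop)) hx G.lt ha (Ioo_subset_Icc_self hm)
  rw [G.sub_eq_len] at this
  simpa [Box.sliceSq] using this

lemma Box.integrable_sq_primitive {a : ℝ} (ha : a ∈ Icc (-G.ξ) G.d) (v : Lp ℂ 2 (G.wt ν)) :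
    Integrable (fun x : ℝ × K => ‖∫ t in a..x.1, v (t, x.2)‖ ^ 2) (G.dom ν) := by
  refine Integrable.mono' (Box.integrable_param
    ((Box.integrable_sliceSq 0 (Box.integrable_sq v)).const_mul G.len)) ?_ ?_
  · exact ((Box.measurable_primitive a (Box.measurable_coe v)).norm.pow_const 2).aestronglyMeasurable
  · filter_upwards [Box.ae_sq_primitive_le ha v] with x hx
    rwa [Real.norm_of_nonneg (sq_nonneg _)]

lemma Box.memLp_primitive {a : ℝ} (ha : a ∈ Icc (-G.ξ) G.d) (v : Lp ℂ 2 (G.wt ν)) :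
    MemLp (fun x : ℝ × K => ∫ t in a..x.1, v (t, x.2)) 2 (G.wt ν) :=
  (memLp_two_iff_integrable_sq_norm
    (Box.measurable_primitive a (Box.measurable_coe v)).aestronglyMeasurable).2
    (Box.integrable_wt_iff.2 (Box.integrable_sq_primitive ha v))

lemma Box.traceAt_toLp {a : ℝ} (ha : a ∈ Icc (-G.ξ) G.d) (v : Lp ℂ 2 (G.wt ν)) :
    G.TraceAt ν a ((Box.memLp_primitive ha v).toLp _) v 0 := by
  have := Box.wt_ae.1 (Box.memLp_primitive ha v).coeFn_toLp
  unfold Box.TraceAt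
  filter_upwards [this] with x hx
  rw [hx]
  simp

lemma Box.TraceAt.unique {ν : Measure K} {a : ℝ} {u u' v : Lp ℂ 2 (G.wt ν)} (h : G.TraceAt ν a u v 0)
    (h' : G.TraceAt ν a u' v 0) : u = u' := by
  refine Lp.ext (Box.wt_ae.2 ?_)
  filter_upwards [h, h'] with x hx hx'
  rw [hx, hx']

/-- The primitive in `z` with the value `0` at `z = a`, as an operator. -/
def Box.primitive {a : ℝ} (ha : a ∈ Icc (-G.ξ) G.d) :
    Lp ℂ 2 (G.wt ν) →L[ℝ] Lp ℂ 2 (G.wt ν) :=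
  LinearMap.mkContinuous
    { toFun := fun v => (Box.memLp_primitive ha v).toLp _
      map_add' := fun v v' => (Box.traceAt_toLp ha (v + v')).unique
        ((Box.traceAt_toLp ha v).add₀ ha (Box.traceAt_toLp ha v'))
      map_smul' := fun c v => (Box.traceAt_toLp ha (c • v)).unique
        ((Box.traceAt_toLp ha v).smul₀ ha c) } G.len <| by
    intro v
    have hlen := G.len_pos
    refine (sq_le_sq₀ (norm_nonneg _) (by positivity)).1 ?_
    change ‖(Box.memLp_primitive ha v).toLp _‖ ^ 2 ≤ _
    rw [Box.norm_sq_eq, mul_pow, Box.norm_sq_eq]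
    have h1 := integral_mono_ae (Box.integrable_sq _)
      (Box.integrable_param ((Box.integrable_sliceSq 0 (Box.integrable_sq v)).const_mul G.len))
      (show ∀ᵐ x ∂(G.dom ν), ‖(Box.memLp_primitive ha v).toLp _ x‖ ^ 2
        ≤ G.len * G.sliceSq 0 v x.2 by
        filter_upwards [Box.wt_ae.1 (Box.memLp_primitive ha v).coeFn_toLp,
          Box.ae_sq_primitive_le ha v] with x hx hx'
        rwa [hx])
    rw [Box.integral_param (fun k => G.len * G.sliceSq 0 v k), integral_const_mul,
      Box.integral_sliceSq 0 (Box.integrable_sq v)] at h1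
    simp only [mul_zero, zero_mul, Real.exp_zero, mul_one] at h1
    calc _ ≤ G.h ^ 2 * (G.len * (G.len * ∫ x, ‖v x‖ ^ 2 ∂(G.dom ν))) := by gcongr
      _ = _ := by ring

/-- A homogeneous trace condition becomes an equation between bounded operators, hence a closed
condition. -/
lemma Box.traceAt_iff {a : ℝ} (ha : a ∈ Icc (-G.ξ) G.d) {u v : Lp ℂ 2 (G.wt ν)} :
    G.TraceAt ν a u v 0 ↔ u = Box.primitive ha v :=
  ⟨fun h => h.unique (Box.traceAt_toLp ha v), fun h => by rw [h]; exact Box.traceAt_toLp ha v⟩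

lemma ae_eq_zero_iff {ν : Measure K} {v : Lp ℂ 2 (G.wt ν)} : (∀ᵐ x ∂(G.dom ν), v x = 0) ↔ v = 0 := by
  rw [← Box.wt_ae, Lp.eq_zero_iff_ae_eq_zero]
  rfl

/-- The image in the ambient `L²` product is cut out by closed linear equations. With zero data on
`Γ` the existence of weak derivatives is itself one of these equations, so closedness of the whole
space `Sob` is not needed. -/
instance completeSpace_Sob₀ : CompleteSpace (Sob₀ G ν) := by
  have hL := G.left_mem
  have hR := G.right_mem
  have himage : ((↑) : Sob G ν 2 → PiLp 2 (fun _ : G.Node × G.Node × Fin 3 => Lp ℂ 2 (G.wt ν))) ''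
      (Sob₀ G ν : Set (Sob G ν 2)) = {f |
        (∀ i l, f (G.mid i, G.mid l, 0) = Box.primitive hL (f (G.mid i, G.mid l, 1))) ∧
        (∀ i l, f (G.mid i, G.mid l, 1) = Box.primitive hL (f (G.mid i, G.mid l, 2))) ∧
        (∀ i l, f (G.mid i, G.mid l, 0) = Box.primitive hR (f (G.mid i, G.mid l, 1))) ∧
        (∀ j s r, G.Lateral j s → f (j, s, r) = 0)} := by
    ext f
    constructor
    · rintro ⟨u, hu, rfl⟩
      have hu' : HasBC u 0 0 := hu
      refine ⟨fun i l => (Box.traceAt_iff hL).1 (hu'.1 i l),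
        fun i l => (Box.traceAt_iff hL).1 (hu'.2.1 i l),
        fun i l => (Box.traceAt_iff hR).1 (hu'.2.2.1 i l), fun j s r h => ?_⟩
      exact ae_eq_zero_iff.1 (ae_zD_lateral ⟨u, hu⟩ r h)
    · rintro ⟨h1, h2, h3, h4⟩
      -- At interior nodes the derivative relations follow from the two trace equations at `z = -ξ`;
      -- at lateral nodes all components are zero.
      have hf : f ∈ Sob G ν 2 := by
        intro j s r
        rcases G.lateral_or_mid j s with h | ⟨i, l, rfl, rfl⟩
        · rw [h4 j s _ h, h4 j s _ h]
          exact ⟨0, Box.TraceAt.zero hL⟩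
        · refine ⟨0, (Box.traceAt_iff hL).2 ?_⟩
          fin_cases r
          exacts [h1 i l, h2 i l]
      exact ⟨⟨f, hf⟩, ⟨fun i l => (Box.traceAt_iff hL).2 (h1 i l),
        fun i l => (Box.traceAt_iff hL).2 (h2 i l), fun i l => (Box.traceAt_iff hR).2 (h3 i l),
        fun j s h => ae_eq_zero_iff.2 (h4 j s 0 h)⟩, rfl⟩
  have hclosed : IsClosed (((↑) : Sob G ν 2 →
      PiLp 2 (fun _ : G.Node × G.Node × Fin 3 => Lp ℂ 2 (G.wt ν))) ''
      (Sob₀ G ν : Set (Sob G ν 2))) := by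
    rw [himage]
    have hp : ∀ a, Continuous fun f : PiLp 2 (fun _ : G.Node × G.Node × Fin 3 =>
        Lp ℂ 2 (G.wt ν)) => f a := fun a => PiLp.continuous_apply 2 _ a
    simp only [ofPred_and, ofPred_forall]
    refine IsClosed.inter ?_ (IsClosed.inter ?_ (IsClosed.inter ?_ ?_))
    · exact isClosed_iInter fun i => isClosed_iInter fun l =>
        isClosed_eq (hp _) ((Box.primitive hL).continuous.comp (hp _))
    · exact isClosed_iInter fun i => isClosed_iInter fun l =>
        isClosed_eq (hp _) ((Box.primitive hL).continuous.comp (hp _))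
    · exact isClosed_iInter fun i => isClosed_iInter fun l =>
        isClosed_eq (hp _) ((Box.primitive hR).continuous.comp (hp _))
    · exact isClosed_iInter fun i => isClosed_iInter fun l => isClosed_iInter fun r =>
        isClosed_iInter fun _ => isClosed_eq (hp _) continuous_const
  refine IsComplete.completeSpace_coe (s := (Sob₀ G ν : Set (Sob G ν 2))) ?_
  exact isUniformEmbedding_subtype_val.isComplete_iff.1 hclosed.isComplete

end Complete

/-! ### Existence, uniqueness and boundedness of the tail function -/

section Minimizer

/-- A strongly convex nonnegative functional has a unique minimizer. -/
lemma existsUnique_isMinOn {E : Type*} [NormedAddCommGroup E] [NormedSpace ℝ E] [CompleteSpace E]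
    {f : E → ℝ} {c C : ℝ} (hf0 : ∀ x, 0 ≤ f x) (hc : 0 < c)
    (hcont : ∀ x y : E, ∀ t : ℝ, 0 < t → f x ≤ (1 + t) * f y + (1 + 1 / t) * (C * ‖x - y‖ ^ 2))
    (hconv : ∀ x y, f ((1 / 2 : ℝ) • (x + y)) + c * ‖x - y‖ ^ 2 ≤ (f x + f y) / 2) :
    ∃! x, IsMinOn f univ x := by
  have hbdd : BddBelow (range f) := ⟨0, by rintro _ ⟨x, rfl⟩; exact hf0 x⟩
  set I := ⨅ x, f x with hI
  have hIle : ∀ x, I ≤ f x := fun x => ciInf_le hbdd x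
  have hex : ∀ n : ℕ, ∃ x, f x < I + 1 / ((n : ℝ) + 1) := fun n =>
    exists_lt_of_ciInf_lt (by
      have : 0 < 1 / ((n : ℝ) + 1) := by positivity
      linarith)
  choose s hs using hex
  -- The midpoint has value at least `I`, so two almost minimal points are close. This gives both
  -- the Cauchy property and, with `e = 0`, uniqueness.
  have hdist : ∀ x y : E, ∀ e : ℝ, f x ≤ I + e → f y ≤ I + e → dist x y ≤ √(e / c) := by
    intro x y e hx hy
    rw [dist_eq_norm]
    refine Real.le_sqrt_of_sq_le ?_
    rw [le_div_iff₀ hc]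
    linarith [hconv x y, hIle ((1 / 2 : ℝ) • (x + y))]
  have hcau : CauchySeq s := by
    refine cauchySeq_of_le_tendsto_0 (fun N : ℕ => √(1 / ((N : ℝ) + 1) / c)) ?_ ?_
    · intro n m N hn hm
      have hle : ∀ n : ℕ, N ≤ n → f (s n) ≤ I + 1 / ((N : ℝ) + 1) := by
        intro n hn
        refine (hs n).le.trans ?_
        gcongr
      exact hdist _ _ _ (hle n hn) (hle m hm)
    · have h1 := (tendsto_one_div_add_atTop_nhds_zero_nat (𝕜 := ℝ)).div_const c
      simpa using h1.sqrt
  obtain ⟨x, hx⟩ := cauchySeq_tendsto_of_complete hcau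
  -- Instead of continuity, `hcont` is used: the limit along the sequence for fixed `t` gives `f x ≤
  -- (1 + t) * I`, after which `t` is made small.
  have hfx : f x ≤ I := by
    have h1 : ∀ t : ℝ, 0 < t → f x ≤ (1 + t) * I := by
      intro t ht
      have h2 : Filter.Tendsto (fun n : ℕ => (1 + t) * (I + 1 / ((n : ℝ) + 1))
          + (1 + 1 / t) * (C * ‖x - s n‖ ^ 2)) Filter.atTop
          (nhds ((1 + t) * (I + 0) + (1 + 1 / t) * (C * ‖x - x‖ ^ 2))) :=
        ((tendsto_const_nhds.add (tendsto_one_div_add_atTop_nhds_zero_nat (𝕜 := ℝ))).const_mul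
          _).add ((((hx.const_sub x).norm.pow 2).const_mul _).const_mul _)
      simp only [sub_self, norm_zero, add_zero] at h2
      norm_num at h2
      refine ge_of_tendsto' h2 fun n => ?_
      refine (hcont x (s n) t ht).trans ?_
      have := (hs n).le
      norm_num at this ⊢
      gcongr
    refine le_of_forall_pos_le_add fun e he => ?_
    have hI0 : 0 ≤ I := le_ciInf hf0
    have h3 := h1 (e / (I + 1)) (by positivity)
    have h4 : e / (I + 1) * I ≤ e := by
      rw [div_mul_eq_mul_div, div_le_iff₀ (by positivity)]
      nlinarith
    linarith
  refine ⟨x, fun y _ => hfx.trans (hIle y), ?_⟩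
  intro y hy
  have hy' : f y ≤ I + 0 := by
    rw [add_zero]
    exact le_ciInf fun z => hy (mem_univ z)
  have := hdist y x 0 hy' (by rwa [add_zero])
  simpa using this

variable {K : Type} [MeasurableSpace K] {G : Box} {ν : Measure K} [SFinite ν]

/-- Young's inequality with a free parameter. It yields the continuity needed for the minimizer with
`t` small, and the factor `2` in the stability estimate with `t = 1`. -/
lemma lapMass_add_le (lam : ℝ) (f g : Sob G ν 2) {t : ℝ} (ht : 0 < t) :
    lapMass lam (f + g) ≤ (1 + t) * lapMass lam f + (1 + 1 / t) * lapMass lam g := by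
  simp only [lapMass, Finset.mul_sum, ← Finset.sum_add_distrib]
  refine Finset.sum_le_sum fun i _ => Finset.sum_le_sum fun l _ => ?_
  have i1 := Box.integrable_mul_exp lam (integrable_sq_lap f i l)
  have i2 := Box.integrable_mul_exp lam (integrable_sq_lap g i l)
  rw [← integral_const_mul, ← integral_const_mul, ← integral_add (i1.const_mul _) (i2.const_mul _)]
  refine integral_mono_ae (Box.integrable_mul_exp lam (integrable_sq_lap _ i l))
    ((i1.const_mul _).add (i2.const_mul _)) ?_
  filter_upwards [ae_zD_add f g] with x hx
  rw [lap_eq_add hx, ← mul_assoc, ← mul_assoc, ← add_mul]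
  refine mul_le_mul_of_nonneg_right ?_ (Real.exp_pos _).le
  set a := ‖lap f i l x‖
  set b := ‖lap g i l x‖
  have h1 : ‖lap f i l x + lap g i l x‖ ^ 2 ≤ (a + b) ^ 2 :=
    pow_le_pow_left₀ (norm_nonneg _) (norm_add_le _ _) 2
  have h2 : (1 + t) * a ^ 2 + (1 + 1 / t) * b ^ 2 - (a + b) ^ 2 = (t * a - b) ^ 2 / t := by
    field_simp
    ring
  have h3 : 0 ≤ (t * a - b) ^ 2 / t := by positivity
  linarith

/-- This is the parallelogram law, in fact an equality pointwise. -/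
lemma lapMass_midpoint (lam : ℝ) (f g : Sob G ν 2) :
    lapMass lam ((1 / 2 : ℝ) • (f + g)) + 1 / 4 * lapMass lam (f - g)
      ≤ (lapMass lam f + lapMass lam g) / 2 := by
  simp only [lapMass, Finset.mul_sum, ← Finset.sum_add_distrib, Finset.sum_div]
  refine Finset.sum_le_sum fun i _ => Finset.sum_le_sum fun l _ => ?_
  have hi := fun f => Box.integrable_mul_exp lam (integrable_sq_lap (G := G) (ν := ν) f i l)
  rw [← integral_const_mul, ← integral_add (hi f) (hi g), ← integral_div,
    ← integral_add (hi _) ((hi _).const_mul _)]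
  refine integral_mono_ae ((hi _).add ((hi _).const_mul _)) (((hi f).add (hi g)).div_const 2) ?_
  -- The representative of `f` is rewritten through `f = (f - g) + g`, so that only additivity is
  -- used.
  filter_upwards [ae_zD_add f g, ae_zD_smul (1 / 2) (f + g), ae_zD_add (f - g) g] with x h1 h2 h3
  rw [sub_add_cancel] at h3
  have e := lap_eq_add h3 i l
  rw [lap_eq_smul h2, lap_eq_add h1, e]
  refine le_of_eq ?_
  have h4 : ∀ a b : ℂ, ‖((1 / 2 : ℝ) : ℂ) * (a + b + b)‖ ^ 2 + 1 / 4 * ‖a‖ ^ 2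
      = (‖a + b‖ ^ 2 + ‖b‖ ^ 2) / 2 := by
    intro a b
    simp only [← Complex.normSq_eq_norm_sq, Complex.normSq_apply, Complex.add_re, Complex.add_im,
      Complex.mul_re, Complex.mul_im, Complex.ofReal_re, Complex.ofReal_im]
    ring
  have := h4 (lap (f - g) i l x) (lap g i l x)
  linear_combination Real.exp (-2 * lam * x.1) * this

lemma norm_sq_le_lapMass {lam : ℝ} (hl : G.carlemanParam ≤ lam) (u : Sob₀ G ν) :
    ‖u‖ ^ 2 ≤ 4 * G.normConst * Real.exp (2 * lam * G.d) * lapMass lam u.1 := by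
  have h1 := norm_sq_le_mass (by linarith [G.two_le_carlemanParam] : 1 ≤ lam) u
  have h2 := mass_le_lapMass hl u
  have h3 := G.normConst_pos
  calc _ ≤ _ := h1
    _ ≤ G.normConst * (Real.exp (2 * lam * G.d) * (4 * lapMass lam u.1)) := by gcongr
    _ = _ := by ring

lemma tailCost_eq (Q : HΩ G 2) (μ : ℝ) (W : HΩ₀ G) :
    tailCost G Q μ W = Real.exp (2 * μ * G.d) * (G.h ^ 2 * lapMass μ (W.1 + Q)) := by
  unfold tailCost lapMass
  rw [weightedSq_eq]
  congr 2
  refine Finset.sum_congr rfl fun i _ => Finset.sum_congr rfl fun l _ => integral_congr_ae ?_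
  filter_upwards [ae_zD_add W.1 Q] with x hx
  rw [lap_eq_add hx]

/-- The parallelogram law leaves a quarter of the residual of the difference, which the Carleman
estimate bounds below by its norm. Together they give the modulus of convexity `h² / (16 ·
normConst)`. -/
theorem existsUnique_tail (Q : HΩ G 2) {μ : ℝ} (hμ : G.carlemanParam ≤ μ) :
    ∃! W : HΩ₀ G, IsMinOn (tailCost G Q μ) univ W := by
  have hh := G.h_pos
  have hN := G.normConst_pos
  have h0 : 0 ≤ μ := by linarith [G.two_le_carlemanParam]
  set e := Real.exp (2 * μ * G.d) with he
  have hepos : 0 < e := Real.exp_pos _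
  refine existsUnique_isMinOn (c := G.h ^ 2 / (16 * G.normConst))
    (C := e * (G.h ^ 2 * (G.n ^ 2 * (G.wMax μ * ((1 + 8 / G.h ^ 2) ^ 2 * (1 / G.h ^ 2))))))
    ?_ (by positivity) ?_ ?_
  · intro W
    rw [tailCost_eq]
    have := lapMass_nonneg μ (W.1 + Q)
    positivity
  · intro x y t ht
    rw [tailCost_eq, tailCost_eq, ← he]
    have h1 := lapMass_add_le μ (y.1 + Q) (x - y).1 ht
    have e1 : y.1 + Q + (x - y).1 = x.1 + Q := by
      rw [Submodule.coe_sub]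
      abel
    rw [e1] at h1
    have h2 := lapMass_le_norm h0 (x - y).1
    calc _ ≤ e * (G.h ^ 2 * ((1 + t) * lapMass μ (y.1 + Q) + (1 + 1 / t) *
          (G.n ^ 2 * (G.wMax μ * ((1 + 8 / G.h ^ 2) ^ 2 * (‖(x - y).1‖ ^ 2 / G.h ^ 2)))))) := by
          gcongr
          refine h1.trans ?_
          gcongr
      _ = _ := by
          rw [← Submodule.coe_norm]
          ring
  · intro x y
    rw [tailCost_eq, tailCost_eq, tailCost_eq, ← he]
    have h1 := lapMass_midpoint μ (x.1 + Q) (y.1 + Q)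
    have e1 : (1 / 2 : ℝ) • (x.1 + Q + (y.1 + Q)) = ((1 / 2 : ℝ) • (x + y)).1 + Q := by
      rw [Submodule.coe_smul, Submodule.coe_add]
      module
    have e2 : x.1 + Q - (y.1 + Q) = (x - y).1 := by
      rw [Submodule.coe_sub]
      abel
    rw [e1, e2] at h1
    have h2 := norm_sq_le_lapMass hμ (x - y)
    rw [← he] at h2
    have h3 : G.h ^ 2 / (16 * G.normConst) * ‖x - y‖ ^ 2
        ≤ e * (G.h ^ 2 * (1 / 4 * lapMass μ (x - y).1)) := by
      calc _ ≤ G.h ^ 2 / (16 * G.normConst) * (4 * G.normConst * e * lapMass μ (x - y).1) := by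
            gcongr
        _ = _ := by
            field_simp
            ring
    calc _ ≤ e * (G.h ^ 2 * lapMass μ (((1 / 2 : ℝ) • (x + y)).1 + Q))
          + e * (G.h ^ 2 * (1 / 4 * lapMass μ (x - y).1)) := by gcongr
      _ = e * (G.h ^ 2 * (lapMass μ (((1 / 2 : ℝ) • (x + y)).1 + Q)
          + 1 / 4 * lapMass μ (x - y).1)) := by ring
      _ ≤ e * (G.h ^ 2 * ((lapMass μ (x.1 + Q) + lapMass μ (y.1 + Q)) / 2)) := by gcongr
      _ = _ := by ring

lemma HasBC.sub_mem {f g : Sob G ν 2} {φ₀ φ₁ : Fin G.n → Fin G.n → K → ℂ} (hf : HasBC f φ₀ φ₁)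
    (hg : HasBC g φ₀ φ₁) : f - g ∈ Sob₀ G ν := by
  have e : f - g = f + (-1 : ℝ) • g := by module
  have h0 : ∀ φ : K → ℂ, φ + (-1 : ℝ) • φ = 0 := fun φ => by module
  rw [e]
  obtain ⟨h1, h2, h3, h4⟩ := hf
  obtain ⟨h1', h2', h3', h4'⟩ := hg
  refine ⟨fun i l => ?_, fun i l => ?_, fun i l => ?_, fun j s hjs => ?_⟩
  · have := Box.TraceAt.add G.left_mem (h1 i l) (Box.TraceAt.smul G.left_mem (-1) (h1' i l))
    rw [h0] at this
    exact this
  · have := Box.TraceAt.add G.left_mem (h2 i l) (Box.TraceAt.smul G.left_mem (-1) (h2' i l))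
    rw [h0] at this
    exact this
  · have := Box.TraceAt.add G.right_mem (h3 i l) (Box.TraceAt.smul G.right_mem (-1) (h3' i l))
    rw [h0] at this
    exact this
  · filter_upwards [h4 j s hjs, h4' j s hjs, ae_zD_add f ((-1 : ℝ) • g), ae_zD_smul (-1) g]
      with x h h' ha hs
    rw [ha, hs, h, h']
    simp

lemma lapMass_eq_zero {lam : ℝ} {f : Sob G ν 2}
    (h : ∀ i l, ∀ᵐ x ∂(G.dom ν), lap f i l x = 0) : lapMass lam f = 0 := by
  unfold lapMass
  refine Finset.sum_eq_zero fun i _ => Finset.sum_eq_zero fun l _ => integral_eq_zero_of_ae ?_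
  filter_upwards [h i l] with x hx
  simp [hx]

/-- In exponential form this says `e^{2μ(d+ξ)} = 1/δ`: the ratio between the extreme values of the
weight on the box is the inverse noise level. -/
lemma tailParam_eq {δ : ℝ} (hδ : 0 < δ) :
    2 * tailParam G δ * G.len = -Real.log δ := by
  have hlen := G.len_pos
  unfold tailParam
  rw [Real.log_rpow hδ]
  change 2 * (-(1 / (2 * G.len)) * Real.log δ) * G.len = _
  field_simp

lemma le_tailParam {δ lam : ℝ} (hδ : 0 < δ) (h : δ < Real.exp (-2 * (G.d + G.ξ) * lam)) :
    lam ≤ tailParam G δ := by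
  have hlen := G.len_pos
  have h1 := Real.log_lt_log hδ h
  rw [Real.log_exp] at h1
  change Real.log δ < -2 * G.len * lam at h1
  have h2 := tailParam_eq (G := G) hδ
  nlinarith

/-- The constant in the stability estimate for the tail function. -/
def Box.tailConst (G : Box) : ℝ :=
  32 * G.normConst * (G.n ^ 2 * ((1 + 8 / G.h ^ 2) ^ 2 / G.h ^ 2))

/-- The tail function is bounded in terms of the exact one. -/
theorem norm_tail_le {δ : ℝ} (hδ : 0 < δ) (hδ1 : δ ≤ 1)
    (hμ : G.carlemanParam ≤ tailParam G δ) {ψ₀ ψ₁ : Fin G.n → Fin G.n → Unit → ℂ}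
    {Q Qs Vs : HΩ G 2} (hQs : HasBC Qs ψ₀ ψ₁) (hQ : ‖Q - Qs‖ < δ) (hVs : HasBC Vs ψ₀ ψ₁)
    (hlap : ∀ i l, ∀ᵐ x ∂(G.dom (Measure.dirac ())), lap Vs i l x = 0)
    {W : HΩ₀ G} (hW : IsMinOn (tailCost G Q (tailParam G δ)) univ W) :
    ‖W.1 + Q‖ ≤ √G.tailConst + 1 + ‖Vs‖ := by
  have hh := G.h_pos
  have hN := G.normConst_pos
  set μ := tailParam G δ with hμdef
  have h0 : 0 ≤ μ := by linarith [G.two_le_carlemanParam]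
  -- The competitor is admissible because `Vs` and `Qs` share their Cauchy data.
  set Ws : HΩ₀ G := ⟨Vs - Qs, hVs.sub_mem hQs⟩
  have hWs : Ws.1 = Vs - Qs := rfl
  have h1 : lapMass μ (W.1 + Q) ≤ lapMass μ (Ws.1 + Q) := by
    have := hW (mem_univ Ws)
    simp only [mem_ofPred_eq, tailCost_eq] at this
    exact le_of_mul_le_mul_left (le_of_mul_le_mul_left this (Real.exp_pos _)) (by positivity)
  -- Since `Ws + Q = (Q - Qs) + Vs` and `Δ^h Vs = 0`, only the data error contributes to the
  -- residual of the competitor.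
  have h2 : lapMass μ (Ws.1 + Q) ≤ 2 * lapMass μ (Q - Qs) := by
    have e : Ws.1 + Q = Q - Qs + Vs := by
      rw [hWs]
      abel
    have := lapMass_add_le μ (Q - Qs) Vs one_pos
    rw [lapMass_eq_zero hlap] at this
    rw [e]
    linarith
  -- The constant is `2 · (2 + 2)`: minimality bounds both residuals by that of the competitor.
  have h3 : lapMass μ (W - Ws).1 ≤ 8 * lapMass μ (Q - Qs) := by
    have e : (W - Ws).1 = W.1 + Q + (-1 : ℝ) • (Ws.1 + Q) := by
      rw [Submodule.coe_sub]
      module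
    have h4 := lapMass_add_le μ (W.1 + Q) ((-1 : ℝ) • (Ws.1 + Q)) one_pos
    have h5 : lapMass μ ((-1 : ℝ) • (Ws.1 + Q)) = lapMass μ (Ws.1 + Q) := by
      unfold lapMass
      refine Finset.sum_congr rfl fun i _ => Finset.sum_congr rfl fun l _ => integral_congr_ae ?_
      filter_upwards [ae_zD_smul (-1) (Ws.1 + Q)] with x hx
      rw [lap_eq_smul hx]
      simp
    rw [e]
    rw [h5] at h4
    linarith
  have h6 := norm_sq_le_lapMass hμ (W - Ws)
  have h7 := lapMass_le_norm h0 (Q - Qs)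
  -- The loss `1/δ` from the weight meets the squared data error `δ²`, so a factor `δ ≤ 1` is left
  -- over.
  have hexp : Real.exp (2 * μ * G.d) * G.wMax μ = 1 / δ := by
    unfold Box.wMax
    rw [← Real.exp_add]
    have : 2 * μ * G.d + 2 * μ * G.ξ = -Real.log δ := by
      rw [← tailParam_eq (G := G) hδ, Box.len]
      ring
    rw [this, Real.exp_neg, Real.exp_log hδ, one_div]
  have h8 : ‖W - Ws‖ ^ 2 ≤ G.tailConst := by
    calc _ ≤ _ := h6
      _ ≤ 4 * G.normConst * Real.exp (2 * μ * G.d) * (8 * (G.n ^ 2 * (G.wMax μ *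
          ((1 + 8 / G.h ^ 2) ^ 2 * (δ ^ 2 / G.h ^ 2))))) := by
          have : 0 ≤ G.wMax μ := (Real.exp_pos _).le
          gcongr
          refine h3.trans ?_
          gcongr
          refine h7.trans ?_
          gcongr
      _ = G.tailConst * ((Real.exp (2 * μ * G.d) * G.wMax μ) * δ ^ 2) := by
          unfold Box.tailConst
          ring
      _ = G.tailConst * δ := by
          rw [hexp]
          field_simp
      _ ≤ G.tailConst := by
          refine mul_le_of_le_one_right ?_ hδ1
          unfold Box.tailConst
          positivity
  have h9 : ‖(W - Ws).1‖ ≤ √G.tailConst := Real.le_sqrt_of_sq_le h8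
  have e : W.1 + Q = (W - Ws).1 + (Q - Qs) + Vs := by
    rw [Submodule.coe_sub, hWs]
    abel
  rw [e]
  refine (norm_add_le _ _).trans ?_
  refine add_le_add_left ((norm_add_le _ _).trans ?_) _
  linarith

end Minimizer

/-! ### The integral over `(k, k₂)` of the gradient -/

section Volterra

/-- The measure `dz dk` on `(-ξ, d) × (k₁, k₂)`. -/
abbrev Box.domK (G : Box) (k₁ k₂ : ℝ) : Measure (ℝ × ℝ) :=
  G.dom (volume.restrict (Ioo k₁ k₂))

variable {G : Box} {k₁ k₂ : ℝ}

lemma Box.ae_mem_param : ∀ᵐ x ∂(G.domK k₁ k₂), x.2 ∈ Ioo k₁ k₂ :=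
  Box.ae_param (ae_restrict_mem measurableSet_Ioo)

lemma Box.ae_fst {p : ℝ × ℝ → Prop} (h : ∀ᵐ x ∂(G.domK k₁ k₂), p x) :
    ∀ᵐ x ∂(G.domK k₁ k₂), ∀ᵐ κ ∂(volume.restrict (Ioo k₁ k₂)), p (x.1, κ) :=
  Measure.quasiMeasurePreserving_fst.ae (Measure.ae_ae_of_ae_prod h)

/-- A pointwise bound by a function of `k` gives a uniform bound for `∫_k^{k₂}`. -/
lemma ae_norm_volterra_le {g : ℝ × ℝ → ℂ} {ρ e : ℝ → ℝ} (hρ : ∀ z, 0 < ρ z)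
    (he0 : ∀ k, 0 ≤ e k) (he : IntegrableOn e (Ioo k₁ k₂))
    (h : ∀ᵐ x ∂(G.domK k₁ k₂), ‖g x‖ * ρ x.1 ≤ e x.2) :
    ∀ᵐ x ∂(G.domK k₁ k₂), ‖∫ κ in x.2..k₂, g (x.1, κ)‖ * ρ x.1 ≤ ∫ κ in Ioo k₁ k₂, e κ := by
  filter_upwards [Box.ae_fst h, Box.ae_mem_param (G := G) (k₁ := k₁) (k₂ := k₂)] with x hx hm
  have hs : Ioo x.2 k₂ ⊆ Ioo k₁ k₂ := Ioo_subset_Ioo_left hm.1.le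
  have h1 : ‖∫ κ in x.2..k₂, g (x.1, κ)‖ ≤ ∫ κ in Ioo x.2 k₂, e κ / ρ x.1 := by
    rw [intervalIntegral.integral_of_le hm.2.le, integral_Ioc_eq_integral_Ioo]
    refine norm_integral_le_of_norm_le ((he.mono_set hs).div_const _) ?_
    filter_upwards [ae_restrict_of_ae_restrict_of_subset hs hx] with κ hκ
    rwa [le_div_iff₀ (hρ _)]
  rw [integral_div, le_div_iff₀ (hρ _)] at h1
  exact h1.trans (setIntegral_mono_set he (.of_forall he0) (LE.le.eventuallyLE hs))

lemma measurable_volterra {g : ℝ × ℝ → ℂ} (hg : Measurable g) :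
    Measurable fun x : ℝ × ℝ => ∫ κ in x.2..k₂, g (x.1, κ) := by
  have h1 := Box.measurable_primitive k₂ (v := fun y : ℝ × ℝ => g (y.2, y.1)) (by fun_prop)
  have h2 := (h1.comp measurable_swap).neg
  convert h2 using 2 with x
  exact intervalIntegral.integral_symm _ _

lemma integrableOn_sqrt {e : ℝ → ℝ} (hm : Measurable e) (he0 : ∀ k, 0 ≤ e k)
    (he : IntegrableOn e (Ioo k₁ k₂)) : MemLp (fun k => √(e k)) 2 (volume.restrict (Ioo k₁ k₂)) := by
  refine (memLp_two_iff_integrable_sq hm.sqrt.aestronglyMeasurable).2 ?_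
  simp only [Real.sq_sqrt (he0 _)]
  exact he

lemma setIntegral_sqrt_le (hk : k₁ < k₂) {e : ℝ → ℝ} (hm : Measurable e) (he0 : ∀ k, 0 ≤ e k)
    (he : IntegrableOn e (Ioo k₁ k₂)) :
    ∫ k in Ioo k₁ k₂, √(e k) ≤ √((k₂ - k₁) * ∫ k in Ioo k₁ k₂, e k) := by
  have h2 : MemLp (fun _ : ℝ => (1 : ℝ)) 2 (volume.restrict (Ioo k₁ k₂)) := memLp_const 1
  have h := integral_mul_sq_le h2 (integrableOn_sqrt hm he0 he) (fun _ => zero_le_one)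
    (fun _ => Real.sqrt_nonneg _)
  simp only [Real.sq_sqrt (he0 _)] at h
  refine Real.le_sqrt_of_sq_le ?_
  simpa [hk.le] using h

/-- `∫_k^{k₂} ∇^h q dκ` at the node `(i, l)`. -/
def gradInt (q : HK G k₁ k₂ 2) (i l : Fin G.n) (x : ℝ × ℝ) : Fin 3 → ℂ :=
  fun c => ∫ κ in x.2..k₂, grad q i l (x.1, κ) c

lemma measurable_gradInt (q : HK G k₁ k₂ 2) (i l : Fin G.n) (c : Fin 3) :
    Measurable fun x => gradInt q i l x c :=
  measurable_volterra (measurable_grad q i l c)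

/-- A bound for `∇^h q` that depends on `k` only. -/
def gradSup (q : HK G k₁ k₂ 2) (k : ℝ) : ℝ := √(G.supConst ^ 2 * totalSlice q k)

lemma gradSup_nonneg (q : HK G k₁ k₂ 2) (k : ℝ) : 0 ≤ gradSup q k := Real.sqrt_nonneg _

lemma sq_gradSup (q : HK G k₁ k₂ 2) (k : ℝ) :
    gradSup q k ^ 2 = G.supConst ^ 2 * totalSlice q k :=
  Real.sq_sqrt (mul_nonneg (sq_nonneg _) (totalSlice_nonneg _ _))

lemma ae_norm_grad_le_gradSup (q : HK G k₁ k₂ 2) :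
    ∀ᵐ x ∂(G.domK k₁ k₂), ∀ i l c, ‖grad q i l x c‖ ≤ gradSup q x.2 := by
  filter_upwards [ae_norm_grad_le q] with x hx i l c
  refine (hx i l c).trans (le_of_eq ?_)
  rw [gradSup, Real.sqrt_mul (sq_nonneg _), Real.sqrt_sq G.supConst_nonneg]

lemma integrable_gradSup_sq (q : HK G k₁ k₂ 2) :
    IntegrableOn (fun k => G.supConst ^ 2 * totalSlice q k) (Ioo k₁ k₂) :=
  (integrable_totalSlice q).const_mul _

lemma integral_gradSup_sq (q : HK G k₁ k₂ 2) :
    ∫ k in Ioo k₁ k₂, G.supConst ^ 2 * totalSlice q k = (G.supConst * ‖q‖ / G.h) ^ 2 := by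
  rw [integral_const_mul, integral_totalSlice]
  ring

lemma integrable_gradSup (q : HK G k₁ k₂ 2) : IntegrableOn (gradSup q) (Ioo k₁ k₂) :=
  (integrableOn_sqrt ((measurable_totalSlice q).const_mul _)
    (fun _ => mul_nonneg (sq_nonneg _) (totalSlice_nonneg _ _))
    (integrable_gradSup_sq q)).integrable (by norm_num)

/-- Integration in `κ` with Cauchy–Schwarz improves square integrability in `k` to boundedness. The
gradient itself has no such uniform bound in `k`. -/
lemma ae_norm_gradInt_le (hk : k₁ < k₂) (q : HK G k₁ k₂ 2) :
    ∀ᵐ x ∂(G.domK k₁ k₂), ∀ i l c,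
      ‖gradInt q i l x c‖ ≤ √(k₂ - k₁) * (G.supConst * ‖q‖ / G.h) := by
  have hh := G.h_pos
  have hC := G.supConst_nonneg
  simp only [ae_all_iff]
  intro i l c
  have h1 : ∀ᵐ x ∂(G.domK k₁ k₂), ‖grad q i l x c‖ * (fun _ : ℝ => (1 : ℝ)) x.1
      ≤ gradSup q x.2 := by
    filter_upwards [ae_norm_grad_le_gradSup q] with x hx
    simpa using hx i l c
  filter_upwards [ae_norm_volterra_le (fun _ => one_pos) (gradSup_nonneg q)
    (integrable_gradSup q) h1] with x hx
  rw [mul_one] at hx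
  refine hx.trans ((setIntegral_sqrt_le hk ((measurable_totalSlice q).const_mul _)
    (fun _ => mul_nonneg (sq_nonneg _) (totalSlice_nonneg _ _))
    (integrable_gradSup_sq q)).trans (le_of_eq ?_))
  rw [integral_gradSup_sq, Real.sqrt_mul (sub_pos.2 hk).le, Real.sqrt_sq (by positivity)]

lemma ae_integrable_grad (q : HK G k₁ k₂ 2) :
    ∀ᵐ x ∂(G.domK k₁ k₂), ∀ i l c, IntervalIntegrable (fun κ => grad q i l (x.1, κ) c)
      volume x.2 k₂ := by
  filter_upwards [Box.ae_fst (ae_norm_grad_le_gradSup q),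
    Box.ae_mem_param (G := G) (k₁ := k₁) (k₂ := k₂)] with x hx hm i l c
  rw [intervalIntegrable_iff, uIoc_of_le hm.2.le, integrableOn_Ioc_iff_integrableOn_Ioo]
  have h1 : IntegrableOn (fun κ => grad q i l (x.1, κ) c) (Ioo k₁ k₂) := by
    refine Integrable.mono' (integrable_gradSup q) ?_ ?_
    · exact ((measurable_grad q i l c).comp (by fun_prop : Measurable fun κ : ℝ => (x.1, κ))).aestronglyMeasurable
    · filter_upwards [hx] with κ hκ
      exact hκ i l c
  exact h1.mono_set (Ioo_subset_Ioo_left hm.1.le)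

lemma gradInt_congr {q : HK G k₁ k₂ 2} {i l : Fin G.n} {x : ℝ × ℝ} {g : ℝ → Fin 3 → ℂ}
    (hm : x.2 ∈ Ioo k₁ k₂)
    (h : ∀ᵐ κ ∂(volume.restrict (Ioo k₁ k₂)), grad q i l (x.1, κ) = g κ) (c : Fin 3) :
    gradInt q i l x c = ∫ κ in x.2..k₂, g κ c := by
  unfold gradInt
  rw [intervalIntegral.integral_of_le hm.2.le, intervalIntegral.integral_of_le hm.2.le,
    integral_Ioc_eq_integral_Ioo, integral_Ioc_eq_integral_Ioo]
  refine integral_congr_ae ?_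
  filter_upwards [ae_restrict_of_ae_restrict_of_subset (Ioo_subset_Ioo_left hm.1.le) h] with κ hκ
  rw [hκ]

lemma ae_gradInt_add (q r : HK G k₁ k₂ 2) :
    ∀ᵐ x ∂(G.domK k₁ k₂), ∀ i l, gradInt (q + r) i l x = gradInt q i l x + gradInt r i l x := by
  filter_upwards [Box.ae_fst (ae_zD_add q r), ae_integrable_grad q, ae_integrable_grad r,
    Box.ae_mem_param (G := G) (k₁ := k₁) (k₂ := k₂)] with x hx h1 h2 hm i l
  ext c
  rw [gradInt_congr (g := fun κ => grad q i l (x.1, κ) + grad r i l (x.1, κ)) hm]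
  · exact intervalIntegral.integral_add (h1 i l c) (h2 i l c)
  · filter_upwards [hx] with κ hκ
    exact grad_eq_add hκ i l

lemma ae_gradInt_smul (a : ℝ) (q : HK G k₁ k₂ 2) :
    ∀ᵐ x ∂(G.domK k₁ k₂), ∀ i l, gradInt (a • q) i l x = (a : ℂ) • gradInt q i l x := by
  filter_upwards [Box.ae_fst (ae_zD_smul a q),
    Box.ae_mem_param (G := G) (k₁ := k₁) (k₂ := k₂)] with x hx hm i l
  ext c
  rw [gradInt_congr (g := fun κ => (a : ℂ) • grad q i l (x.1, κ)) hm]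
  · exact intervalIntegral.integral_const_mul _ _
  · filter_upwards [hx] with κ hκ
    exact grad_eq_smul hκ i l

/-- The tail has no parameter: for the Dirac measure the only slice carries the full norm, so the
embedding gives a uniform bound. -/
lemma ae_norm_grad_tail_le (V : HΩ G 2) :
    ∀ᵐ x ∂(G.domK k₁ k₂), ∀ i l c, ‖grad V i l (x.1, ()) c‖ ≤ G.supConst * ‖V‖ / G.h := by
  have hh := G.h_pos
  have e : totalSlice V () = ‖V‖ ^ 2 / G.h ^ 2 := by
    rw [← integral_totalSlice V]
    simp
  have h1 := Box.ae_swap (ae_norm_grad_le V)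
  have h2 : ∀ᵐ z ∂(volume.restrict (Ioo (-G.ξ) G.d)),
      ∀ i l c, ‖grad V i l (z, ()) c‖ ≤ G.supConst * √(totalSlice V ()) := by
    rw [ae_dirac_eq] at h1
    exact h1
  have h3 : ∀ᵐ x ∂(G.domK k₁ k₂), ∀ i l c,
      ‖grad V i l (x.1, ()) c‖ ≤ G.supConst * √(totalSlice V ()) :=
    Measure.quasiMeasurePreserving_fst.ae h2
  rw [e, ← div_pow, Real.sqrt_sq (by positivity)] at h3
  simpa only [mul_div_assoc] using h3

/-- The factor that makes the weighted gradient small for large `lam`. -/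
def Box.small (G : Box) (lam : ℝ) : ℝ := (1 + 1 / G.h) ^ 2 * (1 + 1 / lam) ^ 2 / (2 * lam)

lemma Box.small_nonneg {lam : ℝ} (hl : 0 < lam) : 0 ≤ G.small lam := by
  have := G.h_pos
  unfold Box.small
  positivity

/-- A weighted bound for `∇^h r` that depends on `k` only. -/
def wSup (lam : ℝ) (r : HK₀ G k₁ k₂) (k : ℝ) : ℝ := √(G.small lam * energy lam r k)

/-- A weighted bound for `∫_k^{k₂} ∇^h r dκ`. -/
def wSupInt (lam : ℝ) (r : HK₀ G k₁ k₂) : ℝ := √((k₂ - k₁) * (G.small lam * mass lam r))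

lemma wSup_nonneg (lam : ℝ) (r : HK₀ G k₁ k₂) (k : ℝ) : 0 ≤ wSup lam r k := Real.sqrt_nonneg _

lemma sq_wSup {lam : ℝ} (hl : 0 < lam) (r : HK₀ G k₁ k₂) (k : ℝ) :
    wSup lam r k ^ 2 = G.small lam * energy lam r k :=
  Real.sq_sqrt (mul_nonneg (G.small_nonneg hl) (energy_nonneg _ _ _))

lemma sq_wSupInt {lam : ℝ} (hl : 0 < lam) (hk : k₁ < k₂) (r : HK₀ G k₁ k₂) :
    wSupInt lam r ^ 2 = (k₂ - k₁) * (G.small lam * mass lam r) :=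
  Real.sq_sqrt (mul_nonneg (sub_pos.2 hk).le (mul_nonneg (G.small_nonneg hl) (mass_nonneg _ _)))

/-- Combines the weighted bounds for `u` and `u_z`; the worse of the two, of squared order `1/λ`,
determines `Box.small`. -/
lemma ae_weighted_grad_le {lam : ℝ} (hl : 0 < lam) (r : HK₀ G k₁ k₂) :
    ∀ᵐ x ∂(G.domK k₁ k₂), ∀ i l c,
      ‖grad r.1 i l x c‖ * Real.exp (-lam * x.1) ≤ wSup lam r x.2 := by
  have hh := G.h_pos
  filter_upwards [ae_weighted_zD_zero hl r, ae_weighted_zD_one hl r] with x h0 h1 i l c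
  have hω := Real.exp_pos (-lam * x.1)
  set S := √(energy lam r x.2 / (2 * lam)) with hS
  have hS0 : 0 ≤ S := Real.sqrt_nonneg _
  have e : wSup lam r x.2 = (1 + 1 / G.h) * ((1 + 1 / lam) * S) := by
    have h2 : G.small lam * energy lam r x.2 = ((1 + 1 / G.h) * ((1 + 1 / lam) * S)) ^ 2 := by
      rw [mul_pow, mul_pow, sq_sqrt_energy hl, Box.small]
      ring
    rw [wSup, h2, Real.sqrt_sq (by positivity)]
  have h3 := norm_grad_le (f := r.1) (x := x) (i := i) (l := l)
    (A := (1 + 1 / lam) * S / Real.exp (-lam * x.1)) ?_ ?_ c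
  · rw [e]
    rwa [← mul_div_assoc, le_div_iff₀ hω] at h3
  · intro j s
    rw [le_div_iff₀ hω]
    refine (h0 j s).trans (le_of_le_of_eq (le_add_of_nonneg_left hS0) ?_)
    ring
  · rw [le_div_iff₀ hω]
    refine (h1 _ _).trans (le_mul_of_one_le_left hS0 ?_)
    have : 0 ≤ 1 / lam := by positivity
    linarith

lemma ae_weighted_gradInt_le {lam : ℝ} (hl : 0 < lam) (hk : k₁ < k₂) (r : HK₀ G k₁ k₂) :
    ∀ᵐ x ∂(G.domK k₁ k₂), ∀ i l c,
      ‖gradInt r.1 i l x c‖ * Real.exp (-lam * x.1) ≤ wSupInt lam r := by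
  simp only [ae_all_iff]
  intro i l c
  have hm := (measurable_energy lam r).const_mul (G.small lam)
  have h0 : ∀ k, 0 ≤ G.small lam * energy lam r k := fun k =>
    mul_nonneg (G.small_nonneg hl) (energy_nonneg _ _ _)
  have hi : IntegrableOn (fun k => G.small lam * energy lam r k) (Ioo k₁ k₂) :=
    (integrable_energy lam r).const_mul _
  have h1 : ∀ᵐ x ∂(G.domK k₁ k₂),
      ‖grad r.1 i l x c‖ * (fun z => Real.exp (-lam * z)) x.1 ≤ wSup lam r x.2 := by
    filter_upwards [ae_weighted_grad_le hl r] with x hx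
    exact hx i l c
  filter_upwards [ae_norm_volterra_le (fun _ => Real.exp_pos _) (wSup_nonneg lam r)
    ((integrableOn_sqrt hm h0 hi).integrable (by norm_num)) h1] with x hx
  refine hx.trans ((setIntegral_sqrt_le hk hm h0 hi).trans (le_of_eq ?_))
  rw [integral_const_mul, integral_energy]
  rfl

end Volterra

/-! ### Algebra of the lower order terms -/

section Nonlinear

lemma norm_dotProduct_le {u v : Fin 3 → ℂ} {A B : ℝ} (hu : ∀ c, ‖u c‖ ≤ A) (hv : ∀ c, ‖v c‖ ≤ B) :
    ‖u ⬝ᵥ v‖ ≤ 3 * (A * B) := by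
  have hA : 0 ≤ A := (norm_nonneg _).trans (hu 0)
  have h : ∀ c, ‖u c * v c‖ ≤ A * B := fun c => by
    rw [norm_mul]
    exact mul_le_mul (hu c) (hv c) (norm_nonneg _) hA
  have e : u ⬝ᵥ v = u 0 * v 0 + u 1 * v 1 + u 2 * v 2 := by
    simp [dotProduct, Fin.sum_univ_three]
  rw [e]
  refine (norm_add₃_le).trans ?_
  linarith [h 0, h 1, h 2]

/-- The algebraic form of the lower order terms of the operator `L^h`. -/
def lowerForm (k t : ℝ) (gV gq S : Fin 3 → ℂ) : ℂ :=
  2 * (k : ℂ) * ((gV - S) ⬝ᵥ ((k : ℂ) • gq + (t : ℂ) • gV - S))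
    + 2 * Complex.I * ((k : ℂ) * gq 2 + gV 2 - S 2)

/-- The algebraic form of the increment of the lower order terms of `L^h`. -/
def pertForm (k t : ℝ) (gV S₁ g₂ S₂ gr Sr : Fin 3 → ℂ) : ℂ :=
  2 * (k : ℂ) * ((gV - S₁) ⬝ᵥ ((k : ℂ) • gr - Sr)
    - Sr ⬝ᵥ ((k : ℂ) • g₂ + (t : ℂ) • gV - S₂)) + 2 * Complex.I * ((k : ℂ) * gr 2 - Sr 2)

/-- The product rule for differences: the first factor is taken at the new argument and the second
at the old one, so the increment is exact without a separate quadratic term. -/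
lemma lowerForm_add (k t : ℝ) (gV gq S gr Sr : Fin 3 → ℂ) :
    lowerForm k t gV (gq + gr) (S + Sr)
      = lowerForm k t gV gq S + pertForm k t gV (S + Sr) gq S gr Sr := by
  simp only [lowerForm, pertForm, dotProduct, Fin.sum_univ_three, Pi.add_apply, Pi.sub_apply,
    Pi.smul_apply, smul_eq_mul]
  ring

/-- Isolates the part quadratic in the increment. It has no product `gr ⬝ᵥ gr`, because the first
factor of the nonlinearity involves `q` only through its integral; such a product would not be
controlled in `k`. -/
lemma pertForm_sub (k t : ℝ) (gV S g₂ S₂ gr Sr : Fin 3 → ℂ) :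
    pertForm k t gV (S + Sr) g₂ S₂ gr Sr - pertForm k t gV S g₂ S₂ gr Sr
      = -(2 * (k : ℂ) * (Sr ⬝ᵥ ((k : ℂ) • gr - Sr))) := by
  simp only [pertForm, dotProduct, Fin.sum_univ_three, Pi.add_apply, Pi.sub_apply,
    Pi.smul_apply, smul_eq_mul]
  ring

lemma pertForm_add (k t : ℝ) (gV S₁ g₂ S₂ gr Sr gr' Sr' : Fin 3 → ℂ) :
    pertForm k t gV S₁ g₂ S₂ (gr + gr') (Sr + Sr')
      = pertForm k t gV S₁ g₂ S₂ gr Sr + pertForm k t gV S₁ g₂ S₂ gr' Sr' := by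
  simp only [pertForm, dotProduct, Fin.sum_univ_three, Pi.add_apply, Pi.sub_apply,
    Pi.smul_apply, smul_eq_mul]
  ring

lemma pertForm_smul (k t : ℝ) (gV S₁ g₂ S₂ gr Sr : Fin 3 → ℂ) (a : ℂ) :
    pertForm k t gV S₁ g₂ S₂ (a • gr) (a • Sr) = a * pertForm k t gV S₁ g₂ S₂ gr Sr := by
  simp only [pertForm, dotProduct, Fin.sum_univ_three, Pi.sub_apply,
    Pi.add_apply, Pi.smul_apply, smul_eq_mul]
  ring

variable {k t b X : ℝ} {gV S₁ g₂ S₂ gr Sr : Fin 3 → ℂ}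

lemma norm_two_mul_le (hk0 : 0 ≤ k) (hkb : k ≤ b) {u : ℂ} {A : ℝ} (hu : ‖u‖ ≤ A) :
    ‖2 * (k : ℂ) * u‖ ≤ 2 * b * A := by
  have hA : 0 ≤ A := (norm_nonneg _).trans hu
  have hb : 0 ≤ b := hk0.trans hkb
  rw [norm_mul, norm_mul, Complex.norm_real, Real.norm_of_nonneg hk0]
  norm_num
  gcongr

lemma norm_smul_sub_le (hk0 : 0 ≤ k) (hkb : k ≤ b) {e s : ℝ} {c : Fin 3} (hg : ‖gr c‖ ≤ e)
    (hS : ‖Sr c‖ ≤ s) : ‖((k : ℂ) • gr - Sr) c‖ ≤ b * e + s := by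
  have he : 0 ≤ e := (norm_nonneg _).trans hg
  have hb : 0 ≤ b := hk0.trans hkb
  simp only [Pi.sub_apply, Pi.smul_apply, smul_eq_mul]
  refine (norm_sub_le _ _).trans (add_le_add ?_ hS)
  rw [norm_mul, Complex.norm_real, Real.norm_of_nonneg hk0]
  gcongr

lemma norm_smul_add_sub_le (hk0 : 0 ≤ k) (hkb : k ≤ b) (hb : 1 ≤ b) (ht : |t| ≤ b) {a : ℝ}
    {c : Fin 3} (hV : ‖gV c‖ ≤ X) (hg : ‖g₂ c‖ ≤ a) (hS : ‖S₂ c‖ ≤ X) :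
    ‖((k : ℂ) • g₂ + (t : ℂ) • gV - S₂) c‖ ≤ b * a + 2 * b * X := by
  have ha : 0 ≤ a := (norm_nonneg _).trans hg
  have hX : 0 ≤ X := (norm_nonneg _).trans hV
  simp only [Pi.sub_apply, Pi.add_apply, Pi.smul_apply, smul_eq_mul]
  have h1 : ‖(k : ℂ) * g₂ c‖ ≤ b * a := by
    rw [norm_mul, Complex.norm_real, Real.norm_of_nonneg hk0]
    gcongr
  have h2 : ‖(t : ℂ) * gV c‖ ≤ b * X := by
    rw [norm_mul, Complex.norm_real, Real.norm_eq_abs]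
    gcongr
  have h3 : ‖S₂ c‖ ≤ b * X := hS.trans (le_mul_of_one_le_left hX hb)
  refine (norm_sub_le _ _).trans ?_
  have := norm_add_le ((k : ℂ) * g₂ c) ((t : ℂ) * gV c)
  linarith

lemma norm_sub_apply_le {c : Fin 3} (hV : ‖gV c‖ ≤ X) (hS : ‖S₁ c‖ ≤ X) :
    ‖(gV - S₁) c‖ ≤ 2 * X := by
  rw [Pi.sub_apply]
  exact (norm_sub_le _ _).trans (by linarith)

lemma norm_two_I_mul (u : ℂ) : ‖2 * Complex.I * u‖ = 2 * ‖u‖ := by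
  rw [norm_mul, norm_mul, Complex.norm_I]
  norm_num

/-- The bound `a` for `∇^h q` is kept apart from the uniform bound `X`, as it is only square
integrable in `k`. It occurs only multiplied by `s`, which will be independent of `k`. -/
lemma norm_pertForm_le (hk0 : 0 ≤ k) (hkb : k ≤ b) (hb : 1 ≤ b) (ht : |t| ≤ b) {a e s : ℝ}
    (hV : ∀ c, ‖gV c‖ ≤ X) (hS₁ : ∀ c, ‖S₁ c‖ ≤ X) (hg₂ : ∀ c, ‖g₂ c‖ ≤ a)
    (hS₂ : ∀ c, ‖S₂ c‖ ≤ X) (hgr : ∀ c, ‖gr c‖ ≤ e) (hSr : ∀ c, ‖Sr c‖ ≤ s) :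
    ‖pertForm k t gV S₁ g₂ S₂ gr Sr‖ ≤ 24 * b ^ 2 * (1 + X) * (e + s + s * a) := by
  have hX : 0 ≤ X := (norm_nonneg _).trans (hV 0)
  have ha : 0 ≤ a := (norm_nonneg _).trans (hg₂ 0)
  have he : 0 ≤ e := (norm_nonneg _).trans (hgr 0)
  have hs : 0 ≤ s := (norm_nonneg _).trans (hSr 0)
  have h1 := norm_dotProduct_le (fun c => norm_sub_apply_le (hV c) (hS₁ c))
    (fun c => norm_smul_sub_le hk0 hkb (hgr c) (hSr c))
  have h2 := norm_dotProduct_le hSr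
    (fun c => norm_smul_add_sub_le hk0 hkb hb ht (hV c) (hg₂ c) (hS₂ c))
  have h3 := norm_two_mul_le hk0 hkb ((norm_sub_le _ _).trans (add_le_add h1 h2))
  have h4 : ‖2 * Complex.I * ((k : ℂ) * gr 2 - Sr 2)‖ ≤ 2 * (b * e + s) := by
    rw [norm_two_I_mul]
    gcongr
    exact norm_smul_sub_le hk0 hkb (hgr 2) (hSr 2)
  refine (norm_add_le _ _).trans ((add_le_add h3 h4).trans ?_)
  have hb2 : b ≤ b ^ 2 := by nlinarith
  have hb1 : 1 ≤ b ^ 2 := by nlinarith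
  have p1 : b * (X * s) ≤ b ^ 2 * (X * s) := mul_le_mul_of_nonneg_right hb2 (by positivity)
  have p2 : b * e ≤ b ^ 2 * e := mul_le_mul_of_nonneg_right hb2 he
  have p3 : 1 * s ≤ b ^ 2 * s := mul_le_mul_of_nonneg_right hb1 hs
  have p4 : 0 ≤ b ^ 2 * e := by positivity
  have p5 : 0 ≤ b ^ 2 * s := by positivity
  have p6 : 0 ≤ b ^ 2 * (s * a) := by positivity
  have p7 : 0 ≤ b ^ 2 * (X * e) := by positivity
  have p8 : 0 ≤ b ^ 2 * (X * (s * a)) := by positivity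
  nlinarith

lemma norm_quadForm_le (hk0 : 0 ≤ k) (hkb : k ≤ b) (hb : 1 ≤ b) {e s : ℝ}
    (hgr : ∀ c, ‖gr c‖ ≤ e) (hSr : ∀ c, ‖Sr c‖ ≤ s) :
    ‖-(2 * (k : ℂ) * (Sr ⬝ᵥ ((k : ℂ) • gr - Sr)))‖ ≤ 6 * b ^ 2 * (s * e + s ^ 2) := by
  have hs : 0 ≤ s := (norm_nonneg _).trans (hSr 0)
  have h1 := norm_dotProduct_le hSr (fun c => norm_smul_sub_le hk0 hkb (hgr c) (hSr c))
  rw [norm_neg]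
  refine (norm_two_mul_le hk0 hkb h1).trans ?_
  have hb2 : b ≤ b ^ 2 := by nlinarith
  nlinarith [mul_le_mul_of_nonneg_right hb2 (sq_nonneg s)]

lemma norm_lowerForm_le (hk0 : 0 ≤ k) (hkb : k ≤ b) (hb : 1 ≤ b) (ht : |t| ≤ b) {a : ℝ}
    (hV : ∀ c, ‖gV c‖ ≤ X) (hg₂ : ∀ c, ‖g₂ c‖ ≤ a) (hS₂ : ∀ c, ‖S₂ c‖ ≤ X) :
    ‖lowerForm k t gV g₂ S₂‖ ≤ 24 * b ^ 2 * (1 + X) * (a + X) := by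
  have hX : 0 ≤ X := (norm_nonneg _).trans (hV 0)
  have ha : 0 ≤ a := (norm_nonneg _).trans (hg₂ 0)
  have h1 := norm_dotProduct_le (fun c => norm_sub_apply_le (hV c) (hS₂ c))
    (fun c => norm_smul_add_sub_le hk0 hkb hb ht (hV c) (hg₂ c) (hS₂ c))
  have h3 := norm_two_mul_le hk0 hkb h1
  have h4 : ‖2 * Complex.I * ((k : ℂ) * g₂ 2 + gV 2 - S₂ 2)‖ ≤ 2 * (b * a + 2 * b * X) := by
    rw [norm_two_I_mul]
    gcongr
    -- The term with `2i` is the last component of the second factor of the dot product with `θ`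
    -- replaced by `1`.
    have := norm_smul_add_sub_le (t := 1) hk0 hkb hb (by simpa using hb) (hV 2) (hg₂ 2) (hS₂ 2)
    simpa using this
  refine (norm_add_le _ _).trans ((add_le_add h3 h4).trans ?_)
  have hb2 : b ≤ b ^ 2 := by nlinarith
  have p1 : b * X ≤ b ^ 2 * X := mul_le_mul_of_nonneg_right hb2 hX
  have p2 : b * a ≤ b ^ 2 * a := mul_le_mul_of_nonneg_right hb2 ha
  have p3 : 0 ≤ b ^ 2 * a := by positivity
  have p4 : 0 ≤ b ^ 2 * (X * a) := by positivity
  have p5 : 0 ≤ b ^ 2 * X := by positivity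
  nlinarith

end Nonlinear

/-! ### Increments of the operator `L^h` -/

section Operator

variable {G : Box} {k₁ k₂ : ℝ}

/-- The increment of the lower order terms of `L^h` in the direction `r`. -/
def pert (θ : ℝ → ℝ) (V : HΩ G 2) (q₁ q₂ r : HK G k₁ k₂ 2) (i l : Fin G.n) (x : ℝ × ℝ) : ℂ :=
  pertForm x.2 (θ x.2) (grad V i l (x.1, ())) (gradInt q₁ i l x) (grad q₂ i l x)
    (gradInt q₂ i l x) (grad r i l x) (gradInt r i l x)

lemma Lop_eq (θ : ℝ → ℝ) (V : HΩ G 2) (q : HK G k₁ k₂ 2) (i l : Fin G.n) (x : ℝ × ℝ) :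
    Lop G k₁ k₂ θ V q i l x = lap q i l x
      + lowerForm x.2 (θ x.2) (grad V i l (x.1, ())) (grad q i l x) (gradInt q i l x) := by
  rw [lowerForm, ← add_assoc]
  rfl

lemma ae_Lop_add (θ : ℝ → ℝ) (V : HΩ G 2) (q r : HK G k₁ k₂ 2) :
    ∀ᵐ x ∂(G.domK k₁ k₂), ∀ i l, Lop G k₁ k₂ θ V (q + r) i l x
      = Lop G k₁ k₂ θ V q i l x + (lap r i l x + pert θ V (q + r) q r i l x) := by
  filter_upwards [ae_zD_add q r, ae_gradInt_add q r] with x h1 h2 i l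
  rw [Lop_eq, Lop_eq, lap_eq_add h1, grad_eq_add h1, h2, lowerForm_add, pert, h2]
  ring

lemma ae_pert_sub (θ : ℝ → ℝ) (V : HΩ G 2) (q r : HK G k₁ k₂ 2) :
    ∀ᵐ x ∂(G.domK k₁ k₂), ∀ i l, pert θ V (q + r) q r i l x - pert θ V q q r i l x
      = -(2 * (x.2 : ℂ) * (gradInt r i l x ⬝ᵥ ((x.2 : ℂ) • grad r i l x - gradInt r i l x))) := by
  filter_upwards [ae_gradInt_add q r] with x h2 i l
  rw [pert, pert, h2, pertForm_sub]

lemma ae_pert_add (θ : ℝ → ℝ) (V : HΩ G 2) (q₁ q₂ r r' : HK G k₁ k₂ 2) :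
    ∀ᵐ x ∂(G.domK k₁ k₂), ∀ i l, pert θ V q₁ q₂ (r + r') i l x
      = pert θ V q₁ q₂ r i l x + pert θ V q₁ q₂ r' i l x := by
  filter_upwards [ae_zD_add r r', ae_gradInt_add r r'] with x h1 h2 i l
  rw [pert, h2, grad_eq_add h1, pertForm_add]
  rfl

lemma ae_pert_smul (θ : ℝ → ℝ) (V : HΩ G 2) (q₁ q₂ r : HK G k₁ k₂ 2) (a : ℝ) :
    ∀ᵐ x ∂(G.domK k₁ k₂), ∀ i l, pert θ V q₁ q₂ (a • r) i l x
      = (a : ℂ) * pert θ V q₁ q₂ r i l x := by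
  filter_upwards [ae_zD_smul a r, ae_gradInt_smul a r] with x h1 h2 i l
  rw [pert, h2, grad_eq_smul h1, pertForm_smul]
  rfl

lemma measurable_grad_tail (V : HΩ G 2) (i l : Fin G.n) (c : Fin 3) :
    Measurable fun x : ℝ × ℝ => grad V i l (x.1, ()) c :=
  (measurable_grad V i l c).comp (by fun_prop)

lemma measurable_pert {θ : ℝ → ℝ} (hθ : Measurable θ) (V : HΩ G 2) (q₁ q₂ r : HK G k₁ k₂ 2)
    (i l : Fin G.n) : Measurable (pert θ V q₁ q₂ r i l) := by
  have h1 := measurable_grad_tail V i l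
  have h2 := measurable_gradInt q₁ i l
  have h3 := measurable_gradInt q₂ i l
  have h4 := measurable_gradInt r i l
  have h5 := measurable_grad q₂ i l
  have h6 := measurable_grad r i l
  unfold pert pertForm
  simp only [dotProduct, Fin.sum_univ_three, Pi.add_apply, Pi.sub_apply,
    Pi.smul_apply, smul_eq_mul]
  fun_prop

lemma measurable_Lop {θ : ℝ → ℝ} (hθ : Measurable θ) (V : HΩ G 2) (q : HK G k₁ k₂ 2)
    (i l : Fin G.n) : Measurable (Lop G k₁ k₂ θ V q i l) := by
  have h1 := measurable_grad_tail V i l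
  have h3 := measurable_gradInt q i l
  have h5 := measurable_grad q i l
  have h6 := measurable_lap q i l
  have e : Lop G k₁ k₂ θ V q i l = _ := funext (Lop_eq θ V q i l)
  rw [e]
  unfold lowerForm
  simp only [dotProduct, Fin.sum_univ_three, Pi.add_apply, Pi.sub_apply,
    Pi.smul_apply, smul_eq_mul]
  fun_prop

end Operator

/-! ### Integral bounds for the operator and its increments -/

section Bounds

variable {G : Box} {k₁ k₂ : ℝ}

lemma integral_add_three {α : Type*} [MeasurableSpace α] {μ : Measure α} {f g h : α → ℝ}
    (hf : Integrable f μ) (hg : Integrable g μ) (hh : Integrable h μ) :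
    ∫ x, f x + g x + h x ∂μ = ∫ x, f x ∂μ + ∫ x, g x ∂μ + ∫ x, h x ∂μ := by
  rw [← integral_add hf hg]
  exact integral_add (hf.add hg) hh

lemma integrable_of_ae_le {α : Type*} [MeasurableSpace α] {μ : Measure α} {f g : α → ℝ}
    (hm : Measurable f) (h0 : ∀ x, 0 ≤ f x) (h : ∀ᵐ x ∂μ, f x ≤ g x) (hg : Integrable g μ) :
    Integrable f μ := by
  refine hg.mono' hm.aestronglyMeasurable ?_
  filter_upwards [h] with x hx
  rwa [Real.norm_of_nonneg (h0 x)]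

/-- The standing assumptions on the coefficients of `L^h`: `Y` bounds the tail function. -/
structure Coeff (G : Box) (k₁ k₂ : ℝ) (θ : ℝ → ℝ) (V : HΩ G 2) (Y : ℝ) : Prop where
  pos : 0 < k₁
  lt : k₁ < k₂
  meas : Measurable θ
  bound : ∀ k ∈ Ioo k₁ k₂, |θ k| ≤ 1 + k₂
  norm_le : ‖V‖ ≤ Y

/-- The bound for `∇^h V` and `∫ ∇^h q dκ`. -/
def Box.gradBound (G : Box) (k₁ k₂ Y : ℝ) : ℝ := (1 + √(k₂ - k₁)) * (G.supConst * Y / G.h)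

/-- The bound for the coefficients of the lower order terms. -/
def Box.coeffBound (G : Box) (k₁ k₂ Y : ℝ) : ℝ :=
  24 * (1 + k₂) ^ 2 * (1 + G.gradBound k₁ k₂ Y)

/-- The bound for the square of the `L²` norm of `L^h(q)`. -/
def Box.opBound (G : Box) (k₁ k₂ Y : ℝ) : ℝ :=
  3 * ((1 + 8 / G.h ^ 2) ^ 2 * (Y ^ 2 / G.h ^ 2))
    + 3 * G.coeffBound k₁ k₂ Y ^ 2 * (G.len * (G.supConst * Y / G.h) ^ 2)
    + 3 * G.coeffBound k₁ k₂ Y ^ 2 * G.gradBound k₁ k₂ Y ^ 2 * (G.len * (k₂ - k₁))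

/-- The bound for the increments of the lower order terms. -/
def Box.pertBound (G : Box) (k₁ k₂ Y : ℝ) : ℝ :=
  3 * G.coeffBound k₁ k₂ Y ^ 2 * G.len
    * (1 + (k₂ - k₁) ^ 2 + (k₂ - k₁) * (G.supConst * Y / G.h) ^ 2)

/-- The bound for the quadratic terms of the increments. -/
def Box.quadBound (G : Box) (k₁ k₂ Y : ℝ) : ℝ :=
  6 * (1 + k₂) ^ 2 * (2 * (k₂ - k₁) * G.opBound k₁ k₂ Y + G.len + (k₂ - k₁) ^ 2 * G.len)

variable {θ : ℝ → ℝ} {V : HΩ G 2} {Y : ℝ}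

lemma Coeff.nonneg (H : Coeff G k₁ k₂ θ V Y) : 0 ≤ Y := (norm_nonneg _).trans H.norm_le

lemma Coeff.gradBound_nonneg (H : Coeff G k₁ k₂ θ V Y) : 0 ≤ G.gradBound k₁ k₂ Y := by
  have h1 := G.h_pos
  have h2 := H.nonneg
  have h3 := G.supConst_nonneg
  unfold Box.gradBound
  positivity

lemma Coeff.coeffBound_nonneg (H : Coeff G k₁ k₂ θ V Y) : 0 ≤ G.coeffBound k₁ k₂ Y := by
  have h1 := H.gradBound_nonneg
  unfold Box.coeffBound
  positivity

lemma Coeff.opBound_nonneg (H : Coeff G k₁ k₂ θ V Y) : 0 ≤ G.opBound k₁ k₂ Y := by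
  have h1 := H.coeffBound_nonneg
  have h2 := G.len_pos
  have h3 := sub_pos.2 H.lt
  unfold Box.opBound
  positivity

lemma Coeff.pertBound_nonneg (H : Coeff G k₁ k₂ θ V Y) : 0 ≤ G.pertBound k₁ k₂ Y := by
  have h2 := G.len_pos
  have h3 := sub_pos.2 H.lt
  unfold Box.pertBound
  positivity

lemma Coeff.quadBound_nonneg (H : Coeff G k₁ k₂ θ V Y) : 0 ≤ G.quadBound k₁ k₂ Y := by
  have h1 := H.opBound_nonneg
  have h2 := G.len_pos
  have h3 := sub_pos.2 H.lt
  unfold Box.quadBound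
  positivity

lemma Coeff.ae_tail_le (H : Coeff G k₁ k₂ θ V Y) :
    ∀ᵐ x ∂(G.domK k₁ k₂), ∀ i l c, ‖grad V i l (x.1, ()) c‖ ≤ G.gradBound k₁ k₂ Y := by
  have h1 := G.h_pos
  have h2 := H.nonneg
  have h3 := G.supConst_nonneg
  filter_upwards [ae_norm_grad_tail_le (k₁ := k₁) (k₂ := k₂) V] with x hx i l c
  refine (hx i l c).trans ?_
  have h4 : G.supConst * ‖V‖ / G.h ≤ G.supConst * Y / G.h := by
    have := H.norm_le
    gcongr
  refine h4.trans (le_mul_of_one_le_left (by positivity) ?_)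
  linarith [Real.sqrt_nonneg (k₂ - k₁)]

lemma Coeff.ae_gradInt_le (H : Coeff G k₁ k₂ θ V Y) {q : HK G k₁ k₂ 2} (hq : ‖q‖ ≤ Y) :
    ∀ᵐ x ∂(G.domK k₁ k₂), ∀ i l c, ‖gradInt q i l x c‖ ≤ G.gradBound k₁ k₂ Y := by
  have h1 := G.h_pos
  have h2 := H.nonneg
  have h3 := G.supConst_nonneg
  filter_upwards [ae_norm_gradInt_le H.lt q] with x hx i l c
  refine (hx i l c).trans ?_
  unfold Box.gradBound
  gcongr
  linarith

lemma Coeff.param (H : Coeff G k₁ k₂ θ V Y) {k : ℝ} (hk : k ∈ Ioo k₁ k₂) :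
    0 ≤ k ∧ k ≤ 1 + k₂ ∧ 1 ≤ 1 + k₂ ∧ |θ k| ≤ 1 + k₂ := by
  have := H.pos
  exact ⟨by linarith [hk.1], by linarith [hk.2], by linarith [hk.1, hk.2], H.bound k hk⟩

lemma integrable_param_gradSup (q : HK G k₁ k₂ 2) :
    Integrable (fun x => gradSup q x.2 ^ 2) (G.domK k₁ k₂) := by
  simp only [sq_gradSup]
  exact Box.integrable_param (integrable_gradSup_sq q)

lemma integral_param_gradSup_le {q : HK G k₁ k₂ 2} (hq : ‖q‖ ≤ Y) :
    ∫ x, gradSup q x.2 ^ 2 ∂(G.domK k₁ k₂) ≤ G.len * (G.supConst * Y / G.h) ^ 2 := by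
  have h1 := G.h_pos
  have h2 := G.len_pos
  have h3 := G.supConst_nonneg
  simp only [sq_gradSup]
  rw [Box.integral_param (fun k => G.supConst ^ 2 * totalSlice q k), integral_gradSup_sq]
  gcongr

lemma integrable_domK_const (c : ℝ) : Integrable (fun _ : ℝ × ℝ => c) (G.domK k₁ k₂) :=
  Box.integrable_param (integrable_const c)

lemma integral_domK_const (hk : k₁ < k₂) (c : ℝ) :
    ∫ _x, c ∂(G.domK k₁ k₂) = c * (G.len * (k₂ - k₁)) := by
  rw [Box.integral_param (fun _ => c), integral_const, measureReal_restrict_apply_univ,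
    Real.volume_real_Ioo_of_le hk.le, smul_eq_mul]
  ring

lemma Coeff.ae_sq_Lop_le (H : Coeff G k₁ k₂ θ V Y) {q : HK G k₁ k₂ 2} (hq : ‖q‖ ≤ Y)
    (i l : Fin G.n) :
    ∀ᵐ x ∂(G.domK k₁ k₂), ‖Lop G k₁ k₂ θ V q i l x‖ ^ 2
      ≤ 3 * ‖lap q i l x‖ ^ 2 + 3 * G.coeffBound k₁ k₂ Y ^ 2 * gradSup q x.2 ^ 2
        + 3 * G.coeffBound k₁ k₂ Y ^ 2 * G.gradBound k₁ k₂ Y ^ 2 := by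
  filter_upwards [H.ae_tail_le, H.ae_gradInt_le hq, ae_norm_grad_le_gradSup q,
    Box.ae_mem_param (G := G) (k₁ := k₁) (k₂ := k₂)] with x hV hS hg hm
  obtain ⟨hk0, hkb, hb, ht⟩ := H.param hm
  have h1 := norm_lowerForm_le hk0 hkb hb ht (hV i l) (hg i l) (hS i l)
  change _ ≤ G.coeffBound k₁ k₂ Y * _ at h1
  have h2 : ‖Lop G k₁ k₂ θ V q i l x‖ ≤ ‖lap q i l x‖ + (G.coeffBound k₁ k₂ Y * gradSup q x.2
      + G.coeffBound k₁ k₂ Y * G.gradBound k₁ k₂ Y) := by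
    rw [Lop_eq, ← mul_add]
    exact (norm_add_le _ _).trans (add_le_add_right h1 _)
  have h3 := pow_le_pow_left₀ (norm_nonneg _) h2 2
  set a := ‖lap q i l x‖
  set b := G.coeffBound k₁ k₂ Y * gradSup q x.2 with hb
  set c := G.coeffBound k₁ k₂ Y * G.gradBound k₁ k₂ Y with hc
  have e : 3 * a ^ 2 + 3 * G.coeffBound k₁ k₂ Y ^ 2 * gradSup q x.2 ^ 2
        + 3 * G.coeffBound k₁ k₂ Y ^ 2 * G.gradBound k₁ k₂ Y ^ 2
      = 3 * a ^ 2 + 3 * b ^ 2 + 3 * c ^ 2 := by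
    rw [hb, hc]
    ring
  rw [e]
  nlinarith [sq_nonneg (a - b), sq_nonneg (a - c), sq_nonneg (b - c)]

lemma integrable_sq_Lop_bound (q : HK G k₁ k₂ 2) (i l : Fin G.n) (a b : ℝ) :
    Integrable (fun x => 3 * ‖lap q i l x‖ ^ 2 + a * gradSup q x.2 ^ 2 + b) (G.domK k₁ k₂) :=
  (((integrable_sq_lap q i l).const_mul 3).add ((integrable_param_gradSup q).const_mul _)).add
    (integrable_domK_const _)

lemma Coeff.integrable_sq_Lop (H : Coeff G k₁ k₂ θ V Y) (q : HK G k₁ k₂ 2) (i l : Fin G.n) :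
    Integrable (fun x => ‖Lop G k₁ k₂ θ V q i l x‖ ^ 2) (G.domK k₁ k₂) := by
  -- Integrability is needed for every `q`; enlarging `Y` to include `‖q‖` makes the quantitative
  -- bound available.
  have H' : Coeff G k₁ k₂ θ V (max Y ‖q‖) :=
    ⟨H.pos, H.lt, H.meas, H.bound, H.norm_le.trans (le_max_left _ _)⟩
  exact integrable_of_ae_le ((measurable_Lop H.meas V q i l).norm.pow_const 2)
    (fun _ => sq_nonneg _) (H'.ae_sq_Lop_le (le_max_right _ _) i l)
    (integrable_sq_Lop_bound q i l _ _)

lemma Coeff.integral_sq_Lop_le (H : Coeff G k₁ k₂ θ V Y) {q : HK G k₁ k₂ 2} (hq : ‖q‖ ≤ Y)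
    (i l : Fin G.n) :
    ∫ x, ‖Lop G k₁ k₂ θ V q i l x‖ ^ 2 ∂(G.domK k₁ k₂) ≤ G.opBound k₁ k₂ Y := by
  refine (integral_mono_ae (H.integrable_sq_Lop q i l)
    (integrable_sq_Lop_bound q i l _ _) (H.ae_sq_Lop_le hq i l)).trans ?_
  have i1 := (integrable_sq_lap q i l).const_mul 3
  have i2 := (integrable_param_gradSup q).const_mul (3 * G.coeffBound k₁ k₂ Y ^ 2)
  rw [integral_add_three i1 i2 (integrable_domK_const _), integral_const_mul,
    integral_const_mul, integral_domK_const H.lt]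
  unfold Box.opBound
  have h1 := integral_sq_lap_le q i l
  have h2 := integral_param_gradSup_le hq
  have h3 := G.h_pos
  gcongr
  refine h1.trans ?_
  gcongr

lemma Coeff.ae_sq_pert_le (H : Coeff G k₁ k₂ θ V Y) {lam : ℝ} (hl : 0 < lam)
    {q₁ q₂ : HK G k₁ k₂ 2} (hq₁ : ‖q₁‖ ≤ Y) (hq₂ : ‖q₂‖ ≤ Y) (r : HK₀ G k₁ k₂) (i l : Fin G.n) :
    ∀ᵐ x ∂(G.domK k₁ k₂), ‖pert θ V q₁ q₂ r.1 i l x‖ ^ 2 * Real.exp (-2 * lam * x.1)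
      ≤ 3 * G.coeffBound k₁ k₂ Y ^ 2 * (G.small lam * energy lam r x.2)
        + 3 * G.coeffBound k₁ k₂ Y ^ 2 * wSupInt lam r ^ 2
        + 3 * G.coeffBound k₁ k₂ Y ^ 2 * wSupInt lam r ^ 2 * gradSup q₂ x.2 ^ 2 := by
  filter_upwards [H.ae_tail_le, H.ae_gradInt_le hq₁, H.ae_gradInt_le hq₂,
    ae_norm_grad_le_gradSup q₂, ae_weighted_grad_le hl r, ae_weighted_gradInt_le hl H.lt r,
    Box.ae_mem_param (G := G) (k₁ := k₁) (k₂ := k₂)] with x hV hS₁ hS₂ hg hgr hSr hm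
  obtain ⟨hk0, hkb, hb, ht⟩ := H.param hm
  have hω := Real.exp_pos (-lam * x.1)
  rw [← sq_wSup hl, ← exp_sq, ← mul_pow]
  set ω := Real.exp (-lam * x.1)
  set e := wSup lam r x.2
  set s := wSupInt lam r
  set a := gradSup q₂ x.2
  set C := G.coeffBound k₁ k₂ Y
  have h1 : ‖pert θ V q₁ q₂ r.1 i l x‖ ≤ C * (e / ω + s / ω + s / ω * a) :=
    norm_pertForm_le hk0 hkb hb ht (hV i l) (hS₁ i l) (hg i l) (hS₂ i l)
      (fun c => (le_div_iff₀ hω).2 (hgr i l c)) (fun c => (le_div_iff₀ hω).2 (hSr i l c))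
  have h2 : ‖pert θ V q₁ q₂ r.1 i l x‖ * ω ≤ C * e + C * s + C * (s * a) := by
    refine (mul_le_mul_of_nonneg_right h1 hω.le).trans (le_of_eq ?_)
    field_simp
  have h3 := pow_le_pow_left₀ (by positivity) h2 2
  nlinarith [sq_nonneg (C * e - C * s), sq_nonneg (C * e - C * (s * a)),
    sq_nonneg (C * s - C * (s * a))]

lemma integrable_sq_pert_bound {lam : ℝ} (q₂ : HK G k₁ k₂ 2) (r : HK₀ G k₁ k₂) (a b c : ℝ) :
    Integrable (fun x => a * (G.small lam * energy lam r x.2) + b + c * gradSup q₂ x.2 ^ 2)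
      (G.domK k₁ k₂) :=
  ((Box.integrable_param (((integrable_energy lam r).const_mul _).const_mul _)).add
    (integrable_domK_const _)).add ((integrable_param_gradSup q₂).const_mul _)

lemma Coeff.integrable_sq_pert (H : Coeff G k₁ k₂ θ V Y) {lam : ℝ} (hl : 0 < lam)
    (q₁ q₂ : HK G k₁ k₂ 2) (r : HK₀ G k₁ k₂) (i l : Fin G.n) :
    Integrable (fun x => ‖pert θ V q₁ q₂ r.1 i l x‖ ^ 2 * Real.exp (-2 * lam * x.1))
      (G.domK k₁ k₂) := by
  have H' : Coeff G k₁ k₂ θ V (max Y (max ‖q₁‖ ‖q₂‖)) :=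
    ⟨H.pos, H.lt, H.meas, H.bound, H.norm_le.trans (le_max_left _ _)⟩
  have hm := measurable_pert H.meas V q₁ q₂ r.1 i l
  exact integrable_of_ae_le (by fun_prop) (fun _ => by positivity)
    (H'.ae_sq_pert_le hl ((le_max_left _ _).trans (le_max_right _ _))
      ((le_max_right _ _).trans (le_max_right _ _)) r i l)
    (integrable_sq_pert_bound q₂ r _ _ _)

lemma integral_param_energy (lam : ℝ) (r : HK₀ G k₁ k₂) :
    ∫ x, G.small lam * energy lam r x.2 ∂(G.domK k₁ k₂) = G.len * (G.small lam * mass lam r) := by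
  rw [Box.integral_param (fun k => G.small lam * energy lam r k), integral_const_mul,
    integral_energy]

/-- The entire first order increment is small against `mass`: every term carries the factor `small
lam`, and the constant does not depend on `lam`. -/
lemma Coeff.integral_sq_pert_le (H : Coeff G k₁ k₂ θ V Y) {lam : ℝ} (hl : 0 < lam)
    {q₁ q₂ : HK G k₁ k₂ 2} (hq₁ : ‖q₁‖ ≤ Y) (hq₂ : ‖q₂‖ ≤ Y) (r : HK₀ G k₁ k₂) (i l : Fin G.n) :
    ∫ x, ‖pert θ V q₁ q₂ r.1 i l x‖ ^ 2 * Real.exp (-2 * lam * x.1) ∂(G.domK k₁ k₂)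
      ≤ G.pertBound k₁ k₂ Y * (G.small lam * mass lam r) := by
  refine (integral_mono_ae (H.integrable_sq_pert hl q₁ q₂ r i l)
    (integrable_sq_pert_bound q₂ r _ _ _) (H.ae_sq_pert_le hl hq₁ hq₂ r i l)).trans ?_
  have i1 : Integrable (fun x => 3 * G.coeffBound k₁ k₂ Y ^ 2 * (G.small lam * energy lam r x.2))
      (G.domK k₁ k₂) :=
    Box.integrable_param (((integrable_energy lam r).const_mul _).const_mul _)
  have i2 := integrable_domK_const (G := G) (k₁ := k₁) (k₂ := k₂)
    (3 * G.coeffBound k₁ k₂ Y ^ 2 * wSupInt lam r ^ 2)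
  have i3 := (integrable_param_gradSup q₂).const_mul
    (3 * G.coeffBound k₁ k₂ Y ^ 2 * wSupInt lam r ^ 2)
  rw [integral_add_three i1 i2 i3, integral_const_mul, integral_param_energy,
    integral_domK_const H.lt, integral_const_mul]
  have h2 := integral_param_gradSup_le hq₂
  calc _ ≤ 3 * G.coeffBound k₁ k₂ Y ^ 2 * (G.len * (G.small lam * mass lam r))
        + 3 * G.coeffBound k₁ k₂ Y ^ 2 * wSupInt lam r ^ 2 * (G.len * (k₂ - k₁))
        + 3 * G.coeffBound k₁ k₂ Y ^ 2 * wSupInt lam r ^ 2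
          * (G.len * (G.supConst * Y / G.h) ^ 2) := by gcongr
    _ = _ := by
        rw [sq_wSupInt hl H.lt]
        unfold Box.pertBound
        ring

/-- The product of the operator with the quadratic part of its increment. -/
def crossTerm (θ : ℝ → ℝ) (V : HΩ G 2) (lam : ℝ) (q r : HK G k₁ k₂ 2) (i l : Fin G.n)
    (x : ℝ × ℝ) : ℝ :=
  2 * (‖Lop G k₁ k₂ θ V q i l x‖ * ‖pert θ V (q + r) q r i l x - pert θ V q q r i l x‖)
    * Real.exp (-2 * lam * x.1)

/-- The quadratic part has two factors in `r`, and each takes one factor `e^{-λz}` of the weight. So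
`L^h(q)` appears unweighted, and its bounded `L²` norm suffices uniformly in `lam`. -/
lemma Coeff.ae_crossTerm_le (H : Coeff G k₁ k₂ θ V Y) {lam : ℝ} (hl : 0 < lam)
    (q : HK G k₁ k₂ 2) (r : HK₀ G k₁ k₂) (i l : Fin G.n) :
    ∀ᵐ x ∂(G.domK k₁ k₂), crossTerm θ V lam q r.1 i l x
      ≤ 6 * (1 + k₂) ^ 2 * (2 * wSupInt lam r ^ 2) * ‖Lop G k₁ k₂ θ V q i l x‖ ^ 2
        + 6 * (1 + k₂) ^ 2 * (G.small lam * energy lam r x.2)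
        + 6 * (1 + k₂) ^ 2 * wSupInt lam r ^ 2 := by
  filter_upwards [ae_pert_sub θ V q r.1, ae_weighted_grad_le hl r,
    ae_weighted_gradInt_le hl H.lt r,
    Box.ae_mem_param (G := G) (k₁ := k₁) (k₂ := k₂)] with x hp hgr hSr hm
  obtain ⟨hk0, hkb, hb, -⟩ := H.param hm
  have hω := Real.exp_pos (-lam * x.1)
  unfold crossTerm
  rw [hp, ← sq_wSup hl, ← exp_sq]
  have h1 := norm_quadForm_le hk0 hkb hb (fun c => (le_div_iff₀ hω).2 (hgr i l c))
    (fun c => (le_div_iff₀ hω).2 (hSr i l c))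
  set ω := Real.exp (-lam * x.1)
  set e := wSup lam r x.2
  set s := wSupInt lam r
  set L := ‖Lop G k₁ k₂ θ V q i l x‖
  have hL : 0 ≤ L := norm_nonneg _
  set B := ‖-(2 * (x.2 : ℂ) * (gradInt r.1 i l x ⬝ᵥ
    ((x.2 : ℂ) • grad r.1 i l x - gradInt r.1 i l x)))‖
  have h2 : B * ω ^ 2 ≤ 6 * (1 + k₂) ^ 2 * (s * e + s ^ 2) := by
    refine (mul_le_mul_of_nonneg_right h1 (sq_nonneg ω)).trans (le_of_eq ?_)
    field_simp
  calc 2 * (L * B) * ω ^ 2 = 2 * L * (B * ω ^ 2) := by ring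
    _ ≤ 2 * L * (6 * (1 + k₂) ^ 2 * (s * e + s ^ 2)) := by gcongr
    _ = 6 * (1 + k₂) ^ 2 * (2 * (s * L) * e + 2 * L * s ^ 2) := by ring
    -- Young is applied to `(s * L) * e`, since `s` is constant while `L` and `e` are only square
    -- integrable. For the other term `2 * L ≤ 1 + L ^ 2`.
    _ ≤ 6 * (1 + k₂) ^ 2 * ((s * L) ^ 2 + e ^ 2 + (1 + L ^ 2) * s ^ 2) := by
        gcongr
        · nlinarith [sq_nonneg (s * L - e)]
        · nlinarith [sq_nonneg (L - 1)]
    _ = _ := by ring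

lemma crossTerm_nonneg (lam : ℝ) (q r : HK G k₁ k₂ 2) (i l : Fin G.n) (x : ℝ × ℝ) :
    0 ≤ crossTerm θ V lam q r i l x := by
  unfold crossTerm
  positivity

lemma Coeff.integrable_crossTerm_bound (H : Coeff G k₁ k₂ θ V Y) (lam : ℝ)
    (q : HK G k₁ k₂ 2) (r : HK₀ G k₁ k₂) (i l : Fin G.n) (a b c : ℝ) :
    Integrable (fun x => a * ‖Lop G k₁ k₂ θ V q i l x‖ ^ 2
      + b * (G.small lam * energy lam r x.2) + c) (G.domK k₁ k₂) :=
  (((H.integrable_sq_Lop q i l).const_mul _).add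
    (Box.integrable_param (((integrable_energy lam r).const_mul _).const_mul _))).add
    (integrable_domK_const _)

lemma Coeff.integrable_crossTerm (H : Coeff G k₁ k₂ θ V Y) {lam : ℝ} (hl : 0 < lam)
    (q : HK G k₁ k₂ 2) (r : HK₀ G k₁ k₂) (i l : Fin G.n) :
    Integrable (crossTerm θ V lam q r.1 i l) (G.domK k₁ k₂) := by
  have h1 := measurable_pert H.meas V (q + r.1) q r.1 i l
  have h2 := measurable_pert H.meas V q q r.1 i l
  have h3 := measurable_Lop H.meas V q i l
  refine integrable_of_ae_le ?_ (crossTerm_nonneg _ _ _ _ _) (H.ae_crossTerm_le hl q r i l)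
    (H.integrable_crossTerm_bound lam q r i l _ _ _)
  unfold crossTerm
  fun_prop

lemma Coeff.integral_crossTerm_le (H : Coeff G k₁ k₂ θ V Y) {lam : ℝ} (hl : 0 < lam)
    {q : HK G k₁ k₂ 2} (hq : ‖q‖ ≤ Y) (r : HK₀ G k₁ k₂) (i l : Fin G.n) :
    ∫ x, crossTerm θ V lam q r.1 i l x ∂(G.domK k₁ k₂)
      ≤ G.quadBound k₁ k₂ Y * (G.small lam * mass lam r) := by
  refine (integral_mono_ae (H.integrable_crossTerm hl q r i l)
    (H.integrable_crossTerm_bound lam q r i l _ _ _) (H.ae_crossTerm_le hl q r i l)).trans ?_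
  have i1 := (H.integrable_sq_Lop q i l).const_mul (6 * (1 + k₂) ^ 2 * (2 * wSupInt lam r ^ 2))
  have i2 : Integrable (fun x => 6 * (1 + k₂) ^ 2 * (G.small lam * energy lam r x.2))
      (G.domK k₁ k₂) :=
    Box.integrable_param (((integrable_energy lam r).const_mul _).const_mul _)
  rw [integral_add_three i1 i2 (integrable_domK_const _), integral_const_mul,
    integral_const_mul, integral_domK_const H.lt, integral_param_energy]
  have h2 := H.integral_sq_Lop_le hq i l
  calc _ ≤ 6 * (1 + k₂) ^ 2 * (2 * wSupInt lam r ^ 2) * G.opBound k₁ k₂ Y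
        + 6 * (1 + k₂) ^ 2 * (G.len * (G.small lam * mass lam r))
        + 6 * (1 + k₂) ^ 2 * wSupInt lam r ^ 2 * (G.len * (k₂ - k₁)) := by gcongr
    _ = _ := by
        rw [sq_wSupInt hl H.lt]
        unfold Box.quadBound
        ring

end Bounds

/-! ### Fréchet derivative and convexity of the functional -/

section Functional

variable {G : Box} {k₁ k₂ : ℝ} {θ : ℝ → ℝ} {V : HΩ G 2} {Y : ℝ}

/-- The density of the derivative of the weighted functional in the direction `r`. -/
def derivDensity (θ : ℝ → ℝ) (V : HΩ G 2) (lam : ℝ) (q r : HK G k₁ k₂ 2) (i l : Fin G.n)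
    (x : ℝ × ℝ) : ℝ :=
  2 * inner ℝ (Lop G k₁ k₂ θ V q i l x) (lap r i l x + pert θ V q q r i l x)
    * Real.exp (-2 * lam * x.1)

lemma sq_norm_add_le (a b : ℂ) : ‖a + b‖ ^ 2 ≤ 2 * ‖a‖ ^ 2 + 2 * ‖b‖ ^ 2 := by
  have := pow_le_pow_left₀ (norm_nonneg _) (norm_add_le a b) 2
  nlinarith [sq_nonneg (‖a‖ - ‖b‖)]

lemma abs_derivDensity_le (lam : ℝ) (q r : HK G k₁ k₂ 2) (i l : Fin G.n) (x : ℝ × ℝ) :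
    |derivDensity θ V lam q r i l x|
      ≤ ‖Lop G k₁ k₂ θ V q i l x‖ ^ 2 * Real.exp (-2 * lam * x.1)
        + 2 * (‖lap r i l x‖ ^ 2 * Real.exp (-2 * lam * x.1))
        + 2 * (‖pert θ V q q r i l x‖ ^ 2 * Real.exp (-2 * lam * x.1)) := by
  have hω := Real.exp_pos (-2 * lam * x.1)
  have h1 := abs_real_inner_le_norm (Lop G k₁ k₂ θ V q i l x)
    (lap r i l x + pert θ V q q r i l x)
  have h2 := sq_norm_add_le (lap r i l x) (pert θ V q q r i l x)
  have h3 : 2 * |inner ℝ (Lop G k₁ k₂ θ V q i l x) (lap r i l x + pert θ V q q r i l x)|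
      ≤ ‖Lop G k₁ k₂ θ V q i l x‖ ^ 2 + 2 * ‖lap r i l x‖ ^ 2
        + 2 * ‖pert θ V q q r i l x‖ ^ 2 := by
    nlinarith [sq_nonneg (‖Lop G k₁ k₂ θ V q i l x‖ - ‖lap r i l x + pert θ V q q r i l x‖)]
  unfold derivDensity
  rw [abs_mul, abs_mul, abs_two, abs_of_pos hω]
  calc _ ≤ _ := mul_le_mul_of_nonneg_right h3 hω.le
    _ = _ := by ring

lemma Coeff.integrable_derivDensity_bound (H : Coeff G k₁ k₂ θ V Y) {lam : ℝ} (hl : 0 < lam)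
    (q : HK G k₁ k₂ 2) (r : HK₀ G k₁ k₂) (i l : Fin G.n) :
    Integrable (fun x => ‖Lop G k₁ k₂ θ V q i l x‖ ^ 2 * Real.exp (-2 * lam * x.1)
        + 2 * (‖lap r.1 i l x‖ ^ 2 * Real.exp (-2 * lam * x.1))
        + 2 * (‖pert θ V q q r.1 i l x‖ ^ 2 * Real.exp (-2 * lam * x.1))) (G.domK k₁ k₂) :=
  ((Box.integrable_mul_exp lam (H.integrable_sq_Lop q i l)).add
    ((Box.integrable_mul_exp lam (integrable_sq_lap r.1 i l)).const_mul 2)).add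
    ((H.integrable_sq_pert hl q q r i l).const_mul 2)

lemma Coeff.integrable_derivDensity (H : Coeff G k₁ k₂ θ V Y) {lam : ℝ} (hl : 0 < lam)
    (q : HK G k₁ k₂ 2) (r : HK₀ G k₁ k₂) (i l : Fin G.n) :
    Integrable (derivDensity θ V lam q r.1 i l) (G.domK k₁ k₂) := by
  have h1 := measurable_Lop H.meas V q i l
  have h2 := measurable_lap r.1 i l
  have h3 := measurable_pert H.meas V q q r.1 i l
  refine (H.integrable_derivDensity_bound hl q r i l).mono' ?_
    (.of_forall fun x => abs_derivDensity_le lam q r.1 i l x)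
  unfold derivDensity
  exact Measurable.aestronglyMeasurable (by fun_prop)

/-- The bound is not homogeneous in `r`, but for a linear functional boundedness on the unit ball is
enough. -/
lemma Coeff.abs_integral_derivDensity_le (H : Coeff G k₁ k₂ θ V Y) {lam : ℝ} (hl : 0 < lam)
    {q : HK G k₁ k₂ 2} (hq : ‖q‖ ≤ Y) (r : HK₀ G k₁ k₂) (i l : Fin G.n) :
    |∫ x, derivDensity θ V lam q r.1 i l x ∂(G.domK k₁ k₂)|
      ≤ G.wMax lam * G.opBound k₁ k₂ Y
        + 2 * (G.wMax lam * ((1 + 8 / G.h ^ 2) ^ 2 * (‖r‖ ^ 2 / G.h ^ 2)))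
        + 2 * (G.pertBound k₁ k₂ Y * (G.small lam * mass lam r)) := by
  have hw : 0 ≤ G.wMax lam := (Real.exp_pos _).le
  refine (norm_integral_le_of_norm_le (f := derivDensity θ V lam q r.1 i l)
    (H.integrable_derivDensity_bound hl q r i l) (.of_forall fun x => abs_derivDensity_le lam q r.1 i l x)).trans ?_
  rw [integral_add_three (Box.integrable_mul_exp lam (H.integrable_sq_Lop q i l))
    ((Box.integrable_mul_exp lam (integrable_sq_lap r.1 i l)).const_mul 2)
    ((H.integrable_sq_pert hl q q r i l).const_mul 2), integral_const_mul, integral_const_mul]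
  have h1 := (integral_mul_exp_le hl.le (fun _ => sq_nonneg _)
    (H.integrable_sq_Lop q i l)).trans
    (mul_le_mul_of_nonneg_left (H.integral_sq_Lop_le hq i l) hw)
  have h2 := (integral_mul_exp_le hl.le (fun _ => sq_nonneg _)
    (integrable_sq_lap r.1 i l)).trans
    (mul_le_mul_of_nonneg_left (integral_sq_lap_le r.1 i l) hw)
  have h3 := H.integral_sq_pert_le hl hq hq r i l
  rw [Submodule.coe_norm]
  linarith

/-- The second order remainder of the density of the functional. -/
def remDensity (θ : ℝ → ℝ) (V : HΩ G 2) (lam : ℝ) (q r : HK G k₁ k₂ 2) (i l : Fin G.n)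
    (x : ℝ × ℝ) : ℝ :=
  ‖Lop G k₁ k₂ θ V (q + r) i l x‖ ^ 2 * Real.exp (-2 * lam * x.1)
    - ‖Lop G k₁ k₂ θ V q i l x‖ ^ 2 * Real.exp (-2 * lam * x.1) - derivDensity θ V lam q r i l x

lemma ae_remDensity (θ : ℝ → ℝ) (V : HΩ G 2) (lam : ℝ) (q r : HK G k₁ k₂ 2) :
    ∀ᵐ x ∂(G.domK k₁ k₂), ∀ i l,
      1 / 2 * (‖lap r i l x‖ ^ 2 * Real.exp (-2 * lam * x.1))
          - ‖pert θ V (q + r) q r i l x‖ ^ 2 * Real.exp (-2 * lam * x.1)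
          - crossTerm θ V lam q r i l x ≤ remDensity θ V lam q r i l x ∧
      remDensity θ V lam q r i l x ≤ 2 * (‖lap r i l x‖ ^ 2 * Real.exp (-2 * lam * x.1))
          + 2 * (‖pert θ V (q + r) q r i l x‖ ^ 2 * Real.exp (-2 * lam * x.1))
          + crossTerm θ V lam q r i l x := by
  filter_upwards [ae_Lop_add θ V q r] with x hx i l
  have hω := (Real.exp_pos (-2 * lam * x.1)).le
  unfold remDensity derivDensity crossTerm
  rw [hx]
  set ω := Real.exp (-2 * lam * x.1)
  set L := Lop G k₁ k₂ θ V q i l x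
  set D := lap r i l x
  set P := pert θ V (q + r) q r i l x
  set A := pert θ V q q r i l x
  -- The terms linear in `r` cancel: what remains is a square and the pairing of `L` with the
  -- quadratic part `P - A`.
  have e : ‖L + (D + P)‖ ^ 2 - ‖L‖ ^ 2 - 2 * inner ℝ L (D + A)
      = ‖D + P‖ ^ 2 + 2 * inner ℝ L (P - A) := by
    rw [norm_add_sq_real, inner_sub_right, inner_add_right, inner_add_right]
    ring
  have e' : ‖L + (D + P)‖ ^ 2 * ω - ‖L‖ ^ 2 * ω - 2 * inner ℝ L (D + A) * ω
      = (‖D + P‖ ^ 2 + 2 * inner ℝ L (P - A)) * ω := by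
    rw [← e]
    ring
  have h1 := abs_le.1 (abs_real_inner_le_norm L (P - A))
  have h2 := sq_norm_add_le D P
  -- Applied to `D = (D + P) - P`, this gives the lower bound `|D + P|² ≥ ½|D|² - |P|²`.
  have h3 := sq_norm_add_le (D + P) (-P)
  rw [add_neg_cancel_right, norm_neg] at h3
  rw [e']
  constructor
  · have h4 : 1 / 2 * ‖D‖ ^ 2 - ‖P‖ ^ 2 - 2 * (‖L‖ * ‖P - A‖)
        ≤ ‖D + P‖ ^ 2 + 2 * inner ℝ L (P - A) := by linarith [h1.1]
    calc _ = (1 / 2 * ‖D‖ ^ 2 - ‖P‖ ^ 2 - 2 * (‖L‖ * ‖P - A‖)) * ω := by ring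
      _ ≤ _ := mul_le_mul_of_nonneg_right h4 hω
  · have h4 : ‖D + P‖ ^ 2 + 2 * inner ℝ L (P - A)
        ≤ 2 * ‖D‖ ^ 2 + 2 * ‖P‖ ^ 2 + 2 * (‖L‖ * ‖P - A‖) := by linarith [h1.2]
    calc _ ≤ _ := mul_le_mul_of_nonneg_right h4 hω
      _ = _ := by ring

lemma Coeff.integrable_remDensity (H : Coeff G k₁ k₂ θ V Y) {lam : ℝ} (hl : 0 < lam)
    (q : HK G k₁ k₂ 2) (r : HK₀ G k₁ k₂) (i l : Fin G.n) :
    Integrable (remDensity θ V lam q r.1 i l) (G.domK k₁ k₂) :=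
  ((Box.integrable_mul_exp lam (H.integrable_sq_Lop (q + r.1) i l)).sub
    (Box.integrable_mul_exp lam (H.integrable_sq_Lop q i l))).sub
    (H.integrable_derivDensity hl q r i l)

lemma Coeff.integral_remDensity_bounds (H : Coeff G k₁ k₂ θ V Y) {lam : ℝ} (hl : 0 < lam)
    {q : HK G k₁ k₂ 2} (hq : ‖q‖ ≤ Y) (r : HK₀ G k₁ k₂) (hqr : ‖q + r.1‖ ≤ Y) (i l : Fin G.n) :
    1 / 2 * (∫ x, ‖lap r.1 i l x‖ ^ 2 * Real.exp (-2 * lam * x.1) ∂(G.domK k₁ k₂))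
        - (G.pertBound k₁ k₂ Y + G.quadBound k₁ k₂ Y) * (G.small lam * mass lam r)
      ≤ ∫ x, remDensity θ V lam q r.1 i l x ∂(G.domK k₁ k₂) ∧
    ∫ x, remDensity θ V lam q r.1 i l x ∂(G.domK k₁ k₂)
      ≤ 2 * (∫ x, ‖lap r.1 i l x‖ ^ 2 * Real.exp (-2 * lam * x.1) ∂(G.domK k₁ k₂))
        + 2 * (G.pertBound k₁ k₂ Y + G.quadBound k₁ k₂ Y) * (G.small lam * mass lam r) := by
  have hae := ae_remDensity (k₁ := k₁) (k₂ := k₂) θ V lam q r.1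
  have iD := Box.integrable_mul_exp lam (integrable_sq_lap r.1 i l)
  have iP := H.integrable_sq_pert hl (q + r.1) q r i l
  have iC := H.integrable_crossTerm hl q r i l
  have iR := H.integrable_remDensity hl q r i l
  have hP := H.integral_sq_pert_le hl hqr hq r i l
  have hC := H.integral_crossTerm_le hl hq r i l
  have hC0 : 0 ≤ G.quadBound k₁ k₂ Y * (G.small lam * mass lam r) :=
    mul_nonneg H.quadBound_nonneg (mul_nonneg (G.small_nonneg hl) (mass_nonneg _ _))
  constructor
  · have h1 := integral_mono_ae (iD.const_mul (1 / 2)) ((iR.add iP).add iC) (by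
      filter_upwards [hae] with x hx
      simp only [Pi.add_apply]
      linarith [(hx i l).1])
    have e := integral_add_three iR iP iC
    rw [integral_const_mul] at h1
    have h2 := h1.trans (le_of_eq e)
    linarith
  · have h1 := integral_mono_ae iR (((iD.const_mul 2).add (iP.const_mul 2)).add iC) (by
      filter_upwards [hae] with x hx
      exact (hx i l).2)
    have e := integral_add_three (iD.const_mul 2) (iP.const_mul 2) iC
    rw [integral_const_mul, integral_const_mul] at e
    have h2 := h1.trans (le_of_eq e)
    linarith

/-- The integrals of `|L^h(q)|² e^{-2λz}`, summed over the interior nodes. -/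
def resid (θ : ℝ → ℝ) (V : HΩ G 2) (lam : ℝ) (q : HK G k₁ k₂ 2) : ℝ :=
  ∑ i, ∑ l, ∫ x, ‖Lop G k₁ k₂ θ V q i l x‖ ^ 2 * Real.exp (-2 * lam * x.1) ∂(G.domK k₁ k₂)

/-- The derivative of `resid`. -/
def residDeriv (θ : ℝ → ℝ) (V : HΩ G 2) (lam : ℝ) (q r : HK G k₁ k₂ 2) : ℝ :=
  ∑ i, ∑ l, ∫ x, derivDensity θ V lam q r i l x ∂(G.domK k₁ k₂)

/-- The lower bound is used for the convexity, and both bounds for differentiability. -/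
lemma Coeff.resid_bounds (H : Coeff G k₁ k₂ θ V Y) {lam : ℝ} (hl : 0 < lam)
    {q : HK G k₁ k₂ 2} (hq : ‖q‖ ≤ Y) (r : HK₀ G k₁ k₂) (hqr : ‖q + r.1‖ ≤ Y) :
    1 / 2 * lapMass lam r.1
        - G.n ^ 2 * ((G.pertBound k₁ k₂ Y + G.quadBound k₁ k₂ Y) * (G.small lam * mass lam r))
      ≤ resid θ V lam (q + r.1) - resid θ V lam q - residDeriv θ V lam q r.1 ∧
    resid θ V lam (q + r.1) - resid θ V lam q - residDeriv θ V lam q r.1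
      ≤ 2 * lapMass lam r.1
        + G.n ^ 2 * (2 * (G.pertBound k₁ k₂ Y + G.quadBound k₁ k₂ Y)
          * (G.small lam * mass lam r)) := by
  have e : resid θ V lam (q + r.1) - resid θ V lam q - residDeriv θ V lam q r.1
      = ∑ i, ∑ l, ∫ x, remDensity θ V lam q r.1 i l x ∂(G.domK k₁ k₂) := by
    simp only [resid, residDeriv, ← Finset.sum_sub_distrib]
    refine Finset.sum_congr rfl fun i _ => Finset.sum_congr rfl fun l _ => ?_
    have i1 := Box.integrable_mul_exp lam (H.integrable_sq_Lop (q + r.1) i l)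
    have i2 := Box.integrable_mul_exp lam (H.integrable_sq_Lop q i l)
    rw [← integral_sub i1 i2]
    exact (integral_sub (i1.sub i2) (H.integrable_derivDensity hl q r i l)).symm
  have hsum : ∀ c : ℝ, G.n ^ 2 * c = ∑ _i : Fin G.n, ∑ _l : Fin G.n, c := by
    intro c
    simp only [Finset.sum_const, Finset.card_univ, Fintype.card_fin, nsmul_eq_mul]
    ring
  rw [e, hsum, hsum]
  simp only [lapMass, Finset.mul_sum, ← Finset.sum_add_distrib, ← Finset.sum_sub_distrib]
  constructor
  · exact Finset.sum_le_sum fun i _ => Finset.sum_le_sum fun l _ =>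
      (H.integral_remDensity_bounds hl hq r hqr i l).1
  · exact Finset.sum_le_sum fun i _ => Finset.sum_le_sum fun l _ =>
      (H.integral_remDensity_bounds hl hq r hqr i l).2

lemma Coeff.residDeriv_add (H : Coeff G k₁ k₂ θ V Y) {lam : ℝ} (hl : 0 < lam)
    (q : HK G k₁ k₂ 2) (r r' : HK₀ G k₁ k₂) :
    residDeriv θ V lam q (r + r').1 = residDeriv θ V lam q r.1 + residDeriv θ V lam q r'.1 := by
  simp only [residDeriv, ← Finset.sum_add_distrib]
  refine Finset.sum_congr rfl fun i _ => Finset.sum_congr rfl fun l _ => ?_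
  rw [← integral_add (H.integrable_derivDensity hl q r i l)
    (H.integrable_derivDensity hl q r' i l)]
  refine integral_congr_ae ?_
  filter_upwards [ae_pert_add θ V q q r.1 r'.1, ae_zD_add r.1 r'.1] with x h1 h2
  unfold derivDensity
  rw [Submodule.coe_add, h1, lap_eq_add h2]
  simp only [inner_add_right]
  ring

lemma residDeriv_smul (θ : ℝ → ℝ) (V : HΩ G 2) (lam : ℝ) (q : HK G k₁ k₂ 2) (a : ℝ)
    (r : HK₀ G k₁ k₂) :
    residDeriv θ V lam q (a • r).1 = a * residDeriv θ V lam q r.1 := by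
  simp only [residDeriv, Finset.mul_sum]
  refine Finset.sum_congr rfl fun i _ => Finset.sum_congr rfl fun l _ => ?_
  rw [← integral_const_mul]
  refine integral_congr_ae ?_
  filter_upwards [ae_pert_smul θ V q q r.1 a, ae_zD_smul a r.1] with x h1 h2
  unfold derivDensity
  rw [Submodule.coe_smul, h1, lap_eq_smul h2, ← mul_add, ← Complex.real_smul,
    real_inner_smul_right]
  ring

lemma Coeff.exists_residDeriv_bound (H : Coeff G k₁ k₂ θ V Y) {lam : ℝ} (hl : 0 < lam)
    (q : HK G k₁ k₂ 2) :
    ∃ C, ∀ r : HK₀ G k₁ k₂, ‖r‖ ≤ 1 → |residDeriv θ V lam q r.1| ≤ C := by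
  have hh := G.h_pos
  have H' : Coeff G k₁ k₂ θ V (max Y ‖q‖) :=
    ⟨H.pos, H.lt, H.meas, H.bound, H.norm_le.trans (le_max_left _ _)⟩
  have hP := H'.pertBound_nonneg
  have hw : 0 ≤ G.wMax lam := (Real.exp_pos _).le
  have hs := G.small_nonneg hl
  refine ⟨∑ _i : Fin G.n, ∑ _l : Fin G.n, (G.wMax lam * G.opBound k₁ k₂ (max Y ‖q‖)
        + 2 * (G.wMax lam * ((1 + 8 / G.h ^ 2) ^ 2 * (1 ^ 2 / G.h ^ 2)))
        + 2 * (G.pertBound k₁ k₂ (max Y ‖q‖) * (G.small lam *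
          (G.n ^ 2 * (G.wMax lam * (1 ^ 2 / G.h ^ 2)))))), fun r hr => ?_⟩
  refine (Finset.abs_sum_le_sum_abs _ _).trans (Finset.sum_le_sum fun i _ =>
    (Finset.abs_sum_le_sum_abs _ _).trans (Finset.sum_le_sum fun l _ => ?_))
  refine (H'.abs_integral_derivDensity_le hl (le_max_right _ _) r i l).trans ?_
  have hm := mass_le_norm hl.le r
  gcongr
  refine hm.trans ?_
  gcongr

lemma cost_eq (θ : ℝ → ℝ) (V : HΩ G 2) (F : HK G k₁ k₂ 3) (lam : ℝ) (p : HK₀ G k₁ k₂) :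
    cost G k₁ k₂ θ V F lam p
      = Real.exp (2 * lam * G.d) * G.h ^ 2 * resid θ V lam (p.1 + trunc F) := by
  simp only [cost, resid, costDensity, ← Finset.mul_sum]
  ring

/-- A functional with a bounded linear first order part and a quadratic remainder has a
gradient. -/
lemma exists_hasFrechetGrad {E : Type*} [NormedAddCommGroup E] [InnerProductSpace ℝ E]
    [CompleteSpace E] {J f : E → ℝ} {p : E} {C C' : ℝ} (hadd : ∀ r r', f (r + r') = f r + f r')
    (hsmul : ∀ (a : ℝ) r, f (a • r) = a * f r) (hf : ∀ r, ‖r‖ ≤ 1 → |f r| ≤ C)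
    (h : ∀ r, ‖r‖ ≤ 1 → |J (p + r) - J p - f r| ≤ C' * ‖r‖ ^ 2) :
    ∃ X : E, HasFrechetGrad J X p ∧ ∀ r, inner ℝ X r = f r := by
  let g : E →ₗ[ℝ] ℝ := { toFun := f, map_add' := hadd, map_smul' := hsmul }
  -- Boundedness on the unit ball makes the linear part continuous, and Riesz represents it. The
  -- remainder `O(‖r‖²)` is then `o(‖r‖)`.
  let g' : E →L[ℝ] ℝ := g.mkContinuous (C / 1) fun r => LinearMap.bound_of_ball_bound' one_pos
    C g (fun z hz => hf z (by simpa using hz)) r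
  have hX : ∀ r, inner ℝ ((InnerProductSpace.toDual ℝ E).symm g') r = f r :=
    fun r => InnerProductSpace.toDual_symm_apply
  refine ⟨(InnerProductSpace.toDual ℝ E).symm g', ?_, hX⟩
  unfold HasFrechetGrad
  rw [hasFDerivAt_iff_isLittleO_nhds_zero]
  have h1 : (fun r => J (p + r) - J p - innerSL ℝ ((InnerProductSpace.toDual ℝ E).symm g') r)
      =O[nhds 0] fun r : E => ‖r‖ ^ 2 := by
    refine Asymptotics.IsBigO.of_bound C' ?_
    filter_upwards [Metric.closedBall_mem_nhds (0 : E) one_pos] with r hr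
    rw [Real.norm_eq_abs, Real.norm_of_nonneg (sq_nonneg _), innerSL_apply_apply, hX]
    exact h r (by simpa using hr)
  exact h1.trans_isLittleO (Asymptotics.isLittleO_norm_pow_id one_lt_two)

lemma Coeff.exists_frechetGrad (H : Coeff G k₁ k₂ θ V Y) (F : HK G k₁ k₂ 3) {lam : ℝ}
    (hl : 0 < lam) (p : HK₀ G k₁ k₂) :
    ∃ X : HK₀ G k₁ k₂, HasFrechetGrad (cost G k₁ k₂ θ V F lam) X p ∧ ∀ r, inner ℝ X r
      = Real.exp (2 * lam * G.d) * G.h ^ 2 * residDeriv θ V lam (p.1 + trunc F) r.1 := by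
  have hh := G.h_pos
  set q := p.1 + trunc F with hqdef
  -- Differentiability is local: this bound covers `q + r` for all `‖r‖ ≤ 1`, with no restriction on
  -- `p`.
  set Z := max Y (‖q‖ + 1)
  have H' : Coeff G k₁ k₂ θ V Z :=
    ⟨H.pos, H.lt, H.meas, H.bound, H.norm_le.trans (le_max_left _ _)⟩
  have hw : 0 ≤ G.wMax lam := (Real.exp_pos _).le
  have hs := G.small_nonneg hl
  have hP := H'.pertBound_nonneg
  have hQ := H'.quadBound_nonneg
  set B := G.pertBound k₁ k₂ Z + G.quadBound k₁ k₂ Z with hB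
  have hB0 : 0 ≤ B := add_nonneg hP hQ
  obtain ⟨C, hC⟩ := H.exists_residDeriv_bound hl q
  have hc : 0 ≤ Real.exp (2 * lam * G.d) * G.h ^ 2 := by positivity
  refine exists_hasFrechetGrad (C := Real.exp (2 * lam * G.d) * G.h ^ 2 * C)
    (fun r r' => by rw [H.residDeriv_add hl, mul_add])
    (fun a r => by rw [residDeriv_smul]; ring)
    (fun r hr => by
      rw [abs_mul, abs_of_nonneg hc]
      exact mul_le_mul_of_nonneg_left (hC r hr) hc)
    (C' := Real.exp (2 * lam * G.d) * G.h ^ 2 *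
    (2 * (G.n ^ 2 * (G.wMax lam * ((1 + 8 / G.h ^ 2) ^ 2 * (1 / G.h ^ 2))))
      + G.n ^ 2 * (2 * B * (G.small lam * (G.n ^ 2 * (G.wMax lam * (1 / G.h ^ 2))))))) ?_
  intro r hr
  have hq : ‖q‖ ≤ Z := le_max_of_le_right (by linarith)
  have hqr : ‖q + r.1‖ ≤ Z := by
    refine (norm_add_le _ _).trans (le_max_of_le_right ?_)
    have : ‖r.1‖ ≤ 1 := hr
    linarith
  have hb := H'.resid_bounds hl hq r hqr
  rw [← hB] at hb
  have hm := mass_le_norm hl.le r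
  have hm0 := mass_nonneg lam r
  have hL := lapMass_le_norm hl.le r.1
  have hL0 := lapMass_nonneg lam r.1
  have e2 : (p + r).1 + trunc F = q + r.1 := by
    rw [hqdef, Submodule.coe_add]
    abel
  rw [cost_eq, cost_eq, e2, ← mul_sub, ← mul_sub, abs_mul, abs_of_nonneg hc,
    mul_assoc _ _ (‖r‖ ^ 2)]
  refine mul_le_mul_of_nonneg_left ?_ hc
  have h3 : 2 * lapMass lam r.1 + G.n ^ 2 * (2 * B * (G.small lam * mass lam r))
      ≤ 2 * (G.n ^ 2 * (G.wMax lam * ((1 + 8 / G.h ^ 2) ^ 2 * (‖r.1‖ ^ 2 / G.h ^ 2))))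
        + G.n ^ 2 * (2 * B * (G.small lam * (G.n ^ 2 * (G.wMax lam * (‖r‖ ^ 2 / G.h ^ 2))))) := by
    gcongr
  have h4 : 0 ≤ G.n ^ 2 * (B * (G.small lam * mass lam r)) := by positivity
  have h5 : |resid θ V lam (q + r.1) - resid θ V lam q - residDeriv θ V lam q r.1|
      ≤ 2 * lapMass lam r.1 + G.n ^ 2 * (2 * B * (G.small lam * mass lam r)) := by
    rw [abs_le]
    exact ⟨by linarith [hb.1], hb.2⟩
  refine h5.trans (h3.trans (le_of_eq ?_))
  rw [← Submodule.coe_norm]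
  ring

/-- The threshold beyond which the functional is convex. -/
def Box.convexParam (G : Box) (k₁ k₂ Y : ℝ) : ℝ :=
  G.carlemanParam + 32 * (G.n ^ 2 * (G.pertBound k₁ k₂ Y + G.quadBound k₁ k₂ Y))
    * (1 + 1 / G.h) ^ 2

lemma Coeff.carlemanParam_le (H : Coeff G k₁ k₂ θ V Y) :
    G.carlemanParam ≤ G.convexParam k₁ k₂ Y := by
  have hP := H.pertBound_nonneg
  have hQ := H.quadBound_nonneg
  unfold Box.convexParam
  refine le_add_of_nonneg_right ?_
  positivity

/-- For `lam ≥ 1`, `small lam ≤ 2 (1 + 1/h)² / lam`, whence the factor `32` in `convexParam`. The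
bound `1/16` is half of the `1/8` that the Carleman estimate provides. -/
lemma Coeff.small_le (H : Coeff G k₁ k₂ θ V Y) {lam : ℝ} (hl : G.convexParam k₁ k₂ Y ≤ lam) :
    G.n ^ 2 * (G.pertBound k₁ k₂ Y + G.quadBound k₁ k₂ Y) * G.small lam ≤ 1 / 16 := by
  have hP := H.pertBound_nonneg
  have hQ := H.quadBound_nonneg
  have hh := G.h_pos
  have h1 : 2 ≤ lam := G.two_le_carlemanParam.trans (H.carlemanParam_le.trans hl)
  have h0 : 0 < lam := by linarith
  set B := G.n ^ 2 * (G.pertBound k₁ k₂ Y + G.quadBound k₁ k₂ Y) with hB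
  have hB0 : 0 ≤ B := by positivity
  have h2 : 32 * B * (1 + 1 / G.h) ^ 2 ≤ lam := by
    unfold Box.convexParam at hl
    linarith [G.two_le_carlemanParam]
  have h3 : (1 + 1 / lam) ^ 2 ≤ 2 ^ 2 := by
    have : 1 / lam ≤ 1 := by
      rw [div_le_one h0]
      linarith
    have h4 : 0 ≤ 1 / lam := by positivity
    exact pow_le_pow_left₀ (by linarith) (by linarith) 2
  calc B * G.small lam ≤ B * ((1 + 1 / G.h) ^ 2 * 2 ^ 2 / (2 * lam)) := by
        unfold Box.small
        gcongr
    _ = 32 * B * (1 + 1 / G.h) ^ 2 / lam * (1 / 16) := by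
        field_simp
        ring
    _ ≤ 1 * (1 / 16) := by
        gcongr
        rwa [div_le_one h0]
    _ = 1 / 16 := one_mul _

/-- The constant of strong convexity. -/
def Box.convexConst (G : Box) : ℝ := G.h ^ 2 / (16 * G.normConst)

lemma Box.convexConst_pos (G : Box) : 0 < G.convexConst := by
  have h1 := G.h_pos
  have h2 := G.normConst_pos
  unfold Box.convexConst
  positivity

/-- The strong convexity estimate. -/
lemma Coeff.convex_estimate (H : Coeff G k₁ k₂ θ V Y) {lam : ℝ}
    (hl : G.convexParam k₁ k₂ Y ≤ lam) {q : HK G k₁ k₂ 2} (hq : ‖q‖ ≤ Y) (r : HK₀ G k₁ k₂)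
    (hqr : ‖q + r.1‖ ≤ Y) :
    G.convexConst * ‖r‖ ^ 2 ≤ Real.exp (2 * lam * G.d) * G.h ^ 2 *
      (resid θ V lam (q + r.1) - resid θ V lam q - residDeriv θ V lam q r.1) := by
  have hc : G.carlemanParam ≤ lam := H.carlemanParam_le.trans hl
  have h2 : 2 ≤ lam := G.two_le_carlemanParam.trans hc
  have h0 : 0 < lam := by linarith
  have hh := G.h_pos
  have hN := G.normConst_pos
  have h1 := (H.resid_bounds h0 hq r hqr).1
  have h3 := mass_le_lapMass hc r
  have h4 := norm_sq_le_mass (by linarith : 1 ≤ lam) r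
  have hm := mass_nonneg lam r
  have h5 := mul_le_mul_of_nonneg_right (H.small_le hl) hm
  -- By Carleman `½ lapMass ≥ ⅛ mass`, and the perturbation takes at most `1/16` of `mass`.
  have h6 : 1 / 16 * mass lam r
      ≤ resid θ V lam (q + r.1) - resid θ V lam q - residDeriv θ V lam q r.1 := by
    refine le_trans ?_ h1
    have e : G.n ^ 2 * (G.pertBound k₁ k₂ Y + G.quadBound k₁ k₂ Y) * G.small lam * mass lam r
        = G.n ^ 2 * ((G.pertBound k₁ k₂ Y + G.quadBound k₁ k₂ Y) * (G.small lam * mass lam r)) := by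
      ring
    rw [e] at h5
    linarith
  calc _ ≤ G.convexConst * (G.normConst * (Real.exp (2 * lam * G.d) * mass lam r)) := by
        have := G.convexConst_pos
        gcongr
    _ = Real.exp (2 * lam * G.d) * G.h ^ 2 * (1 / 16 * mass lam r) := by
        unfold Box.convexConst
        field_simp
    _ ≤ _ := by gcongr

lemma norm_trunc_le (F : HK G k₁ k₂ 3) : ‖trunc F‖ ≤ ‖F‖ := by
  refine (sq_le_sq₀ (norm_nonneg _) (norm_nonneg _)).1 ?_
  rw [norm_sq_eq_sum, norm_sq_eq_sum, Fintype.sum_prod_type, Fintype.sum_prod_type]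
  refine Finset.sum_le_sum fun j _ => ?_
  rw [Fintype.sum_prod_type, Fintype.sum_prod_type]
  refine Finset.sum_le_sum fun s _ => ?_
  rw [Fin.sum_univ_castSucc (n := 3)]
  exact le_add_of_nonneg_right (mul_nonneg (sq_nonneg _) (integral_nonneg fun _ => sq_nonneg _))

/-- A quadratic lower bound for the first order remainder implies strict convexity. -/
lemma strictConvexOn_of_remainder {E : Type*} [NormedAddCommGroup E] [InnerProductSpace ℝ E]
    {J : E → ℝ} {g : E → E} {C R : ℝ} (hC : 0 < C)
    (h : ∀ p r : E, ‖p‖ ≤ R → ‖p + r‖ ≤ R → C * ‖r‖ ^ 2 ≤ J (p + r) - J p - inner ℝ (g p) r) :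
    StrictConvexOn ℝ (Metric.closedBall (0 : E) R) J := by
  refine ⟨convex_closedBall 0 R, ?_⟩
  intro x hx y hy hxy a b ha hb hab
  have hz := convex_closedBall (0 : E) R hx hy ha.le hb.le hab
  set z := a • x + b • y with hzdef
  rw [mem_closedBall_zero_iff] at hx hy hz
  -- Both increments start at the convex combination `z`; the gradient terms cancel after weighting
  -- with `a` and `b`.
  have h1 := h z (x - z) hz (by rwa [add_sub_cancel])
  have h2 := h z (y - z) hz (by rwa [add_sub_cancel])
  rw [add_sub_cancel] at h1 h2
  have e : a * inner ℝ (g z) (x - z) + b * inner ℝ (g z) (y - z) = 0 := by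
    rw [← real_inner_smul_right, ← real_inner_smul_right, ← inner_add_right]
    have : a • (x - z) + b • (y - z) = 0 := by
      calc a • (x - z) + b • (y - z) = a • x + b • y - (a + b) • z := by module
        _ = 0 := by rw [hab, one_smul, hzdef, sub_self]
    rw [this, inner_zero_right]
  have hpos : 0 < ‖x - z‖ ^ 2 := by
    have : x - z ≠ 0 := by
      have e2 : x - z = b • (x - y) := by
        rw [hzdef, eq_sub_iff_add_eq.2 hab]
        module
      rw [e2]
      exact smul_ne_zero hb.ne' (sub_ne_zero.2 hxy)
    have := norm_pos_iff.2 this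
    positivity
  have h3 := mul_pos ha (mul_pos hC hpos)
  have h4 : 0 ≤ b * (C * ‖y - z‖ ^ 2) := by positivity
  have h5 := mul_le_mul_of_nonneg_left h1 ha.le
  have h6 := mul_le_mul_of_nonneg_left h2 hb.le
  simp only [smul_eq_mul]
  have e3 : a * J z + b * J z = J z := by rw [← add_mul, hab, one_mul]
  nlinarith

/-- The functional has a gradient, and beyond the threshold it is strongly convex on balls. -/
theorem Coeff.exists_gradient_convex (H : Coeff G k₁ k₂ θ V Y) {F : HK G k₁ k₂ 3} {R : ℝ}
    (hF : R + ‖trunc F‖ ≤ Y) {lam : ℝ} (hlam : 0 < lam) :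
    ∃ J' : HK₀ G k₁ k₂ → HK₀ G k₁ k₂,
      (∀ p, HasFrechetGrad (cost G k₁ k₂ θ V F lam) (J' p) p) ∧
      (G.convexParam k₁ k₂ Y ≤ lam →
        (∀ p r : HK₀ G k₁ k₂, ‖p‖ ≤ R → ‖p + r‖ ≤ R →
          G.convexConst * ‖r‖ ^ 2 ≤ cost G k₁ k₂ θ V F lam (p + r)
            - cost G k₁ k₂ θ V F lam p - inner ℝ (J' p) r) ∧
        StrictConvexOn ℝ (Metric.closedBall (0 : HK₀ G k₁ k₂) R) (cost G k₁ k₂ θ V F lam)) := by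
  choose J' hJ' hJ'inner using fun p => H.exists_frechetGrad F hlam p
  refine ⟨J', hJ', fun hlam₁ => ?_⟩
  have hq : ∀ p : HK₀ G k₁ k₂, ‖p‖ ≤ R → ‖p.1 + trunc F‖ ≤ Y := by
    intro p hp
    have h1 := norm_add_le p.1 (trunc F)
    have h2 : ‖p.1‖ ≤ R := hp
    linarith
  have hmain : ∀ p r : HK₀ G k₁ k₂, ‖p‖ ≤ R → ‖p + r‖ ≤ R →
      G.convexConst * ‖r‖ ^ 2 ≤ cost G k₁ k₂ θ V F lam (p + r)
        - cost G k₁ k₂ θ V F lam p - inner ℝ (J' p) r := by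
    intro p r hp hpr
    have e : (p + r).1 + trunc F = p.1 + trunc F + r.1 := by
      rw [Submodule.coe_add]
      abel
    have h1 := hq (p + r) hpr
    rw [e] at h1
    rw [cost_eq, cost_eq, hJ'inner, e, ← mul_sub, ← mul_sub]
    exact H.convex_estimate hlam₁ (hq p hp) r h1
  exact ⟨hmain, strictConvexOn_of_remainder (E := HK₀ G k₁ k₂) (J := cost G k₁ k₂ θ V F lam)
    (g := J') G.convexConst_pos hmain⟩

/-- The range of the parameter `k` and the choice of `θ` are admissible. -/
lemma Coeff.of_norm_le (hk₁ : 0 < k₁) (hk : k₁ < k₂) (hθ : θ = (fun _ => 1) ∨ θ = fun k => k)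
    (hV : ‖V‖ ≤ Y) : Coeff G k₁ k₂ θ V Y := by
  refine ⟨hk₁, hk, ?_, ?_, hV⟩
  · rcases hθ with rfl | rfl <;> fun_prop
  · intro k hkm
    have h1 : 0 < k := hk₁.trans hkm.1
    have h2 : k < k₂ := hkm.2
    rcases hθ with rfl | rfl
    · simp only [abs_one]
      linarith
    · simp only [abs_of_pos h1]
      linarith

end Functional

end SemiDiscrete

end

/-! ### Choice of the parameters and assembly -/

theorem theorem7p3 (G : SemiDiscrete.Box) :
    ∃ lam₀ : ℝ, 1 < lam₀ ∧
      (∃ C : ℝ, 0 < C ∧ ∀ lam : ℝ, lam₀ ≤ lam → SemiDiscrete.CarlemanEstimate G C lam) ∧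
    ∀ (k₁ k₂ : ℝ), 0 < k₁ → k₁ < k₂ →
    ∀ θ : ℝ → ℝ, (θ = (fun _ => 1) ∨ θ = (fun k => k)) →
    ∀ R : ℝ, 0 < R → ∀ normF normV : ℝ,
    ∃ lam₁ : ℝ, lam₀ ≤ lam₁ ∧ ∃ C₁ : ℝ, 0 < C₁ ∧
    ∀ δ : ℝ, 0 < δ → δ < Real.exp (-2 * (G.d + G.ξ) * lam₁) →
    -- the data of the tail problem
    ∀ (ψ₀ ψ₁ ψ₀s ψ₁s : Fin G.n → Fin G.n → Unit → ℂ) (Q Qs Vs : SemiDiscrete.HΩ G 2),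
      SemiDiscrete.HasBC Q ψ₀ ψ₁ → SemiDiscrete.HasBC Qs ψ₀s ψ₁s → ‖Q - Qs‖ < δ →
      SemiDiscrete.HasBC Vs ψ₀s ψ₁s →
      (∀ i l, ∀ᵐ x ∂(G.dom (MeasureTheory.Measure.dirac ())), SemiDiscrete.lap Vs i l x = 0) →
      ‖Vs‖ = normV →
    -- the data of the integro-differential problem
    ∀ (φ₀ φ₁ φ₀s φ₁s : Fin G.n → Fin G.n → ℝ → ℂ) (F Fs : SemiDiscrete.HK G k₁ k₂ 3),
      SemiDiscrete.HasBC (SemiDiscrete.trunc F) φ₀ φ₁ →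
      SemiDiscrete.HasBC (SemiDiscrete.trunc Fs) φ₀s φ₁s → ‖F - Fs‖ < δ →
      ‖Fs‖ = normF →
    -- the tail function is `W + Q` with the unique minimizer `W`
    (∃! W : SemiDiscrete.HΩ₀ G,
      IsMinOn (SemiDiscrete.tailCost G Q (SemiDiscrete.tailParam G δ)) Set.univ W) ∧
    ∀ W : SemiDiscrete.HΩ₀ G,
      IsMinOn (SemiDiscrete.tailCost G Q (SemiDiscrete.tailParam G δ)) Set.univ W →
    ∀ lam : ℝ, 0 < lam →
      -- the functional is given by convergent integrals
      (∀ (p : SemiDiscrete.HK₀ G k₁ k₂) (i l : Fin G.n),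
        MeasureTheory.Integrable
          (SemiDiscrete.costDensity G k₁ k₂ θ (W.1 + Q) F lam p i l)
          (G.dom (MeasureTheory.volume.restrict (Set.Ioo k₁ k₂)))) ∧
      -- the Fréchet derivative, represented by an element of the space, and the convexity
      ∃ J' : SemiDiscrete.HK₀ G k₁ k₂ → SemiDiscrete.HK₀ G k₁ k₂,
        (∀ p, SemiDiscrete.HasFrechetGrad
          (SemiDiscrete.cost G k₁ k₂ θ (W.1 + Q) F lam) (J' p) p) ∧
        (lam₁ ≤ lam →
          (∀ p r : SemiDiscrete.HK₀ G k₁ k₂, ‖p‖ ≤ R → ‖p + r‖ ≤ R →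
            C₁ * ‖r‖ ^ 2 ≤
              SemiDiscrete.cost G k₁ k₂ θ (W.1 + Q) F lam (p + r)
                - SemiDiscrete.cost G k₁ k₂ θ (W.1 + Q) F lam p
                - inner ℝ (J' p) r) ∧
          StrictConvexOn ℝ (Metric.closedBall (0 : SemiDiscrete.HK₀ G k₁ k₂) R)
            (SemiDiscrete.cost G k₁ k₂ θ (W.1 + Q) F lam)) := by
  refine ⟨G.carlemanParam, by linarith [G.two_le_carlemanParam],
    ⟨G.carlemanConst, G.carlemanConst_pos, fun lam hl => SemiDiscrete.carlemanEstimate hl⟩, ?_⟩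
  intro k₁ k₂ hk₁ hk θ hθ R hR normF normV
  -- One radius for both uses: the first bracket bounds `p + F` (as `δ ≤ 1`), the second the tail.
  -- It depends on the exact data only, so the threshold can be fixed before `δ`. Absolute values
  -- keep it nonnegative for arbitrary real `normF` and `normV`.
  set Y : ℝ := (R + |normF| + 1) + (√G.tailConst + 1 + |normV|) with hY
  have hY1 : 0 ≤ R + |normF| + 1 := by positivity
  have hY2 : 0 ≤ √G.tailConst + 1 + |normV| := by positivity
  have hcoeff : ∀ V : SemiDiscrete.HΩ G 2, ‖V‖ ≤ Y → SemiDiscrete.Coeff G k₁ k₂ θ V Y :=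
    fun V hV => SemiDiscrete.Coeff.of_norm_le hk₁ hk hθ hV
  have hcar : G.carlemanParam ≤ G.convexParam k₁ k₂ Y :=
    (hcoeff 0 (by rw [norm_zero]; positivity)).carlemanParam_le
  refine ⟨G.convexParam k₁ k₂ Y, hcar, G.convexConst, G.convexConst_pos, ?_⟩
  intro δ hδ hδlt ψ₀ ψ₁ ψ₀s ψ₁s Q Qs Vs _ hQs hQ hVs hlap hnV φ₀ φ₁ φ₀s φ₁s F Fs _ _ hF hnF
  -- The smallness of `δ` means `μ(δ)` exceeds the convexity threshold, hence also the Carleman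
  -- threshold needed for the tail.
  have hμ : G.convexParam k₁ k₂ Y ≤ SemiDiscrete.tailParam G δ :=
    SemiDiscrete.le_tailParam hδ hδlt
  have hδ1 : δ ≤ 1 := by
    refine hδlt.le.trans (Real.exp_le_one_iff.2 ?_)
    have h1 : 0 < G.d + G.ξ := G.len_pos
    have h2 := G.two_le_carlemanParam
    nlinarith
  refine ⟨SemiDiscrete.existsUnique_tail Q (hcar.trans hμ), ?_⟩
  intro W hW lam hlam
  have hV : ‖W.1 + Q‖ ≤ Y := by
    have h1 := SemiDiscrete.norm_tail_le hδ hδ1 (hcar.trans hμ) hQs hQ hVs hlap hW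
    have h2 := le_abs_self normV
    rw [hnV] at h1
    linarith
  have H := hcoeff _ hV
  refine ⟨fun p i l => SemiDiscrete.Box.integrable_mul_exp lam (H.integrable_sq_Lop _ i l),
    H.exists_gradient_convex ?_ hlam⟩
  have h1 := SemiDiscrete.norm_trunc_le F
  have h2 := norm_le_norm_add_norm_sub' F Fs
  have h3 := le_abs_self normF
  linarith
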